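/- We work over $\mathbb{C}$. Let $C$ be a smooth projective (irreducible) curve and let $h : C \to \mathbb{P}^n$ be a generically injective morphism of degree $e = \deg h^*\mathcal{O}_{\mathbb{P}^n}(1)$. Consider the pulled back Euler sequence $$0 \to h^*\Omega_{\mathbb{P}^n}(1) \to \mathcal{O}_C^{\,n+1} \to h^*\mathcal{O}_{\mathbb{P}^n}(1) \to 0 .$$ By a surface scroll in $\mathbb{P}^n$ we mean an irreducible closed subset of dimension two that is swept out by lines (through each of its points there passes a line contained in it); its degree is its degree as a surface in $\mathbb{P}^n$. (1) Let $\pi : h^*\Omega_{\mathbb{P}^n}(1) \to Q$ be a line bundle quotient of degree $-m$, with kernel $S$, and put $Q' = \mathcal{O}_C^{\,n+1}/S$. Exclude the degenerate case in which $h(C)$ is a line and $m = e$. For each (closed) point $p \in C$ the fibre of $\mathbb{P}(Q')$ over $p$ is mapped to a line $\ell_p \subset \mathbb{P}^n$ that contains $h(p)$; the union $X = \bigcup_{p \in C} \ell_p$, that is, the image of $\mathbb{P}(Q') \to \mathbb{P}^n$, is a surface scroll in $\mathbb{P}^n$; it contains $h(C)$; and $\deg X \le e - m$. (2) Suppose that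 $h(C)$ is not a line, let $k$ be an integer, and suppose that $h(C)$ lies on no surface scroll of degree less than $k$. Then every coherent quotient sheaf of rank $1$ of $h^*\Omega_{\mathbb{P}^n}(1)$, not necessarily a line bundle, has degree at least $k - e$. -/

import Mathlib

open AlgebraicGeometry CategoryTheory CategoryTheory.Limits
open scoped LinearAlgebra.Projectivization

noncomputable section

namespace Scrolls

/-! ### Projective space -/

/-- The grading of `ℂ[x₀, …, xₙ]` by degree. -/
abbrev grading (n : ℕ) : ℕ → Submodule ℂ (MvPolynomial (Fin (n + 1)) ℂ) :=
  MvPolynomial.homogeneousSubmodule (Fin (n + 1)) ℂ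

instance gradedAlgebraGrading (n : ℕ) : GradedAlgebra (grading n) :=
  MvPolynomial.gradedAlgebra

/-- Projective space `ℙⁿ` over `ℂ`, as a scheme. -/
abbrev PSpace (n : ℕ) : Scheme.{0} := Proj (grading n)

/-- The structure morphism `ℙⁿ ⟶ Spec ℂ`. -/
def PSpace.toSpec (n : ℕ) : PSpace n ⟶ Spec (.of ℂ) :=
  Proj.toSpecZero (grading n) ≫ Spec.map (CommRingCat.ofHom (algebraMap ℂ (grading n 0)))

/-- The closed points of `ℙⁿ`: lines through the origin of `ℂⁿ⁺¹`. -/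
abbrev PPoints (n : ℕ) : Type := ℙ ℂ (Fin (n + 1) → ℂ)

/-- The homogeneous ideal of a set `S` of closed points of `ℙⁿ`
(the ideal of all polynomials that vanish on the cone over `S`). -/
def idealOf {n : ℕ} (S : Set (PPoints n)) : Ideal (MvPolynomial (Fin (n + 1)) ℂ) :=
  MvPolynomial.vanishingIdeal ℂ
    {v : Fin (n + 1) → ℂ | ∃ hv : v ≠ 0, Projectivization.mk ℂ v hv ∈ S}

/-- `S` is closed in the Zariski topology: it contains every point at which all elements of its
ideal vanish. -/
def IsZariskiClosed {n : ℕ} (S : Set (PPoints n)) : Prop :=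
  ∀ (v : Fin (n + 1) → ℂ) (hv : v ≠ 0),
    (∀ f ∈ idealOf S, MvPolynomial.eval v f = 0) → Projectivization.mk ℂ v hv ∈ S

/-- The scheme-theoretic point `y` of `ℙⁿ` lies on the closed subset with set of closed points
`S`: the homogeneous prime ideal of `y` contains the ideal of `S`. -/
def LiesOn {n : ℕ} (y : PSpace n) (S : Set (PPoints n)) : Prop :=
  idealOf S ≤ y.asHomogeneousIdeal.toIdeal

/-- The image of the morphism `h` is contained in the closed subset `S` of `ℙⁿ`. -/
def ImageIn {X : Scheme.{0}} {n : ℕ} (h : X ⟶ PSpace n) (S : Set (PPoints n)) : Prop :=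
  ∀ x : X, LiesOn (h x) S

/-- The linear subspace `ℙ(W) ⊆ ℙⁿ` given by a vector subspace `W ⊆ ℂⁿ⁺¹`. -/
def linearSubspace {n : ℕ} (W : Submodule ℂ (Fin (n + 1) → ℂ)) : Set (PPoints n) :=
  {x | x.submodule ≤ W}

/-- Lines in `ℙⁿ`. -/
def IsLine {n : ℕ} (S : Set (PPoints n)) : Prop :=
  ∃ W : Submodule ℂ (Fin (n + 1) → ℂ), Module.finrank ℂ W = 2 ∧ S = linearSubspace W

/-! ### Surface scrolls and their degree -/

/-- A surface in `ℙⁿ`: an irreducible closed subset of dimension two, that is, one whose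
homogeneous coordinate ring is a domain of Krull dimension three. -/
structure IsSurface {n : ℕ} (S : Set (PPoints n)) : Prop where
  isClosed : IsZariskiClosed S
  irreducible : (idealOf S).IsPrime
  dim_eq : ringKrullDim (MvPolynomial (Fin (n + 1)) ℂ ⧸ idealOf S) = 3

/-- A surface scroll in `ℙⁿ`: a surface swept out by lines. -/
structure IsSurfaceScroll {n : ℕ} (S : Set (PPoints n)) : Prop extends IsSurface S where
  ruled : ∀ x ∈ S, ∃ l : Set (PPoints n), IsLine l ∧ x ∈ l ∧ l ⊆ S

/-- The degree of a surface in `ℙⁿ`: the number of points in which it meets a general linear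
subspace of codimension two; this is the largest number of points in which it meets a linear
subspace of codimension two that it meets in only finitely many points. -/
def surfaceDegree {n : ℕ} (S : Set (PPoints n)) : ℕ∞ :=
  ⨆ (W : Submodule ℂ (Fin (n + 1) → ℂ)) (_ : Module.finrank ℂ W + 2 = n + 1)
    (_ : (S ∩ linearSubspace W).Finite), (S ∩ linearSubspace W).encard

/-! ### Sheaves of modules on a scheme, and the Euler sequence -/

section Modules

variable {X : Scheme.{0}}

/-- The structure sheaf `𝒪_X`, as a module over itself. -/
abbrev structureModule (X : Scheme.{0}) : X.Modules := SheafOfModules.unit X.ringCatSheaf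

/-- The free module `𝒪_X^I`. -/
abbrev freeModule (X : Scheme.{0}) (I : Type) : X.Modules :=
  SheafOfModules.free (R := X.ringCatSheaf) I

/-- Restrictions of functions compose. -/
lemma map_map_apply {U V W : X.Opensᵒᵖ} (f : U ⟶ V) (g : V ⟶ W) (k : U ⟶ W) (t : X.presheaf.obj U) :
    (X.presheaf.map g).hom ((X.presheaf.map f).hom t) = (X.presheaf.map k).hom t := by
  have hk : k = f ≫ g := Subsingleton.elim _ _
  rw [hk, X.presheaf.map_comp]
  rfl

/-- The pushforward `j_* 𝒪_U` along the inclusion `j : U ⟶ X` of an open subscheme. -/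
abbrev extendedFunctions (U : X.Opens) : X.Modules :=
  (Scheme.Modules.pushforward U.ι).obj (structureModule U)

/-- A function `t` on `U`, as a global section of `j_* 𝒪_U`: its restriction to each `U ∩ V`. -/
def sectionOfFunction (U : X.Opens) (t : Γ(X, U)) : (extendedFunctions U).val.sections :=
  PresheafOfModules.sectionsMk
    (fun V ↦ (X.presheaf.map (homOfLE
      (U.ι_image_le (U.ι ⁻¹ᵁ V.unop)) : U.ι ''ᵁ (U.ι ⁻¹ᵁ V.unop) ⟶ U).op).hom t)
    (fun V W f ↦ by
      exact map_map_apply (X := X) _ _ _ t)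

/-- The function `h^*(x_i / x_j)` on `h⁻¹(D₊(x_j))`. -/
def coordFn {n : ℕ} (h : X ⟶ PSpace n) (i j : Fin (n + 1)) :
    Γ(X, h ⁻¹ᵁ Proj.basicOpen (grading n) (MvPolynomial.X j)) :=
  (h.app (Proj.basicOpen (grading n) (MvPolynomial.X j))).hom
    ((Proj.awayToSection (grading n) (MvPolynomial.X j)).hom
      (HomogeneousLocalization.Away.mk (grading n) (d := 1)
        (MvPolynomial.isHomogeneous_X ℂ j) 1 (MvPolynomial.X i)
        (by simpa using MvPolynomial.isHomogeneous_X ℂ i)))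

/-- The pullback along `h : X ⟶ ℙⁿ` of the evaluation map `𝒪^{n+1} ⟶ 𝒪(1)`, `e_i ↦ x_i`.
Here a section `σ` of `h^* 𝒪(1)` is recorded by the functions `σ / x_j` on `h⁻¹(D₊(x_j))`,
`0 ≤ j ≤ n`, which embeds `h^* 𝒪(1)` in the product of the sheaves `j_* 𝒪` of these open sets;
so `e_i` is sent to the family of the functions `h^*(x_i / x_j)`. -/
def eulerMap {n : ℕ} (h : X ⟶ PSpace n) :
    freeModule X (Fin (n + 1)) ⟶
      ∏ᶜ fun j : Fin (n + 1) ↦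
        extendedFunctions (h ⁻¹ᵁ Proj.basicOpen (grading n) (MvPolynomial.X j)) :=
  Pi.lift fun j ↦ (SheafOfModules.freeHomEquiv _).symm
    fun i ↦ sectionOfFunction _ (coordFn h i j)

/-- The line bundle `h^* 𝒪(1)`: the image of the evaluation map, since `𝒪(1)` is generated by
the sections `x_i`. -/
def pullbackOOne {n : ℕ} (h : X ⟶ PSpace n) : X.Modules := Abelian.image (eulerMap h)

/-- The vector bundle `h^* Ω(1)`, the kernel in the pullback of the Euler sequence
`0 ⟶ h^* Ω(1) ⟶ 𝒪^{n+1} ⟶ h^* 𝒪(1) ⟶ 0`. -/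
def pullbackOmegaOne {n : ℕ} (h : X ⟶ PSpace n) : X.Modules := kernel (eulerMap h)

/-- The inclusion `h^* Ω(1) ⟶ 𝒪^{n+1}` of the Euler sequence. -/
def eulerInclusion {n : ℕ} (h : X ⟶ PSpace n) :
    pullbackOmegaOne h ⟶ freeModule X (Fin (n + 1)) := kernel.ι (eulerMap h)

/-- The module structure of the stalk `M_x` over the local ring `𝒪_{X,x}`. -/
instance stalkModule (M : X.Modules) (x : X) :
    Module (X.presheaf.stalk x) (M.presheaf.stalk x) :=
  PresheafOfModules.instModuleCarrierStalkCommRingCatCarrierAbPresheafOpensCarrier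
    (X := X) (R := X.presheaf) M.val x

/-! ### Rank and degree on a curve -/

/-- The stalk of `M` at the generic point, a vector space over the function field. Its elements
are the rational sections of `M`. -/
abbrev genericStalk [IsIntegral X] (M : X.Modules) : Type :=
  M.presheaf.stalk (genericPoint X)

/-- `M` has rank one. -/
def IsRankOne [IsIntegral X] (M : X.Modules) : Prop :=
  Module.finrank X.functionField (genericStalk M) = 1

/-- `M` is a line bundle: it is locally free of rank one. -/
def IsLineBundle [IsIntegral X] (M : X.Modules) : Prop :=
  SheafOfModules.IsLocallyFree M ∧ IsRankOne M

/-- The map from the stalk at `p` to the stalk at the generic point. -/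
def toGenericStalk [IsIntegral X] (M : X.Modules) (p : X) : M.presheaf.stalk p → genericStalk M :=
  fun q ↦ (M.presheaf.stalkSpecializes ((genericPoint_spec X).specializes trivial)).hom q

/-- `d` is the contribution of the point `p` to the degree of a coherent sheaf `M` of rank one,
computed with the nonzero rational section `s`. If `a ∈ 𝒪_p` is nonzero and `a s` comes from
`q ∈ M_p`, this is `length (M_p / 𝒪_p q) - length (𝒪_p / a 𝒪_p)`. For `M_p` free with generator
`g` and `s = f g` it is the order of `f` at `p`; in general it is the sum of the order at `p` of `s`
as a rational section of `M / torsion` and the length of the torsion submodule of `M_p`. -/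
def IsLocalDegree [IsIntegral X] (M : X.Modules) (s : genericStalk M) (p : X) (d : ℤ) : Prop :=
  ∃ (a : X.presheaf.stalk p) (q : M.presheaf.stalk p) (lq la : ℕ),
    a ≠ 0 ∧
    toGenericStalk M p q = algebraMap (X.presheaf.stalk p) X.functionField a • s ∧
    Module.length (X.presheaf.stalk p)
      (M.presheaf.stalk p ⧸ Submodule.span (X.presheaf.stalk p) {q}) = lq ∧
    Module.length (X.presheaf.stalk p) (X.presheaf.stalk p ⧸ Ideal.span {a}) = la ∧
    d = (lq : ℤ) - la

/-- The coherent sheaf `M` of rank one on the smooth projective curve `X` has degree `d`: for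
some nonzero rational section, the local contributions of the closed points are almost all zero
and add up to `d`. -/
def HasDegree [IsIntegral X] (M : X.Modules) (d : ℤ) : Prop :=
  ∃ s : genericStalk M, s ≠ 0 ∧
    ∃ D : {p : X // IsClosed ({p} : Set X)} →₀ ℤ,
      (∀ p, IsLocalDegree M s p.1 (D p)) ∧ D.sum (fun _ k ↦ k) = d

/-! ### The lines attached to a quotient of `h^* Ω(1)` -/

/-- The complex number `a` as a function on a scheme over `ℂ`. -/
def constFn (c : X ⟶ Spec (.of ℂ)) (a : ℂ) : Γ(X, ⊤) :=
  c.appTop.hom ((Scheme.ΓSpecIso (.of ℂ)).inv.hom a)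

/-- A function `t` on `X`, as a global section of the module `𝒪_X`. -/
def globalSection (t : Γ(X, ⊤)) : (structureModule X).sections :=
  PresheafOfModules.sectionsMk
    (fun V ↦ (X.presheaf.map (homOfLE le_top : V.unop ⟶ (⊤ : X.Opens)).op).hom t)
    (fun V W f ↦ by
      exact map_map_apply (X := X) _ _ _ t)

/-- The morphism `𝒪^{n+1} ⟶ 𝒪`, `(a_0, …, a_n) ↦ ∑ a_i v_i`, for `v ∈ ℂⁿ⁺¹`. -/
def pairing {n : ℕ} (c : X ⟶ Spec (.of ℂ)) (v : Fin (n + 1) → ℂ) :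
    freeModule X (Fin (n + 1)) ⟶ structureModule X :=
  (SheafOfModules.freeHomEquiv _).symm fun i ↦ globalSection (constFn c (v i))

/-- The fibre over `p` of `ℙ(Q') ⟶ ℙⁿ`, where `Q' = 𝒪^{n+1} / S` and `S ⊆ 𝒪^{n+1}` is the
image of `σ : S ⟶ 𝒪^{n+1}`: it consists of the points `[v]` such that `∑ a_i(p) v_i = 0` for all
local sections `(a_0, …, a_n)` of `S` at `p`. -/
def fibreAt {n : ℕ} (c : X ⟶ Spec (.of ℂ)) {S : X.Modules}
    (σ : S ⟶ freeModule X (Fin (n + 1))) (p : X) : Set (PPoints n) :=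
  {x | ∀ v : Fin (n + 1) → ℂ, ∀ hv : v ≠ 0, Projectivization.mk ℂ v hv = x →
    ∀ U : X.Opens, p ∈ U → ∀ s : Γ(S, U),
      p ∉ X.basicOpen (U := U) ((Scheme.Modules.Hom.app (σ ≫ pairing c v) U).hom s)}

/-- For a quotient `π : h^* Ω(1) ⟶ Q` with kernel `S`, the fibre over `p` of `ℙ(Q') ⟶ ℙⁿ`,
where `Q'` is the quotient of `𝒪^{n+1}` by `S ⊆ h^* Ω(1) ⊆ 𝒪^{n+1}`. -/
def quotientLine {n : ℕ} (h : X ⟶ PSpace n) {Q : X.Modules} (π : pullbackOmegaOne h ⟶ Q) (p : X) :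
    Set (PPoints n) :=
  fibreAt (h ≫ PSpace.toSpec n) (kernel.ι π ≫ eulerInclusion h) p

/-- The image of `ℙ(Q') ⟶ ℙⁿ`: the union of the fibres over the closed points. -/
def quotientScroll {n : ℕ} (h : X ⟶ PSpace n) {Q : X.Modules} (π : pullbackOmegaOne h ⟶ Q) :
    Set (PPoints n) :=
  ⋃ (p : X) (_ : IsClosed ({p} : Set X)), quotientLine h π p

end Modules

end Scrolls

end

open Scrolls

/-!
The proof takes place over the function field `K` of the curve `C`, whose closed points are the
places of `K`. Let `x ∈ Kⁿ⁺¹` be the generic point of the curve (`genericCoord`). At the generic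
point of `C`, the bundle `h^* Ω(1)` is the orthogonal complement of `x`, and a quotient `π` of rank
one is given by a vector `w ∈ Kⁿ⁺¹`, independent of `x` (`IsCoframe`). So `x` and `w` span a plane
`Λ ⊆ Kⁿ⁺¹`, and at each place `p` it has a reduction `red p Λ`, a plane in `ℂⁿ⁺¹`, that is, a line
in `ℙⁿ`. If the quotient is a line bundle, this is the line `ℓ_p` (`fibreAt_eq`), and `X` is the
union of these lines, `scroll Λ`. In general `scroll Λ` is the scroll of the quotient modulo
torsion.

*The scroll is a surface.* A polynomial vanishes on `scroll Λ` if and only if it vanishes on `Λ`, so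
the coordinate ring of `scroll Λ` is a subring of `K[s, t]`; it has dimension three, unless all lines
are equal. A point in the closure of the scroll is the center of a valuation of `K(s, t)`. The
restriction of that valuation to `K` is a place whose line contains the point, or it is trivial, and
then the point is a constant vector of `Λ` and lies on all the lines (`isSurfaceScroll_scroll`).
The curve lies on the scroll since `x ∈ Λ` (`imageIn_scroll`).

*Its degree.* Two linear equations of a subspace of codimension two restrict to functionals on `Λ`,
and the determinant of these is a section of a line bundle on the curve, of degree
`planeDegree x w`: minus the sum over all places of the least order of a `2 × 2` minor of the matrix
with rows `x` and `w`. Since a rational function has as many zeros as poles (`finsum_ord`), the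
section has that many zeros; these are the places whose line meets the subspace. So the degree of the
scroll is at most `planeDegree x w` (`surfaceDegree_scroll_le`).

*Comparison with the degrees of the bundles.* At a point where the coordinate `x_j` has least order,
`h^* 𝒪(1)` is generated by `x_j`, and `Q` modulo torsion by the minor with row `j` of least order,
divided by `x_j`. By a Plücker relation this minor has least order among all minors. Hence
`planeDegree x w ≤ e + deg Q`, with equality if `Q` is torsion-free, for torsion only raises the
degree (`planeDegree_le_add`).

*The degenerate case.* If all lines `red p Λ` are equal, then `planeDegree x w = 0`, and the curve is
contained in this line. If `Q` is a line bundle of degree `-m`, then `e = m` besides, and this is the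
excluded case.
-/

noncomputable section

namespace Scrolls

/-! ### Function fields in one variable and their places -/


/-- A function field in one variable over `ℂ`: a finitely generated field extension of transcendence
degree one. -/
class IsCurveField (K : Type) [Field K] [Algebra ℂ K] : Prop where
  essFiniteType : Algebra.EssFiniteType ℂ K
  trdeg_eq : Algebra.trdeg ℂ K = 1

section CurveField

open Polynomial IntermediateField

variable (K : Type) [Field K] [Algebra ℂ K]

/-- The places of `K`: the valuation rings of `K` that contain `ℂ`, other than `K` itself. -/
abbrev Place : Type := {V : ValuationSubring K // (∀ a : ℂ, algebraMap ℂ K a ∈ V) ∧ V ≠ ⊤}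

variable {K}

/-- `ℂ` is algebraically closed in `K`. -/
lemma transcendental_of_notMem_range {f : K} (hf : f ∉ Set.range (algebraMap ℂ K)) :
    Transcendental ℂ f := by
  intro h
  have hi : IsIntegral ℂ f := h.isIntegral
  have := IntermediateField.isAlgebraic_adjoin_simple hi
  obtain ⟨c, hc⟩ := (IsAlgClosed.algebraMap_bijective_of_isIntegral
    (k := ℂ) (K := ℂ⟮f⟯)).2 ⟨f, mem_adjoin_simple_self ℂ f⟩
  exact hf ⟨c, congrArg Subtype.val hc⟩

lemma finiteDimensional_over_adjoin [IsCurveField K] {f : K} (hf : Transcendental ℂ f) :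
    FiniteDimensional ℂ⟮f⟯ K := by
  have h1 := trdeg_add_eq ℂ ℂ⟮f⟯ (A := K)
  have hT : Algebra.Transcendental ℂ ℂ⟮f⟯ := ⟨⟨AdjoinSimple.gen ℂ f, by
    intro h
    exact hf (by simpa using h.algebraMap (A := K))⟩⟩
  have h2 : 1 ≤ Algebra.trdeg ℂ ℂ⟮f⟯ := Cardinal.one_le_iff_pos.mpr (trdeg_pos ℂ ℂ⟮f⟯)
  rw [IsCurveField.trdeg_eq (K := K)] at h1
  have h4 : Algebra.trdeg ℂ⟮f⟯ K = 0 := by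
    have h3 : Algebra.trdeg ℂ⟮f⟯ K ≤ 1 := h1 ▸ self_le_add_left _ _
    have h5 : Algebra.trdeg ℂ ℂ⟮f⟯ ≤ 1 := h1 ▸ self_le_add_right _ _
    obtain ⟨a, ha⟩ := Cardinal.lt_aleph0.mp (h3.trans_lt Cardinal.one_lt_aleph0)
    obtain ⟨b, hb⟩ := Cardinal.lt_aleph0.mp (h5.trans_lt Cardinal.one_lt_aleph0)
    rw [ha, hb] at h1
    rw [hb] at h2
    rw [ha]
    norm_cast at *
    omega
  have halg : Algebra.IsAlgebraic ℂ⟮f⟯ K := trdeg_eq_zero_iff.mp h4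
  have := IsCurveField.essFiniteType (K := K)
  have : Algebra.EssFiniteType ℂ⟮f⟯ K := Algebra.EssFiniteType.of_comp ℂ ℂ⟮f⟯ K
  obtain ⟨S, hS⟩ := IntermediateField.fg_top ℂ⟮f⟯ K
  have h6 : FiniteDimensional ℂ⟮f⟯ (IntermediateField.adjoin ℂ⟮f⟯ (S : Set K)) := by
    have : Finite (S : Set K) := S.finite_toSet
    exact finiteDimensional_adjoin (fun x _ ↦ (Algebra.IsAlgebraic.isAlgebraic x).isIntegral)
  rw [hS] at h6
  exact Module.Finite.equiv (IntermediateField.topEquiv (F := ℂ⟮f⟯) (E := K)).toLinearEquiv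

lemma exists_transcendental [IsCurveField K] : ∃ f : K, Transcendental ℂ f := by
  have h : 0 < Algebra.trdeg ℂ K := by
    rw [IsCurveField.trdeg_eq]; exact zero_lt_one
  have := trdeg_ne_zero_iff.mp h.ne'
  exact Algebra.Transcendental.transcendental

/-- The ring `ℂ[f]`. -/
abbrev polyRing (f : K) : Subalgebra ℂ K := Algebra.adjoin ℂ {f}

/-- The integral closure of `ℂ[f]` in the function field. -/
abbrev intRing (f : K) : Subalgebra (polyRing f) K := integralClosure (polyRing f) K

open scoped IntermediateField.algebraAdjoinAdjoin

lemma isPrincipalIdealRing_polyRing {f : K} (hf : Transcendental ℂ f) :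
    IsPrincipalIdealRing (polyRing f) :=
  IsPrincipalIdealRing.of_surjective (Polynomial.algEquivOfTranscendental ℂ f hf).toRingEquiv
    (Polynomial.algEquivOfTranscendental ℂ f hf).surjective

variable [IsCurveField K]

lemma finite_intRing {f : K} (hf : Transcendental ℂ f) :
    Module.Finite (polyRing f) (intRing f) := by
  have := finiteDimensional_over_adjoin hf
  have := isPrincipalIdealRing_polyRing hf
  have : CharZero ℂ⟮f⟯ := charZero_of_injective_algebraMap (algebraMap ℂ ℂ⟮f⟯).injective
  exact IsIntegralClosure.finite (polyRing f) ℂ⟮f⟯ K (intRing f)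

lemma free_intRing {f : K} (hf : Transcendental ℂ f) :
    Module.Free (polyRing f) (intRing f) := by
  have := finiteDimensional_over_adjoin hf
  have := isPrincipalIdealRing_polyRing hf
  have : CharZero ℂ⟮f⟯ := charZero_of_injective_algebraMap (algebraMap ℂ ℂ⟮f⟯).injective
  exact IsIntegralClosure.module_free (polyRing f) ℂ⟮f⟯ K (intRing f)

lemma finrank_intRing {f : K} (hf : Transcendental ℂ f) :
    Module.finrank (polyRing f) (intRing f) = Module.finrank ℂ⟮f⟯ K := by
  have := finiteDimensional_over_adjoin hf
  have := isPrincipalIdealRing_polyRing hf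
  have : CharZero ℂ⟮f⟯ := charZero_of_injective_algebraMap (algebraMap ℂ ℂ⟮f⟯).injective
  exact IsIntegralClosure.rank (polyRing f) ℂ⟮f⟯ K (intRing f)

lemma isDedekindDomain_intRing {f : K} (hf : Transcendental ℂ f) :
    IsDedekindDomain (intRing f) := by
  have := finiteDimensional_over_adjoin hf
  have := isPrincipalIdealRing_polyRing hf
  have : CharZero ℂ⟮f⟯ := charZero_of_injective_algebraMap (algebraMap ℂ ℂ⟮f⟯).injective
  exact integralClosure.isDedekindDomain (polyRing f) ℂ⟮f⟯ (L := K)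

lemma isFractionRing_intRing {f : K} (hf : Transcendental ℂ f) :
    IsFractionRing (intRing f) K := by
  have := finiteDimensional_over_adjoin hf
  exact integralClosure.isFractionRing_of_finite_extension (A := polyRing f) ℂ⟮f⟯ K

end CurveField

/-! ### Centers of places on the integral closure of a polynomial ring -/

section CurveField

open Polynomial IntermediateField

variable {K : Type} [Field K] [Algebra ℂ K]

/-- Valuation rings are integrally closed. -/
lemma valuationSubring_mem_of_isIntegral {K : Type*} [Field K] (V : ValuationSubring K)
    (A : Subring K) (hA : ∀ a ∈ A, a ∈ V) {x : K} (hx : IsIntegral A x) : x ∈ V := by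
  obtain ⟨p, hp, hpx⟩ := hx
  have hV : IsIntegral V x := by
    refine ⟨p.map (Subring.inclusion (show A ≤ V.toSubring from hA)), hp.map _, ?_⟩
    rw [eval₂_map]
    exact hpx
  obtain ⟨y, hy⟩ := IsIntegrallyClosed.algebraMap_eq_of_integral hV
  rw [← hy]
  exact y.2

lemma mem_of_mem_nonunits {K : Type*} [Field K] {V : ValuationSubring K} {x : K}
    (hx : x ∈ V.nonunits) : x ∈ V := V.nonunits_le hx

lemma inv_mem_of_notMem_nonunits {K : Type*} [Field K] {V : ValuationSubring K} {x : K}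
    (hx : x ∉ V.nonunits) : x⁻¹ ∈ V := by
  rw [ValuationSubring.mem_nonunits_iff, not_lt] at hx
  rw [← V.valuation_le_one_iff, map_inv₀]
  exact inv_le_one_of_one_le₀ hx

lemma inv_mem_nonunits_of_notMem {K : Type*} [Field K] {V : ValuationSubring K} {x : K}
    (hx : x ∉ V) : x⁻¹ ∈ V.nonunits := by
  rw [← V.valuation_le_one_iff, not_le] at hx
  rw [ValuationSubring.mem_nonunits_iff, map_inv₀]
  exact inv_lt_one_of_one_lt₀ hx

lemma one_notMem_nonunits {K : Type*} [Field K] (V : ValuationSubring K) :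
    (1 : K) ∉ V.nonunits := by
  rw [ValuationSubring.mem_nonunits_iff, map_one]; exact lt_irrefl _

lemma mul_mem_nonunits {K : Type*} [Field K] {V : ValuationSubring K} {x y : K}
    (hx : x ∈ V) (hy : y ∈ V.nonunits) : x * y ∈ V.nonunits := by
  rw [ValuationSubring.mem_nonunits_iff] at *
  rw [map_mul]
  exact (mul_le_of_le_one_left' ((V.valuation_le_one_iff x).2 hx)).trans_lt hy

lemma algebraMap_notMem_nonunits (V : Place K) {c : ℂ} (hc : c ≠ 0) :
    algebraMap ℂ K c ∉ V.1.nonunits := by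
  intro h
  have := mul_mem_nonunits (V.2.1 c⁻¹) h
  rw [← map_mul, inv_mul_cancel₀ hc, map_one] at this
  exact one_notMem_nonunits _ this

lemma polyRing_le (V : Place K) {f : K} (hf : f ∈ V.1) : ∀ b ∈ polyRing f, b ∈ V.1 := by
  intro b hb
  induction hb using Algebra.adjoin_induction with
  | mem x hx => rw [hx]; exact hf
  | algebraMap r => exact V.2.1 r
  | add x y _ _ hx hy => exact add_mem hx hy
  | mul x y _ _ hx hy => exact mul_mem hx hy

lemma intRing_le (V : Place K) {f : K} (hf : f ∈ V.1) : ∀ b ∈ intRing f, b ∈ V.1 := fun _ hb ↦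
  valuationSubring_mem_of_isIntegral V.1 (polyRing f).toSubring (polyRing_le V hf) hb

/-- The inclusion of the integral closure of `ℂ[f]` in a place at which `f` is regular. -/
def toPlace (V : Place K) {f : K} (hf : f ∈ V.1) : intRing f →+* V.1 where
  toFun b := ⟨b, intRing_le V hf b b.2⟩
  map_one' := rfl
  map_mul' _ _ := rfl
  map_zero' := rfl
  map_add' _ _ := rfl

/-- The center of a place on the integral closure of `ℂ[f]`. -/
def center (V : Place K) {f : K} (hf : f ∈ V.1) : Ideal (intRing f) :=
  (IsLocalRing.maximalIdeal V.1).comap (toPlace V hf)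

instance (V : Place K) {f : K} (hf : f ∈ V.1) : (center V hf).IsPrime :=
  Ideal.IsPrime.comap _

lemma mem_center {V : Place K} {f : K} {hf : f ∈ V.1} {b : intRing f} :
    b ∈ center V hf ↔ (b : K) ∈ V.1.nonunits := by
  rw [ValuationSubring.mem_nonunits_iff_exists_mem_maximalIdeal]
  exact ⟨fun h ↦ ⟨intRing_le V hf b b.2, h⟩, fun ⟨_, h⟩ ↦ h⟩

/-- The residue field of a place is `ℂ`. If `x - c` were a unit for all `c`, then all rational
functions of `x` would be regular at the place, and so would be the elements of `K`, which are
integral over `ℂ(x)`. -/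
lemma exists_algebraMap_sub_mem [IsCurveField K] (V : Place K) {x : K} (hx : x ∈ V.1) :
    ∃ c : ℂ, x - algebraMap ℂ K c ∈ V.1.nonunits := by
  by_contra! h
  have hx' : x ∉ Set.range (algebraMap ℂ K) := by
    rintro ⟨c, rfl⟩
    exact h c (by rw [sub_self, ValuationSubring.mem_nonunits_iff, map_zero]; exact zero_lt_one)
  have ht := transcendental_of_notMem_range hx'
  have := finiteDimensional_over_adjoin ht
  have hinv : ∀ p : ℂ[X], (aeval x p)⁻¹ ∈ V.1 := by
    intro p
    rw [(IsAlgClosed.splits p).eq_prod_roots, map_mul, mul_inv, aeval_C, ← map_inv₀]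
    refine mul_mem (V.2.1 _) ?_
    generalize p.roots = s
    induction s using Multiset.induction with
    | empty => simp
    | cons a s ih =>
      simp only [Multiset.map_cons, Multiset.prod_cons, map_mul, mul_inv]
      refine mul_mem (inv_mem_of_notMem_nonunits ?_) ih
      simpa using h a
  refine V.2.2 (top_unique fun y _ ↦ ?_)
  refine valuationSubring_mem_of_isIntegral V.1 ℂ⟮x⟯.toSubalgebra.toSubring ?_
    (Algebra.IsIntegral.isIntegral (R := ℂ⟮x⟯) y)
  intro a ha
  obtain ⟨r, s, rfl⟩ := (IntermediateField.mem_adjoin_simple_iff ℂ a).1 ha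
  rw [div_eq_mul_inv]
  refine mul_mem (polyRing_le V hx _ ?_) (hinv s)
  exact aeval_mem_adjoin_singleton ℂ x

lemma center_ne_bot [IsCurveField K] (V : Place K) {f : K} (hf : f ∈ V.1)
    (ht : Transcendental ℂ f) : center V hf ≠ ⊥ := by
  have hfr : f ∉ Set.range (algebraMap ℂ K) := by
    rintro ⟨c, rfl⟩; exact ht (isAlgebraic_algebraMap c)
  obtain ⟨c, hc⟩ := exists_algebraMap_sub_mem V hf
  intro h0
  let f' : polyRing f := ⟨f, Algebra.self_mem_adjoin_singleton ℂ f⟩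
  let g : polyRing f := f' - algebraMap ℂ _ c
  have hg : algebraMap (polyRing f) (intRing f) g ∈ center V hf := mem_center.2 hc
  rw [h0, Ideal.mem_bot] at hg
  have : f - algebraMap ℂ K c = 0 := congrArg (fun z : intRing f ↦ (z : K)) hg
  exact hfr ⟨c, (sub_eq_zero.1 this).symm⟩

/-- The local ring of a Dedekind domain at a nonzero prime is a valuation ring, in terms of
fractions. -/
lemma exists_mul_eq_of_prime {B K : Type*} [CommRing B] [IsDedekindDomain B] [Field K]
    [Algebra B K] [IsFractionRing B K] (q : Ideal B) [q.IsPrime] (hq0 : q ≠ ⊥) (v : K) :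
    ∃ b s : B, s ∉ q ∧
      (v * algebraMap B K s = algebraMap B K b ∨ v⁻¹ * algebraMap B K s = algebraMap B K b) := by
  let _ : Algebra (Localization.AtPrime q) K :=
    IsLocalization.localizationAlgebraOfSubmonoidLe _ K q.primeCompl (nonZeroDivisors _)
      q.primeCompl_le_nonZeroDivisors
  have : IsScalarTower B (Localization.AtPrime q) K :=
    IsLocalization.localization_isScalarTower_of_submonoid_le _ K q.primeCompl _
      q.primeCompl_le_nonZeroDivisors
  have : IsFractionRing (Localization.AtPrime q) K :=
    IsFractionRing.isFractionRing_of_isDomain_of_isLocalization q.primeCompl _ _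
  have := IsLocalization.AtPrime.isDiscreteValuationRing_of_dedekind_domain B hq0
    (Localization.AtPrime q)
  have key : ∀ w : K, IsLocalization.IsInteger (Localization.AtPrime q) w →
      ∃ b s : B, s ∉ q ∧ w * algebraMap B K s = algebraMap B K b := by
    rintro w ⟨z, rfl⟩
    obtain ⟨b, s, rfl⟩ := IsLocalization.exists_mk'_eq q.primeCompl z
    refine ⟨b, s, s.2, ?_⟩
    have := congrArg (algebraMap (Localization.AtPrime q) K)
      (IsLocalization.mk'_spec (Localization.AtPrime q) b s)
    rwa [map_mul, ← IsScalarTower.algebraMap_apply, ← IsScalarTower.algebraMap_apply] at this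
  rcases ValuationRing.isInteger_or_isInteger (Localization.AtPrime q) v with h | h
  · obtain ⟨b, s, hs, hb⟩ := key _ h
    exact ⟨b, s, hs, .inl hb⟩
  · obtain ⟨b, s, hs, hb⟩ := key _ h
    exact ⟨b, s, hs, .inr hb⟩

/-- A place at which `f` is regular is the localization of the integral closure of `ℂ[f]` at its
center, because that localization is already a valuation ring. -/
lemma exists_eq_div_of_mem [IsCurveField K] (V : Place K) {f : K} (hf : f ∈ V.1)
    (ht : Transcendental ℂ f) {v : K} (hv : v ∈ V.1) :
    ∃ b s : intRing f, s ∉ center V hf ∧ v * s = b := by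
  have := isDedekindDomain_intRing ht
  have := isFractionRing_intRing ht
  rcases eq_or_ne v 0 with rfl | hv0
  · exact ⟨0, 1, fun h ↦ (inferInstance : (center V hf).IsPrime).ne_top
      ((Ideal.eq_top_iff_one _).2 h), by simp⟩
  obtain ⟨b, s, hs, h | h⟩ := exists_mul_eq_of_prime (center V hf) (center_ne_bot V hf ht) v
  · exact ⟨b, s, hs, h⟩
  · have hb : v⁻¹ * (s : K) = b := h
    refine ⟨s, b, fun hbq ↦ hs ?_, ?_⟩
    · rw [mem_center] at hbq ⊢
      have := mul_mem_nonunits hv hbq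
      rwa [← hb, mul_inv_cancel_left₀ hv0] at this
    · rw [← hb, mul_inv_cancel_left₀ hv0]

lemma isUnit_toPlace (V : Place K) {f : K} (hf : f ∈ V.1) {s : intRing f}
    (hs : s ∉ center V hf) : IsUnit (toPlace V hf s) := by
  by_contra h
  exact hs ((IsLocalRing.mem_maximalIdeal _).2 h)

lemma isLocalization_place [IsCurveField K] (V : Place K) {f : K} (hf : f ∈ V.1)
    (ht : Transcendental ℂ f) :
    @IsLocalization.AtPrime _ _ V.1 _ (toPlace V hf).toAlgebra (center V hf) _ := by
  let _ := (toPlace V hf).toAlgebra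
  rw [IsLocalization.AtPrime, isLocalization_iff]
  refine ⟨?_, ?_, ?_⟩
  · intro s; exact isUnit_toPlace V hf s.2
  · intro v
    obtain ⟨b, s, hs, h⟩ := exists_eq_div_of_mem V hf ht v.2
    exact ⟨(b, ⟨s, hs⟩), Subtype.ext h⟩
  · intro x y hxy
    refine ⟨1, ?_⟩
    have : x = y := Subtype.ext (congrArg (fun z : V.1 ↦ (z : K)) hxy)
    rw [this]

/-- A place is determined by its center. -/
lemma eq_of_center_eq [IsCurveField K] {V W : Place K} {f : K} (hV : f ∈ V.1) (hW : f ∈ W.1)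
    (ht : Transcendental ℂ f) (h : center V hV = center W hW) : V = W := by
  have key : ∀ {V W : Place K} (hV : f ∈ V.1) (hW : f ∈ W.1), center V hV = center W hW →
      ∀ v ∈ V.1, v ∈ W.1 := by
    intro V W hV hW h v hv
    obtain ⟨b, s, hs, hb⟩ := exists_eq_div_of_mem V hV ht hv
    rw [h, mem_center] at hs
    have hs0 : (s : K) ≠ 0 := by
      rintro h0; apply hs
      rw [h0, ValuationSubring.mem_nonunits_iff, map_zero]; exact zero_lt_one
    rw [← mul_inv_cancel_right₀ hs0 v, hb]
    exact mul_mem (intRing_le W hW _ b.2) (inv_mem_of_notMem_nonunits hs)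
  exact Subtype.ext (le_antisymm (key hV hW h) (key hW hV h.symm))

/-- Every nonzero prime of the integral closure of `ℂ[f]` is the center of a place. -/
lemma exists_place_of_prime [IsCurveField K] {f : K} (ht : Transcendental ℂ f)
    (q : Ideal (intRing f)) [hq : q.IsPrime] (hq0 : q ≠ ⊥) :
    ∃ (V : Place K) (hV : f ∈ V.1), center V hV = q := by
  have := isDedekindDomain_intRing ht
  obtain ⟨V, hV, hqV⟩ := Ideal.image_subset_nonunits_valuationSubring
    (A := (intRing f).toSubring) q hq.ne_top
  have hle : ∀ b ∈ intRing f, b ∈ V := hV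
  have hf : f ∈ V := hle _ (algebraMap_mem (intRing f)
    (⟨f, Algebra.self_mem_adjoin_singleton ℂ f⟩ : polyRing f))
  have hc : ∀ a : ℂ, algebraMap ℂ K a ∈ V := fun a ↦
    hle _ (algebraMap_mem (intRing f) (algebraMap ℂ (polyRing f) a))
  have htop : V ≠ ⊤ := by
    rintro rfl
    obtain ⟨b, hb, hb0⟩ := Submodule.exists_mem_ne_zero_of_ne_bot hq0
    have h1 : (b : K) ∈ (⊤ : ValuationSubring K).nonunits := hqV ⟨b, hb, rfl⟩
    have := mul_mem_nonunits (V := ⊤) (ValuationSubring.mem_top (b : K)⁻¹) h1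
    rw [inv_mul_cancel₀ (by simpa using hb0)] at this
    exact one_notMem_nonunits _ this
  refine ⟨⟨V, hc, htop⟩, hf, ?_⟩
  have hmax : q.IsMaximal := hq.isMaximal hq0
  refine (hmax.eq_of_le (Ideal.IsPrime.ne_top inferInstance) fun b hb ↦ ?_).symm
  exact mem_center.2 (hqV ⟨b, hb, rfl⟩)

lemma exists_mem_transcendental [IsCurveField K] (V : Place K) :
    ∃ f ∈ V.1.nonunits, Transcendental ℂ f := by
  obtain ⟨x, hx⟩ : ∃ x, x ∉ V.1 := by
    by_contra! h
    exact V.2.2 (top_unique fun x _ ↦ h x)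
  refine ⟨x⁻¹, inv_mem_nonunits_of_notMem hx, transcendental_of_notMem_range ?_⟩
  rintro ⟨c, hc⟩
  apply hx
  rw [← inv_inv x, ← hc, ← map_inv₀]
  exact V.2.1 _

instance isDiscreteValuationRing_place [IsCurveField K] (V : Place K) :
    IsDiscreteValuationRing V.1 := by
  obtain ⟨f, hf, ht⟩ := exists_mem_transcendental V
  have hf := mem_of_mem_nonunits hf
  have := isDedekindDomain_intRing ht
  let _ := (toPlace V hf).toAlgebra
  have := isLocalization_place V hf ht
  exact IsLocalization.AtPrime.isDiscreteValuationRing_of_dedekind_domain _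
    (center_ne_bot V hf ht) V.1

end CurveField

/-! ### The order of vanishing at a place -/

section CurveField

open Polynomial IntermediateField

variable {K : Type} [Field K] [Algebra ℂ K]

lemma ne_zero_of_transcendental {f : K} (ht : Transcendental ℂ f) : f ≠ 0 := by
  rintro rfl
  exact ht isAlgebraic_zero

lemma transcendental_inv {f : K} (ht : Transcendental ℂ f) : Transcendental ℂ f⁻¹ := by
  intro h
  exact ht (by simpa using h.inv)

lemma adjoin_inv (f : K) : ℂ⟮f⁻¹⟯ = ℂ⟮f⟯ := by
  apply le_antisymm
  · rw [adjoin_simple_le_iff]; exact inv_mem (mem_adjoin_simple_self ℂ f)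
  · rw [adjoin_simple_le_iff]
    have := inv_mem (mem_adjoin_simple_self ℂ f⁻¹)
    rwa [inv_inv] at this

/-- The ideal of `ℂ[f]` generated by `f`. -/
def zeroIdeal (f : K) : Ideal (polyRing f) :=
  Ideal.span {⟨f, Algebra.self_mem_adjoin_singleton ℂ f⟩}

lemma zeroIdeal_ne_bot {f : K} (ht : Transcendental ℂ f) : zeroIdeal f ≠ ⊥ := by
  rw [zeroIdeal, Ne, Ideal.span_singleton_eq_bot]
  intro h
  exact (ne_zero_of_transcendental ht) (congrArg Subtype.val h)

lemma exists_sub_mem_zeroIdeal (f : K) (a : polyRing f) :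
    ∃ c : ℂ, a - algebraMap ℂ _ c ∈ zeroIdeal f := by
  obtain ⟨a, ha⟩ := a
  induction ha using Algebra.adjoin_induction with
  | mem x hx =>
    refine ⟨0, ?_⟩
    rw [map_zero, sub_zero]
    obtain rfl : x = f := hx
    exact Ideal.mem_span_singleton_self _
  | algebraMap r =>
    refine ⟨r, ?_⟩
    convert Ideal.zero_mem _
    exact sub_eq_zero.2 rfl
  | add x y hx hy h1 h2 =>
    obtain ⟨c, hc⟩ := h1
    obtain ⟨d, hd⟩ := h2
    refine ⟨c + d, ?_⟩
    convert add_mem hc hd using 1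
    rw [map_add]
    have : (⟨x + y, add_mem hx hy⟩ : polyRing f) = ⟨x, hx⟩ + ⟨y, hy⟩ := rfl
    rw [this]; ring
  | mul x y hx hy h1 h2 =>
    obtain ⟨c, hc⟩ := h1
    obtain ⟨d, hd⟩ := h2
    refine ⟨c * d, ?_⟩
    have : (⟨x * y, mul_mem hx hy⟩ : polyRing f) = ⟨x, hx⟩ * ⟨y, hy⟩ := rfl
    have h3 := add_mem (Ideal.mul_mem_right (⟨y, hy⟩ : polyRing f) _ hc)
      (Ideal.mul_mem_left _ (algebraMap ℂ (polyRing f) c) hd)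
    convert h3 using 1
    rw [map_mul, this]; ring

lemma isMaximal_zeroIdeal {f : K} (ht : Transcendental ℂ f) : (zeroIdeal f).IsMaximal := by
  have hne : zeroIdeal f ≠ ⊤ := by
    rw [zeroIdeal, Ne, Ideal.span_singleton_eq_top]
    rintro hu
    obtain ⟨g, hg⟩ := isUnit_iff_exists_inv.1 hu
    obtain ⟨p, hp⟩ := (by
      rw [← Algebra.adjoin_singleton_eq_range_aeval ℂ f]; exact g.2 : (g : K) ∈ (aeval f).range)
    have h1 : f * g = 1 := congrArg Subtype.val hg
    refine ht ⟨X * p - 1, ?_, ?_⟩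
    · intro h
      have := congrArg (eval 0) h
      simp at this
    · change aeval f p = (g : K) at hp
      simp [hp, h1]
  refine Ideal.isMaximal_iff.2 ⟨fun h ↦ hne ((Ideal.eq_top_iff_one _).2 h), ?_⟩
  intro J x hJ hx hxJ
  obtain ⟨c, hc⟩ := exists_sub_mem_zeroIdeal f x
  have hc0 : c ≠ 0 := by
    rintro rfl
    rw [map_zero, sub_zero] at hc
    exact hx hc
  have h2 : algebraMap ℂ (polyRing f) c ∈ J := by
    have := sub_mem hxJ (hJ hc)
    rwa [sub_sub_cancel] at this
  have := J.mul_mem_left (algebraMap ℂ _ c⁻¹) h2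
  rwa [← map_mul, inv_mul_cancel₀ hc0, map_one] at this

lemma liesOver_center {f : K} (ht : Transcendental ℂ f) {V : Place K} (hV : f ∈ V.1.nonunits) :
    (center V (mem_of_mem_nonunits hV)).LiesOver (zeroIdeal f) := by
  have hm := isMaximal_zeroIdeal ht
  refine ⟨?_⟩
  refine hm.eq_of_le (Ideal.IsPrime.ne_top (Ideal.IsPrime.under _ _)) ?_
  rw [zeroIdeal, Ideal.span_singleton_le_iff_mem, Ideal.mem_comap, mem_center]
  exact hV

variable [IsCurveField K]

/-- The order of vanishing at a place. At `0` it takes the junk value `0`. -/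
def ord (V : Place K) (x : K) : ℤ := (Ring.ordFrac V.1 x).log

variable {V : Place K} {x y : K}

lemma ord_mul (hx : x ≠ 0) (hy : y ≠ 0) : ord V (x * y) = ord V x + ord V y := by
  rw [ord, map_mul, WithZero.log_mul (by simpa using hx) (by simpa using hy)]; rfl

lemma ord_inv (x : K) : ord V x⁻¹ = - ord V x := by
  rw [ord, map_inv₀, WithZero.log_inv]; rfl

@[simp] lemma ord_zero : ord V (0 : K) = 0 := by simp [ord]

lemma ord_nonneg_of_mem (hx : x ∈ V.1) : 0 ≤ ord V x := by
  rcases eq_or_ne x 0 with rfl | h0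
  · simp
  have h : 1 ≤ Ring.ordFrac V.1 x :=
    Ring.ordFrac_ge_one_of_ne_zero (K := K) (x := (⟨x, hx⟩ : V.1))
      (fun h ↦ h0 (congrArg Subtype.val h))
  rw [ord, ← WithZero.log_one]
  exact (WithZero.log_le_log one_ne_zero (by simpa using h0)).2 h

lemma ord_eq_zero_of_isUnit (hx : x ∈ V.1) (hx' : x ∉ V.1.nonunits) : ord V x = 0 := by
  refine le_antisymm ?_ (ord_nonneg_of_mem hx)
  have := ord_nonneg_of_mem (inv_mem_of_notMem_nonunits hx')
  rw [ord_inv] at this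
  omega

lemma ord_pos_of_mem (hx : x ∈ V.1.nonunits) (h0 : x ≠ 0) : 0 < ord V x := by
  have hx' := mem_of_mem_nonunits hx
  refine lt_of_le_of_ne (ord_nonneg_of_mem hx') fun h ↦ ?_
  have h1 : Ring.ordFrac V.1 x = 1 := by
    have hne : Ring.ordFrac V.1 x ≠ 0 := by simpa using h0
    have := WithZero.exp_log hne
    rw [← this]
    change WithZero.exp (ord V x) = 1
    rw [← h, WithZero.exp_zero]
  have hu : IsUnit (⟨x, hx'⟩ : V.1) :=
    (Ring.isUnit_iff_ordFrac_one_of_isDiscreteValuationRing (K := K)).2 h1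
  obtain ⟨_, h2⟩ := ValuationSubring.mem_nonunits_iff_exists_mem_maximalIdeal.1 hx
  exact (IsLocalRing.mem_maximalIdeal _).1 h2 hu

lemma mem_iff_ord (h0 : x ≠ 0) : x ∈ V.1 ↔ 0 ≤ ord V x := by
  refine ⟨ord_nonneg_of_mem, fun h ↦ ?_⟩
  by_contra hx
  have := ord_pos_of_mem (inv_mem_nonunits_of_notMem hx) (inv_ne_zero h0)
  rw [ord_inv] at this
  omega

lemma mem_nonunits_iff_ord (h0 : x ≠ 0) : x ∈ V.1.nonunits ↔ 0 < ord V x := by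
  refine ⟨fun h ↦ ord_pos_of_mem h h0, fun h ↦ ?_⟩
  by_contra hx
  have := ord_eq_zero_of_isUnit ((mem_iff_ord h0).2 h.le) hx
  omega

lemma ord_zpow (t : K) (n : ℤ) : ord V (t ^ n) = n * ord V t := by
  rw [ord, map_zpow₀, WithZero.log_zpow]
  simp [ord]

lemma length_eq_ord (hx : x ∈ V.1) (h0 : x ≠ 0) :
    ((Module.length V.1 (V.1 ⧸ Ideal.span {(⟨x, hx⟩ : V.1)})).toNat : ℤ) = ord V x := by
  have hne : (⟨x, hx⟩ : V.1) ≠ 0 := fun h ↦ h0 (congrArg Subtype.val h)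
  have h := Ring.ordFrac_eq_ord V.1 (K := K) hne
  rw [Ring.ordMonoidWithZeroHom_eq_ord (mem_nonZeroDivisors_of_ne_zero hne)] at h
  change Ring.ordFrac V.1 x = _ at h
  rw [ord, h]
  have := Ring.ord_ne_top (mem_nonZeroDivisors_of_ne_zero hne)
  rw [Ring.ord] at this ⊢
  obtain ⟨m, hm⟩ := ENat.ne_top_iff_exists.1 this
  rw [← hm]
  simp
  rfl

lemma ord_algebraMap (c : ℂ) : ord V (algebraMap ℂ K c) = 0 := by
  rcases eq_or_ne c 0 with rfl | hc
  · simp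
  exact ord_eq_zero_of_isUnit (V.2.1 c) (algebraMap_notMem_nonunits V hc)

/-! ### Residues -/

lemma bijective_algebraMap_residue (V : Place K) : Function.Bijective
    ((IsLocalRing.residue V.1).comp ((algebraMap ℂ K).codRestrict V.1.toSubring V.2.1)) := by
  refine ⟨RingHom.injective _, fun z ↦ ?_⟩
  obtain ⟨v, rfl⟩ := IsLocalRing.residue_surjective z
  obtain ⟨c, hc⟩ := exists_algebraMap_sub_mem V v.2
  refine ⟨c, ?_⟩
  obtain ⟨h1, h2⟩ := ValuationSubring.mem_nonunits_iff_exists_mem_maximalIdeal.1 hc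
  have := (IsLocalRing.residue_eq_zero_iff _).2 h2
  have h3 : (⟨_, h1⟩ : V.1) = v - (algebraMap ℂ K).codRestrict V.1.toSubring V.2.1 c := rfl
  rw [h3, map_sub, sub_eq_zero] at this
  exact this.symm

/-- The value in `ℂ` of a function that is regular at a place. -/
def residue (V : Place K) : V.1 →+* ℂ :=
  (RingEquiv.ofBijective _ (bijective_algebraMap_residue V)).symm.toRingHom.comp
    (IsLocalRing.residue V.1)

lemma residue_eq_iff (v : V.1) (c : ℂ) :
    residue V v = c ↔ (v : K) - algebraMap ℂ K c ∈ V.1.nonunits := by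
  change (RingEquiv.ofBijective _ (bijective_algebraMap_residue V)).symm _ = c ↔ _
  rw [RingEquiv.symm_apply_eq]
  change IsLocalRing.residue V.1 v = IsLocalRing.residue V.1 (⟨algebraMap ℂ K c, V.2.1 c⟩ : V.1) ↔ _
  rw [← sub_eq_zero, ← map_sub, IsLocalRing.residue_eq_zero_iff,
    ValuationSubring.mem_nonunits_iff_exists_mem_maximalIdeal]
  exact ⟨fun h ↦ ⟨_, h⟩, fun ⟨_, h⟩ ↦ h⟩

/-! ### A rational function has as many zeros as poles -/

lemma length_quotient_ringEquiv {R S : Type*} [CommRing R] [CommRing S] (e : R ≃+* S)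
    (I : Ideal R) (J : Ideal S) (h : J = I.map (e : R →+* S)) :
    Module.length R (R ⧸ I) = Module.length S (S ⧸ J) := by
  let _ : Algebra R S := (e : R →+* S).toAlgebra
  let e' : R ≃ₐ[R] S := AlgEquiv.ofRingEquiv (f := e) fun _ ↦ rfl
  rw [(Ideal.quotientEquivAlg I J e' h).toLinearEquiv.length_eq]
  exact Module.length_eq_of_surjective (R := S) (S := R) e.surjective

/-- The zeros of `f` are the primes of the integral closure of `ℂ[f]` over the origin. -/
def zerosEquiv {f : K} (ht : Transcendental ℂ f) :
    {V : Place K | f ∈ V.1.nonunits} ≃ (zeroIdeal f).primesOver (intRing f) := by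
  refine Equiv.ofBijective (fun V ↦ ⟨center V.1 (mem_of_mem_nonunits V.2), inferInstance,
    liesOver_center ht V.2⟩) ⟨?_, ?_⟩
  · intro V W h
    exact Subtype.ext (eq_of_center_eq _ _ ht (congrArg Subtype.val h))
  · rintro ⟨q, hq, hqo⟩
    have hq0 : q ≠ ⊥ := by
      rintro rfl
      apply zeroIdeal_ne_bot ht
      rw [hqo.over, Ideal.under, eq_bot_iff]
      intro x hx
      rw [Ideal.mem_comap, Ideal.mem_bot] at hx
      exact Subtype.ext (congrArg (fun z : intRing f ↦ (z : K)) hx)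
    obtain ⟨V, hV, rfl⟩ := exists_place_of_prime ht q hq0
    refine ⟨⟨V, ?_⟩, rfl⟩
    have : (⟨f, Algebra.self_mem_adjoin_singleton ℂ f⟩ : polyRing f) ∈ zeroIdeal f :=
      Ideal.mem_span_singleton_self _
    rw [hqo.over, Ideal.under, Ideal.mem_comap, mem_center] at this
    exact this

lemma inertiaDeg_eq_one {R S : Type*} [CommRing R] [CommRing S] [Algebra R S] (p : Ideal R)
    (q : Ideal S) [q.LiesOver p] [p.IsMaximal] [hq : q.IsMaximal]
    (h : ∀ b : S, ∃ a : R, b - algebraMap R S a ∈ q) : q.inertiaDeg R = 1 := by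
  rw [Ideal.inertiaDeg_eq_of_isMaximal p q]
  let _ : Field (R ⧸ p) := Ideal.Quotient.field _
  have hnt : Nontrivial (S ⧸ q) := Ideal.Quotient.nontrivial_iff.2 hq.ne_top
  rw [finrank_eq_one_iff_of_nonzero' (1 : S ⧸ q) one_ne_zero]
  intro w
  obtain ⟨b, rfl⟩ := Ideal.Quotient.mk_surjective w
  obtain ⟨a, ha⟩ := h b
  refine ⟨Ideal.Quotient.mk _ a, ?_⟩
  rw [Algebra.smul_def, mul_one]
  change Ideal.Quotient.mk q (algebraMap R S a) = _
  rw [eq_comm, Ideal.Quotient.eq]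
  exact ha

/-- The residue extension of a place over the origin of the affine line is trivial. -/
lemma inertiaDeg_center {f : K} (ht : Transcendental ℂ f) (hV : f ∈ V.1.nonunits) :
    (center V (mem_of_mem_nonunits hV)).inertiaDeg (polyRing f) = 1 := by
  have := isMaximal_zeroIdeal ht
  have := liesOver_center ht hV
  have := isDedekindDomain_intRing ht
  have hq : (center V (mem_of_mem_nonunits hV)).IsMaximal :=
    Ideal.IsPrime.isMaximal inferInstance (center_ne_bot V _ ht)
  refine inertiaDeg_eq_one (zeroIdeal f) _ fun b ↦ ?_
  obtain ⟨c, hc⟩ := exists_algebraMap_sub_mem V (intRing_le V (mem_of_mem_nonunits hV) _ b.2)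
  exact ⟨algebraMap ℂ _ c, mem_center.2 hc⟩

lemma ramificationIdx_eq_length {R S : Type*} [CommRing R] [CommRing S] [Algebra R S] (x : R)
    (q : Ideal S) [q.LiesOver (Ideal.span {x})] [q.IsPrime] (T : Type*) [CommRing T] [Algebra S T]
    [IsLocalization.AtPrime T q] :
    q.ramificationIdx R =
      (Module.length T (T ⧸ Ideal.span {algebraMap S T (algebraMap R S x)})).toNat := by
  rw [Ideal.ramificationIdx_eq (Ideal.span {x}) q]
  let e : Localization.AtPrime q ≃ₐ[S] T := IsLocalization.algEquiv q.primeCompl _ _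
  rw [length_quotient_ringEquiv e.toRingEquiv _
    (Ideal.span {algebraMap S T (algebraMap R S x)})]
  rw [Ideal.map_span, Ideal.map_span, Set.image_singleton, Set.image_singleton]
  congr 2
  rw [IsScalarTower.algebraMap_apply R S (Localization.AtPrime q)]
  exact (e.commutes _).symm

/-- The order of vanishing of `f` at a place is the ramification index of its center over the
origin. -/
lemma ramificationIdx_center {f : K} (ht : Transcendental ℂ f) (hV : f ∈ V.1.nonunits) :
    ((center V (mem_of_mem_nonunits hV)).ramificationIdx (polyRing f) : ℤ) = ord V f := by
  have hf := mem_of_mem_nonunits hV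
  have : (center V hf).LiesOver
    (Ideal.span {(⟨f, Algebra.self_mem_adjoin_singleton ℂ f⟩ : polyRing f)}) :=
    liesOver_center ht hV
  let _ := (toPlace V hf).toAlgebra
  have := isLocalization_place V hf ht
  rw [ramificationIdx_eq_length (⟨f, Algebra.self_mem_adjoin_singleton ℂ f⟩ : polyRing f)
    (center V hf) V.1]
  exact length_eq_ord hf (ne_zero_of_transcendental ht)

lemma finite_zeros {f : K} (ht : Transcendental ℂ f) : {V : Place K | f ∈ V.1.nonunits}.Finite := by
  have := isMaximal_zeroIdeal ht
  have := isDedekindDomain_intRing ht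
  have : Finite ((zeroIdeal f).primesOver (intRing f)) :=
    IsDedekindDomain.primesOver_finite (zeroIdeal f) (intRing f)
  exact Finite.of_equiv _ (zerosEquiv ht).symm

/-- The zeros of `f`, with multiplicities, number `[K : ℂ(f)]`: this is the identity `∑ e f = n` for
the primes over the origin of the affine line. -/
lemma sum_ord_zeros {f : K} (ht : Transcendental ℂ f) :
    ∑ᶠ V ∈ {V : Place K | f ∈ V.1.nonunits}, ord V f = Module.finrank ℂ⟮f⟯ K := by
  have := isMaximal_zeroIdeal ht
  have := isDedekindDomain_intRing ht
  have := finite_intRing ht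
  have := free_intRing ht
  have : Module.Flat (polyRing f) (intRing f) := Module.Flat.of_free
  have : Finite ((zeroIdeal f).primesOver (intRing f)) :=
    IsDedekindDomain.primesOver_finite (zeroIdeal f) (intRing f)
  have := Fintype.ofFinite ((zeroIdeal f).primesOver (intRing f))
  have : Fintype {V : Place K | f ∈ V.1.nonunits} := Fintype.ofEquiv _ (zerosEquiv ht).symm
  have h := Ideal.sum_ramification_inertia_eq_finrank (zeroIdeal f) (intRing f)
  rw [← finrank_intRing ht, ← h, ← finsum_set_coe_eq_finsum_mem, finsum_eq_sum_of_fintype,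
    Nat.cast_sum]
  refine Fintype.sum_equiv (zerosEquiv ht) _ _ fun V ↦ ?_
  rw [Nat.cast_mul]
  change ord V.1 f = (Ideal.ramificationIdx (center V.1 _) _ : ℤ) *
    (Ideal.inertiaDeg (center V.1 _) _ : ℤ)
  rw [ramificationIdx_center ht V.2, inertiaDeg_center ht V.2]
  simp

lemma ord_ne_zero_iff {f : K} (h0 : f ≠ 0) :
    ord V f ≠ 0 ↔ f ∈ V.1.nonunits ∨ f⁻¹ ∈ V.1.nonunits := by
  rw [mem_nonunits_iff_ord h0, mem_nonunits_iff_ord (inv_ne_zero h0), ord_inv]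
  omega

theorem finite_ord_ne_zero (f : K) : {V : Place K | ord V f ≠ 0}.Finite := by
  by_cases hf : f ∈ Set.range (algebraMap ℂ K)
  · obtain ⟨c, rfl⟩ := hf
    simp [ord_algebraMap]
  have ht := transcendental_of_notMem_range hf
  refine ((finite_zeros ht).union (finite_zeros (transcendental_inv ht))).subset fun V hV ↦ ?_
  exact (ord_ne_zero_iff (ne_zero_of_transcendental ht)).1 hV

/-- A rational function has degree zero: its zeros and its poles both number `[K : ℂ(f)]`. -/
theorem finsum_ord (f : K) : ∑ᶠ V : Place K, ord V f = 0 := by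
  by_cases hf : f ∈ Set.range (algebraMap ℂ K)
  · obtain ⟨c, rfl⟩ := hf
    simp [ord_algebraMap]
  have ht := transcendental_of_notMem_range hf
  have ht' := transcendental_inv ht
  have h1 := sum_ord_zeros ht
  have h2 := sum_ord_zeros ht'
  have h3 : ∑ᶠ V ∈ {V : Place K | f⁻¹ ∈ V.1.nonunits}, ord V f⁻¹ =
      - ∑ᶠ V ∈ {V : Place K | f⁻¹ ∈ V.1.nonunits}, ord V f := by
    simp_rw [ord_inv]
    exact finsum_mem_neg_distrib _ (finite_zeros ht')
  have hd : Disjoint {V : Place K | f ∈ V.1.nonunits} {V : Place K | f⁻¹ ∈ V.1.nonunits} := by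
    rw [Set.disjoint_left]
    intro V h h'
    rw [Set.mem_ofPred_eq, mem_nonunits_iff_ord (ne_zero_of_transcendental ht)] at h
    rw [Set.mem_ofPred_eq,
      mem_nonunits_iff_ord (inv_ne_zero (ne_zero_of_transcendental ht)), ord_inv] at h'
    omega
  have h4 := finsum_mem_union (f := fun V ↦ ord V f) hd (finite_zeros ht) (finite_zeros ht')
  have h5 : ∑ᶠ V ∈ {V : Place K | f ∈ V.1.nonunits} ∪ {V : Place K | f⁻¹ ∈ V.1.nonunits}, ord V f
      = ∑ᶠ V : Place K, ord V f := by
    rw [← finsum_mem_univ fun V : Place K ↦ ord V f]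
    refine finsum_mem_inter_support_eq' _ _ _ fun V hV ↦ ?_
    simpa using (ord_ne_zero_iff (ne_zero_of_transcendental ht)).1 hV
  rw [h3, adjoin_inv] at h2
  rw [← h5, h4, h1]
  omega

/-- Each of the functions `f - c`, where `c` is a number, has a zero, and these are different. -/
instance infinite_place : Infinite (Place K) := by
  obtain ⟨f, hf⟩ := exists_transcendental (K := K)
  have hs : ∀ c : ℂ, Transcendental ℂ (f - algebraMap ℂ K c) := by
    intro c
    refine transcendental_of_notMem_range ?_
    rintro ⟨d, hd⟩
    apply hf
    have : f = algebraMap ℂ K (d + c) := by rw [map_add, hd]; ring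
    rw [this]
    exact isAlgebraic_algebraMap _
  have : ∀ c : ℂ, ∃ V : Place K, f - algebraMap ℂ K c ∈ V.1.nonunits := by
    intro c
    by_contra! h
    have h1 := sum_ord_zeros (hs c)
    have := finiteDimensional_over_adjoin (hs c)
    have h2 : 0 < Module.finrank ℂ⟮f - algebraMap ℂ K c⟯ K := Module.finrank_pos
    rw [show {V : Place K | f - algebraMap ℂ K c ∈ V.1.nonunits} = ∅ from
      Set.eq_empty_of_forall_notMem h, finsum_mem_empty] at h1
    omega
  choose F hF using this
  refine Infinite.of_injective F fun c d h ↦ ?_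
  by_contra hcd
  have h1 := hF c
  have h2 := hF d
  rw [← h] at h2
  have h3 := sub_mem h2 h1
  rw [sub_sub_sub_cancel_left, ← map_sub] at h3
  exact algebraMap_notMem_nonunits _ (sub_ne_zero.2 hcd) h3

end CurveField

/-! ### Reduction of a plane in `Kⁿ⁺¹` at a place -/

section Charts

variable {K : Type} [Field K] {ι : Type}

lemma finrank_span_pair {E : Type*} [AddCommGroup E] [Module K E] {u w : E}
    (h : LinearIndependent K ![u, w]) : Module.finrank K (Submodule.span K {u, w}) = 2 := by
  have h1 : ({u, w} : Set E) = Set.range ![u, w] := by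
    simp only [Matrix.range_cons, Matrix.range_empty, Set.union_empty, Set.singleton_union]
  rw [h1, finrank_span_eq_card h]
  rfl

/-- The maximal minors of the matrix with rows `b` and `b'`. -/
def minor (b b' : ι → K) (k l : ι) : K := b k * b' l - b l * b' k

/-- Vectors `u`, `w` of `Λ` with coefficients in the place `V`, whose `i`-th and `j`-th coordinates
are `(1, 0)` and `(0, 1)`. -/
structure Chart (V : ValuationSubring K) (Λ : Submodule K (ι → K)) (i j : ι) (u w : ι → K) :
    Prop where
  u_mem : u ∈ Λ
  w_mem : w ∈ Λ
  u_int : ∀ k, u k ∈ V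
  w_int : ∀ k, w k ∈ V
  u_i : u i = 1
  u_j : u j = 0
  w_i : w i = 0
  w_j : w j = 1

section

variable {Λ : Submodule K (ι → K)} {V : ValuationSubring K} {i j : ι} {u w : ι → K}

lemma Chart.linearIndependent (h : Chart V Λ i j u w) : LinearIndependent K ![u, w] := by
  rw [LinearIndependent.pair_iff]
  intro s t hst
  have h1 := congrFun hst i
  have h2 := congrFun hst j
  simp [h.u_i, h.u_j, h.w_i, h.w_j] at h1 h2
  exact ⟨h1, h2⟩

lemma Chart.eq_add (h : Chart V Λ i j u w) (hΛ : Module.finrank K Λ = 2) {v : ι → K} (hv : v ∈ Λ) :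
    v = v i • u + v j • w := by
  have hfin : FiniteDimensional K Λ := Module.finite_of_finrank_pos (by omega)
  have h1 : Submodule.span K (Set.range ![u, w]) = Λ := by
    refine Submodule.eq_of_le_of_finrank_eq ?_ ?_
    · rw [Submodule.span_le]
      rintro _ ⟨k, rfl⟩
      fin_cases k
      · exact h.u_mem
      · exact h.w_mem
    · rw [finrank_span_eq_card h.linearIndependent, hΛ]; rfl
  rw [← h1] at hv
  simp only [Matrix.range_cons, Matrix.range_empty, Set.union_empty, Set.singleton_union] at hv
  obtain ⟨s, t, rfl⟩ := Submodule.mem_span_pair.1 hv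
  simp [h.u_i, h.u_j, h.w_i, h.w_j]

end

/-- Dividing by a minor of least order produces a chart: the row operations are Cramer's rule. -/
lemma chart_of_minor {V : ValuationSubring K} {Λ : Submodule K (ι → K)} {b b' : ι → K}
    (hb : b ∈ Λ) (hb' : b' ∈ Λ) {i j : ι} (h0 : minor b b' i j ≠ 0)
    (h : ∀ k l, minor b b' k l / minor b b' i j ∈ V) :
    Chart V Λ i j (fun k ↦ minor b b' k j / minor b b' i j)
      (fun k ↦ minor b b' i k / minor b b' i j) where
  u_mem := by
    convert Λ.smul_mem (minor b b' i j)⁻¹ (sub_mem (Λ.smul_mem (b' j) hb) (Λ.smul_mem (b j) hb'))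
      using 1
    ext k
    simp only [minor, Pi.smul_apply, Pi.sub_apply, smul_eq_mul]
    ring
  w_mem := by
    convert Λ.smul_mem (minor b b' i j)⁻¹ (sub_mem (Λ.smul_mem (b i) hb') (Λ.smul_mem (b' i) hb))
      using 1
    ext k
    simp only [minor, Pi.smul_apply, Pi.sub_apply, smul_eq_mul]
    ring
  u_int k := h k j
  w_int k := h i k
  u_i := div_self h0
  u_j := by simp [minor]
  w_i := by simp [minor]
  w_j := div_self h0

variable [Finite ι]

/-- Among the minors there is one that divides the others at the valuation ring `V`. -/
lemma exists_max_minor (V : ValuationSubring K) {b b' : ι → K}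
    (hb : LinearIndependent K ![b, b']) :
    ∃ i j, minor b b' i j ≠ 0 ∧ ∀ k l, minor b b' k l / minor b b' i j ∈ V := by
  have hne : ∃ i j, minor b b' i j ≠ 0 := by
    by_contra! h
    have hb0 : b ≠ 0 := hb.ne_zero 0
    obtain ⟨i, hi⟩ := Function.ne_iff.1 hb0
    have := LinearIndependent.pair_iff.1 hb (b' i) (- b i) (by
      ext k
      have := h i k
      simp only [minor] at this
      simp only [Pi.add_apply, Pi.smul_apply, smul_eq_mul, Pi.zero_apply]
      linear_combination -this)
    exact hi (neg_eq_zero.1 this.2)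
  obtain ⟨i0, j0, h0⟩ := hne
  have : Nonempty (ι × ι) := ⟨(i0, j0)⟩
  obtain ⟨⟨i, j⟩, hij⟩ := Finite.exists_max fun p : ι × ι ↦ V.valuation (minor b b' p.1 p.2)
  have hne : minor b b' i j ≠ 0 := by
    intro h
    have := hij (i0, j0)
    simp only [h, map_zero] at this
    exact h0 ((map_eq_zero _).1 (le_zero_iff.1 this))
  refine ⟨i, j, hne, fun k l ↦ ?_⟩
  rw [← V.valuation_le_one_iff, map_div₀]
  exact div_le_one_of_le₀ (hij (k, l)) zero_le

lemma exists_basis_of_finrank {Λ : Submodule K (ι → K)} (hΛ : Module.finrank K Λ = 2) :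
    ∃ b b' : ι → K, LinearIndependent K ![b, b'] ∧ Λ = Submodule.span K {b, b'} := by
  have hfin : FiniteDimensional K Λ := Module.finite_of_finrank_pos (by omega)
  let B := Module.finBasisOfFinrankEq K Λ hΛ
  have hl : LinearIndependent K ![(B 0 : ι → K), (B 1 : ι → K)] := by
    have h1 := B.linearIndependent.map' Λ.subtype (by simp)
    have h2 : ![(B 0 : ι → K), (B 1 : ι → K)] = Λ.subtype ∘ B := by
      ext k : 1
      fin_cases k <;> rfl
    rw [h2]
    exact h1
  refine ⟨B 0, B 1, hl, ?_⟩
  symm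
  refine Submodule.eq_of_le_of_finrank_eq ?_ ?_
  · rw [Submodule.span_le]
    rintro _ (rfl | rfl)
    · exact (B 0).2
    · exact (B 1).2
  · rw [finrank_span_pair hl, hΛ]

/-- A plane over `K` has a basis that stays independent under reduction at a given place. -/
lemma exists_chart (V : ValuationSubring K) {Λ : Submodule K (ι → K)}
    (hΛ : Module.finrank K Λ = 2) : ∃ i j u w, Chart V Λ i j u w := by
  obtain ⟨b, b', hb, rfl⟩ := exists_basis_of_finrank hΛ
  obtain ⟨i, j, h0, h⟩ := exists_max_minor V hb
  exact ⟨i, j, _, _, chart_of_minor (Submodule.subset_span (by simp))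
    (Submodule.subset_span (by simp)) h0 h⟩

end Charts

section Reduction

variable {K : Type} [Field K] [Algebra ℂ K] {ι : Type}

/-- The reduction at the place `V` of a subspace `Λ` of `K^ι`: the values at `V` of the vectors of
`Λ` that are regular at `V`. -/
def red (V : Place K) (Λ : Submodule K (ι → K)) : Submodule ℂ (ι → ℂ) where
  carrier := {c | ∃ v ∈ Λ, ∀ k, v k - algebraMap ℂ K (c k) ∈ V.1.nonunits}
  add_mem' := by
    rintro c d ⟨v, hv, hc⟩ ⟨w, hw, hd⟩
    refine ⟨v + w, add_mem hv hw, fun k ↦ ?_⟩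
    convert add_mem (hc k) (hd k) using 1
    simp only [Pi.add_apply, map_add]
    ring
  zero_mem' := ⟨0, zero_mem _, fun k ↦ by simp⟩
  smul_mem' := by
    rintro a c ⟨v, hv, hc⟩
    refine ⟨algebraMap ℂ K a • v, Λ.smul_mem _ hv, fun k ↦ ?_⟩
    convert mul_mem_nonunits (V.2.1 a) (hc k) using 1
    simp only [Pi.smul_apply, smul_eq_mul, map_mul]
    ring

lemma mem_red {V : Place K} {Λ : Submodule K (ι → K)} {c : ι → ℂ} :
    c ∈ red V Λ ↔ ∃ v ∈ Λ, ∀ k, v k - algebraMap ℂ K (c k) ∈ V.1.nonunits := Iff.rfl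

lemma algebraMap_mem_nonunits_iff {V : Place K} {c : ℂ} :
    algebraMap ℂ K c ∈ V.1.nonunits ↔ c = 0 := by
  refine ⟨fun h ↦ by_contra fun hc ↦ algebraMap_notMem_nonunits V hc h, ?_⟩
  rintro rfl
  rw [map_zero]
  exact zero_mem _

lemma mem_of_sub_mem_nonunits {V : Place K} {v : K} {c : ℂ}
    (h : v - algebraMap ℂ K c ∈ V.1.nonunits) : v ∈ V.1 := by
  have := add_mem (mem_of_mem_nonunits h) (V.2.1 c)
  rwa [sub_add_cancel] at this

end Reduction

section CurveReduction

variable {K : Type} [Field K] [Algebra ℂ K] [IsCurveField K] {ι : Type}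

/-- The vector of values at a place of a vector of functions; the value of a function with a pole is
taken to be `0`. -/
def resVec (V : Place K) (v : ι → K) : ι → ℂ := by
  classical exact fun k ↦ if h : v k ∈ V.1 then residue V ⟨v k, h⟩ else 0

lemma sub_resVec_mem {V : Place K} {v : ι → K} {k : ι} (h : v k ∈ V.1) :
    v k - algebraMap ℂ K (resVec V v k) ∈ V.1.nonunits := by
  rw [resVec, dif_pos h]
  exact (residue_eq_iff ⟨v k, h⟩ _).1 rfl

lemma resVec_eq {V : Place K} {v : ι → K} {k : ι} {c : ℂ}
    (h : v k - algebraMap ℂ K c ∈ V.1.nonunits) : resVec V v k = c := by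
  have h1 := mem_of_sub_mem_nonunits h
  rw [resVec, dif_pos h1]
  exact (residue_eq_iff ⟨v k, h1⟩ _).2 h

lemma resVec_mem_red {V : Place K} {Λ : Submodule K (ι → K)} {v : ι → K} (hv : v ∈ Λ)
    (hV : ∀ k, v k ∈ V.1) : resVec V v ∈ red V Λ := ⟨v, hv, fun k ↦ sub_resVec_mem (hV k)⟩

variable {Λ : Submodule K (ι → K)} {V : Place K} {i j : ι} {u w : ι → K}

lemma Chart.resVec_u_i (h : Chart V.1 Λ i j u w) : resVec V u i = 1 :=
  resVec_eq (by rw [h.u_i, map_one, sub_self]; exact zero_mem _)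

lemma Chart.resVec_u_j (h : Chart V.1 Λ i j u w) : resVec V u j = 0 :=
  resVec_eq (by rw [h.u_j, map_zero, sub_self]; exact zero_mem _)

lemma Chart.resVec_w_i (h : Chart V.1 Λ i j u w) : resVec V w i = 0 :=
  resVec_eq (by rw [h.w_i, map_zero, sub_self]; exact zero_mem _)

lemma Chart.resVec_w_j (h : Chart V.1 Λ i j u w) : resVec V w j = 1 :=
  resVec_eq (by rw [h.w_j, map_one, sub_self]; exact zero_mem _)

/-- In a chart, the reduction of `Λ` is the plane spanned by the reductions of `u` and `w`. -/
lemma Chart.mem_red_iff (h : Chart V.1 Λ i j u w) (hΛ : Module.finrank K Λ = 2) {c : ι → ℂ} :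
    c ∈ red V Λ ↔ c = c i • resVec V u + c j • resVec V w := by
  constructor
  · rintro ⟨v, hv, hc⟩
    have hv' := h.eq_add hΛ hv
    ext k
    simp only [Pi.add_apply, Pi.smul_apply, smul_eq_mul]
    rw [← sub_eq_zero, ← algebraMap_mem_nonunits_iff (V := V)]
    have h1 := congrFun hv' k
    simp only [Pi.add_apply, Pi.smul_apply, smul_eq_mul] at h1
    have h2 := mul_mem_nonunits (h.u_int k) (hc i)
    have h3 := mul_mem_nonunits (h.w_int k) (hc j)
    have h4 := mul_mem_nonunits (V.2.1 (c i)) (sub_resVec_mem (h.u_int k))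
    have h5 := mul_mem_nonunits (V.2.1 (c j)) (sub_resVec_mem (h.w_int k))
    convert sub_mem (add_mem (add_mem h2 h3) (add_mem h4 h5)) (hc k) using 1
    simp only [map_sub, map_add, map_mul]
    linear_combination h1
  · intro hc
    rw [hc]
    exact add_mem (Submodule.smul_mem _ _ (resVec_mem_red h.u_mem h.u_int))
      (Submodule.smul_mem _ _ (resVec_mem_red h.w_mem h.w_int))

lemma Chart.red_eq_span (h : Chart V.1 Λ i j u w) (hΛ : Module.finrank K Λ = 2) :
    red V Λ = Submodule.span ℂ {resVec V u, resVec V w} := by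
  ext c
  rw [h.mem_red_iff hΛ, Submodule.mem_span_pair]
  constructor
  · intro hc; exact ⟨_, _, hc.symm⟩
  · rintro ⟨s, t, rfl⟩
    simp [h.resVec_u_i, h.resVec_u_j, h.resVec_w_i, h.resVec_w_j]

lemma finrank_red [Finite ι] (V : Place K) (hΛ : Module.finrank K Λ = 2) :
    Module.finrank ℂ (red V Λ) = 2 := by
  obtain ⟨i, j, u, w, h⟩ := exists_chart V.1 hΛ
  rw [h.red_eq_span hΛ]
  have hl : LinearIndependent ℂ ![resVec V u, resVec V w] := by
    rw [LinearIndependent.pair_iff]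
    intro s t hst
    have h1 := congrFun hst i
    have h2 := congrFun hst j
    simp [h.resVec_u_i, h.resVec_u_j, h.resVec_w_i, h.resVec_w_j] at h1 h2
    exact ⟨h1, h2⟩
  exact finrank_span_pair hl

end CurveReduction

/-! ### The degree of a plane over the function field -/

section ScrollDegree

variable {K : Type} [Field K] [Algebra ℂ K]

/-- A linear functional with complex coefficients, evaluated at a vector of functions. -/
def functional {ι : Type} [Fintype ι] (T : ι → ℂ) : (ι → K) →ₗ[K] K :=
  ∑ k, algebraMap ℂ K (T k) • LinearMap.proj k

lemma functional_apply {ι : Type} [Fintype ι] (T : ι → ℂ) (v : ι → K) :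
    functional T v = ∑ k, algebraMap ℂ K (T k) * v k := by
  simp [functional, Algebra.smul_def]

lemma functional_mem {ι : Type} [Fintype ι] {V : Place K} {v : ι → K} (hv : ∀ k, v k ∈ V.1)
    (T : ι → ℂ) : functional T v ∈ V.1 := by
  rw [functional_apply]
  exact sum_mem fun k _ ↦ mul_mem (V.2.1 _) (hv k)

lemma functional_sub_mem {ι : Type} [Fintype ι] {V : Place K} {v : ι → K} {c : ι → ℂ}
    (hv : ∀ k, v k - algebraMap ℂ K (c k) ∈ V.1.nonunits) (T : ι → ℂ) :
    functional T v - algebraMap ℂ K (∑ k, T k * c k) ∈ V.1.nonunits := by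
  rw [functional_apply, map_sum, ← Finset.sum_sub_distrib]
  refine sum_mem fun k _ ↦ ?_
  rw [map_mul, ← mul_sub]
  exact mul_mem_nonunits (V.2.1 _) (hv k)

variable [IsCurveField K]

/-- Away from finitely many places a function is regular. -/
lemma finite_notMem (f : K) : {V : Place K | f ∉ V.1}.Finite := by
  refine (finite_ord_ne_zero f).subset fun V hV ↦ ?_
  intro h0
  rcases eq_or_ne f 0 with rfl | hf
  · exact hV (zero_mem _)
  · exact hV ((mem_iff_ord hf).2 h0.ge)

lemma finite_mem_nonunits {f : K} (hf : f ≠ 0) : {V : Place K | f ∈ V.1.nonunits}.Finite := by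
  refine (finite_ord_ne_zero f).subset fun V hV ↦ ?_
  exact (ord_pos_of_mem hV hf).ne'

section Degree

variable {ι : Type} [Finite ι] {b b' : ι → K}

/-- The least order at a place of the maximal minors of the matrix with linearly independent rows
`b` and `b'`: the order of a minor by which the others are divisible. -/
def minorOrd (b b' : ι → K) (V : Place K) : ℤ := by
  classical
  exact if hb : LinearIndependent K ![b, b'] then
    ord V (minor b b' (exists_max_minor V.1 hb).choose
      (exists_max_minor V.1 hb).choose_spec.choose)
  else 0

/-- The order does not depend on the choice of the minor. -/
lemma minorOrd_eq {V : Place K} (hb : LinearIndependent K ![b, b']) {i j : ι}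
    (h0 : minor b b' i j ≠ 0) (h : ∀ k l, minor b b' k l / minor b b' i j ∈ V.1) :
    minorOrd b b' V = ord V (minor b b' i j) := by
  rw [minorOrd, dif_pos hb]
  obtain ⟨h1, h2⟩ := (exists_max_minor V.1 hb).choose_spec.choose_spec
  have h3 := ord_nonneg_of_mem (h2 i j)
  have h4 := ord_nonneg_of_mem
    (h (exists_max_minor V.1 hb).choose (exists_max_minor V.1 hb).choose_spec.choose)
  rw [div_eq_mul_inv, ord_mul h0 (inv_ne_zero h1), ord_inv] at h3
  rw [div_eq_mul_inv, ord_mul h1 (inv_ne_zero h0), ord_inv] at h4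
  omega

lemma finite_minorOrd_ne_zero (b b' : ι → K) : {V : Place K | minorOrd b b' V ≠ 0}.Finite := by
  refine (Set.finite_iUnion fun p : ι × ι ↦ finite_ord_ne_zero (minor b b' p.1 p.2)).subset
    fun V hV ↦ ?_
  rw [Set.mem_iUnion]
  by_cases hb : LinearIndependent K ![b, b']
  · obtain ⟨i, j, h0, h⟩ := exists_max_minor V.1 hb
    refine ⟨(i, j), ?_⟩
    have hV' : minorOrd b b' V ≠ 0 := hV
    rw [minorOrd_eq hb h0 h] at hV'
    exact hV'
  · exact absurd (by rw [minorOrd, dif_neg hb]) hV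

/-- The degree of the line bundle `det` of the rank two quotient given by the plane spanned by `b`
and `b'`. -/
def planeDegree (b b' : ι → K) : ℤ := - ∑ᶠ V : Place K, minorOrd b b' V

end Degree

section Sections

variable {ι : Type} [Fintype ι] {b b' : ι → K}

/-- The determinant of the restriction to the span of `b`, `b'` of a pair of functionals. -/
def pairDet (T T' : ι → ℂ) (b b' : ι → K) : K :=
  functional T b * functional T' b' - functional T' b * functional T b'

/-- The determinant is a section of a line bundle of degree `planeDegree b b'`: it is divisible by
the minors, and it vanishes exactly where the reduction of the plane meets the common kernel of the
functionals. -/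
lemma pairDet_div {V : Place K} {Λ : Submodule K (ι → K)} (hΛ : Module.finrank K Λ = 2)
    (hb : b ∈ Λ) (hb' : b' ∈ Λ) {i j : ι}
    (h0 : minor b b' i j ≠ 0) (h : ∀ k l, minor b b' k l / minor b b' i j ∈ V.1)
    (T T' : ι → ℂ) :
    pairDet T T' b b' / minor b b' i j ∈ V.1 ∧
    (pairDet T T' b b' / minor b b' i j ∈ V.1.nonunits ↔
      ∃ c ∈ red V Λ, c ≠ 0 ∧ ∑ k, T k * c k = 0 ∧ ∑ k, T' k * c k = 0) := by
  have hc := chart_of_minor hb hb' h0 h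
  obtain ⟨u, w, hu, hw, hc⟩ : ∃ u w : ι → K, u = (fun k ↦ minor b b' k j / minor b b' i j) ∧
    w = (fun k ↦ minor b b' i k / minor b b' i j) ∧ Chart V.1 Λ i j u w := ⟨_, _, rfl, rfl, hc⟩
  have e1 := hc.eq_add hΛ hb
  have e2 := hc.eq_add hΛ hb'
  have key : pairDet T T' b b' / minor b b' i j =
      functional T u * functional T' w - functional T' u * functional T w := by
    rw [div_eq_iff h0, pairDet]
    have a1 := congrArg (functional T) e1
    have a2 := congrArg (functional T') e1
    have a3 := congrArg (functional T) e2
    have a4 := congrArg (functional T') e2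
    simp only [map_add, map_smul, smul_eq_mul] at a1 a2 a3 a4
    rw [a1, a2, a3, a4, minor]
    ring
  set c := resVec V u with hcdef
  set d := resVec V w with hddef
  have hcu : ∀ k, u k - algebraMap ℂ K (c k) ∈ V.1.nonunits := fun k ↦ sub_resVec_mem (hc.u_int k)
  have hdw : ∀ k, w k - algebraMap ℂ K (d k) ∈ V.1.nonunits := fun k ↦ sub_resVec_mem (hc.w_int k)
  have hT := functional_sub_mem hcu T
  have hT' := functional_sub_mem hcu T'
  have hS := functional_sub_mem hdw T
  have hS' := functional_sub_mem hdw T'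
  have m1 := functional_mem hc.u_int T
  have m2 := functional_mem hc.u_int T'
  have m3 := functional_mem hc.w_int T
  have m4 := functional_mem hc.w_int T'
  set p := ∑ k, T k * c k with hp
  set p' := ∑ k, T' k * c k with hp'
  set r := ∑ k, T k * d k with hr
  set r' := ∑ k, T' k * d k with hr'
  have hmem : (functional T u * functional T' w - functional T' u * functional T w) -
      algebraMap ℂ K (p * r' - p' * r) ∈ V.1.nonunits := by
    have a1 := mul_mem_nonunits m4 hT
    have a2 := mul_mem_nonunits (V.2.1 p) hS'
    have a3 := mul_mem_nonunits m3 hT'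
    have a4 := mul_mem_nonunits (V.2.1 p') hS
    convert sub_mem (add_mem a1 a2) (add_mem a3 a4) using 1
    simp only [map_sub, map_mul]
    ring
  rw [key]
  refine ⟨sub_mem (mul_mem m1 m4) (mul_mem m2 m3), ?_⟩
  have hiff : functional T u * functional T' w - functional T' u * functional T w ∈ V.1.nonunits ↔
      p * r' - p' * r = 0 := by
    rw [← algebraMap_mem_nonunits_iff (V := V)]
    constructor
    · intro h
      have := sub_mem h hmem
      rwa [sub_sub_cancel] at this
    · intro h
      have := add_mem hmem h
      rwa [sub_add_cancel] at this
  rw [hiff]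
  have hsum : ∀ (S : ι → ℂ) (x y : ℂ), ∑ k, S k * (x • c + y • d) k =
      x * ∑ k, S k * c k + y * ∑ k, S k * d k := by
    intro S x y
    rw [Finset.mul_sum, Finset.mul_sum, ← Finset.sum_add_distrib]
    refine Finset.sum_congr rfl fun k _ ↦ ?_
    simp only [Pi.add_apply, Pi.smul_apply, smul_eq_mul]
    ring
  constructor
  · intro hdet
    -- a nonzero kernel vector of a singular two by two matrix
    obtain ⟨x, y, hxy, hx1, hx2⟩ : ∃ x y : ℂ, (x ≠ 0 ∨ y ≠ 0) ∧ x * p + y * r = 0 ∧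
        x * p' + y * r' = 0 := by
      by_cases hpr : p = 0 ∧ r = 0
      · by_cases hpr' : p' = 0 ∧ r' = 0
        · exact ⟨1, 0, .inl one_ne_zero, by simp [hpr.1], by simp [hpr'.1]⟩
        · refine ⟨r', -p', ?_, by simp [hpr.1, hpr.2], by ring⟩
          by_contra! hcon
          exact hpr' ⟨neg_eq_zero.1 hcon.2, hcon.1⟩
      · refine ⟨r, -p, ?_, by ring, by linear_combination -hdet⟩
        by_contra! hcon
        exact hpr ⟨neg_eq_zero.1 hcon.2, hcon.1⟩
    refine ⟨x • c + y • d, add_mem (Submodule.smul_mem _ _ (resVec_mem_red hc.u_mem hc.u_int))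
      (Submodule.smul_mem _ _ (resVec_mem_red hc.w_mem hc.w_int)), ?_, ?_, ?_⟩
    · intro hzero
      have z1 := congrFun hzero i
      have z2 := congrFun hzero j
      simp [hcdef, hddef, hc.resVec_u_i, hc.resVec_u_j, hc.resVec_w_i, hc.resVec_w_j] at z1 z2
      tauto
    · rw [hsum]; exact hx1
    · rw [hsum]; exact hx2
  · rintro ⟨z, hz, hz0, h1, h2⟩
    rw [hc.mem_red_iff hΛ] at hz
    rw [hz, hsum] at h1 h2
    change z i * p + z j * r = 0 at h1
    change z i * p' + z j * r' = 0 at h2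
    by_contra hdet
    have zi : z i = 0 := by
      have : z i * (p * r' - p' * r) = 0 := by linear_combination r' * h1 - r * h2
      exact (mul_eq_zero.1 this).resolve_right hdet
    have zj : z j = 0 := by
      have : z j * (p * r' - p' * r) = 0 := by linear_combination p * h2 - p' * h1
      exact (mul_eq_zero.1 this).resolve_right hdet
    apply hz0
    rw [hz, zi, zj]
    simp

/-- The order of the determinant of two functionals, in comparison with that of the minors. The
difference is the order of vanishing of the determinant as a section of a line bundle. -/
lemma minorOrd_le_ord_pairDet {Λ : Submodule K (ι → K)} (hΛ : Module.finrank K Λ = 2)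
    (hl : LinearIndependent K ![b, b']) (hb : b ∈ Λ) (hb' : b' ∈ Λ) (T T' : ι → ℂ)
    (hD : pairDet T T' b b' ≠ 0) (V : Place K) :
    minorOrd b b' V ≤ ord V (pairDet T T' b b') ∧
    (minorOrd b b' V < ord V (pairDet T T' b b') ↔
      ∃ c ∈ red V Λ, c ≠ 0 ∧ ∑ k, T k * c k = 0 ∧ ∑ k, T' k * c k = 0) := by
  obtain ⟨i, j, h0, h⟩ := exists_max_minor V.1 hl
  obtain ⟨h1, h2⟩ := pairDet_div hΛ hb hb' h0 h T T'
  rw [minorOrd_eq hl h0 h, ← h2, mem_nonunits_iff_ord (div_ne_zero hD h0)]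
  rw [mem_iff_ord (div_ne_zero hD h0)] at h1
  rw [div_eq_mul_inv, ord_mul hD (inv_ne_zero h0), ord_inv] at h1 ⊢
  omega

/-- The places at which the reduction of a plane meets a subspace of codimension two number at most
the degree, if the determinant does not vanish identically; there are none of them only if the
degree is zero. -/
lemma ncard_meeting_le_planeDegree {Λ : Submodule K (ι → K)} (hΛ : Module.finrank K Λ = 2)
    (hl : LinearIndependent K ![b, b']) (hb : b ∈ Λ) (hb' : b' ∈ Λ) (T T' : ι → ℂ)
    (hD : pairDet T T' b b' ≠ 0) :
    {V : Place K | ∃ c ∈ red V Λ, c ≠ 0 ∧ ∑ k, T k * c k = 0 ∧ ∑ k, T' k * c k = 0}.Finite ∧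
    (({V : Place K | ∃ c ∈ red V Λ, c ≠ 0 ∧ ∑ k, T k * c k = 0 ∧
      ∑ k, T' k * c k = 0}.ncard : ℤ) ≤ planeDegree b b') ∧
    ({V : Place K | ∃ c ∈ red V Λ, c ≠ 0 ∧ ∑ k, T k * c k = 0 ∧ ∑ k, T' k * c k = 0} = ∅ →
      planeDegree b b' = 0) := by
  have key := minorOrd_le_ord_pairDet hΛ hl hb hb' T T' hD
  set B := {V : Place K | ∃ c ∈ red V Λ, c ≠ 0 ∧ ∑ k, T k * c k = 0 ∧ ∑ k, T' k * c k = 0} with hB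
  set g : Place K → ℤ := fun V ↦ ord V (pairDet T T' b b') - minorOrd b b' V with hg
  have hgB : ∀ V, V ∈ B ↔ 0 < g V := fun V ↦ by
    rw [sub_pos]; exact ((key V).2).symm
  have hg0 : ∀ V, 0 ≤ g V := fun V ↦ sub_nonneg.2 (key V).1
  have hsupp : (Function.support g) = B := by
    ext V
    rw [hgB, Function.mem_support]
    have := hg0 V
    omega
  have hf1 : (Function.support fun V : Place K ↦ ord V (pairDet T T' b b')).Finite :=
    finite_ord_ne_zero _
  have hf2 : (Function.support fun V : Place K ↦ minorOrd b b' V).Finite :=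
    finite_minorOrd_ne_zero _ _
  have hsum : ∑ᶠ V, g V = planeDegree b b' := by
    rw [hg, finsum_sub_distrib hf1 hf2, finsum_ord, zero_sub, planeDegree]
  have hfin : B.Finite := by
    refine (hf1.union hf2).subset fun V hV ↦ ?_
    rw [← hsupp] at hV
    by_contra hcon
    rw [Set.mem_union, not_or, Function.notMem_support, Function.notMem_support] at hcon
    exact hV (by rw [hg]; simp only; rw [hcon.1, hcon.2, sub_zero])
  refine ⟨hfin, ?_, ?_⟩
  · rw [← hsum, Set.ncard_eq_toFinset_card B hfin,
      finsum_eq_sum_of_support_subset g (s := hfin.toFinset) (by simp [hsupp])]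
    rw [Finset.card_eq_sum_ones, Nat.cast_sum]
    refine Finset.sum_le_sum fun V hV ↦ ?_
    have := (hgB V).1 (hfin.mem_toFinset.1 hV)
    rw [Nat.cast_one]
    exact this
  · intro hempty
    rw [← hsum]
    have : Function.support g = ∅ := by rw [hsupp, hempty]
    rw [Function.support_eq_empty_iff.1 this]
    simp

end Sections

end ScrollDegree

/-! ### The scroll of a plane over a function field, and its degree -/

section Linear

variable {n : ℕ}

lemma mk_mem_linearSubspace {W : Submodule ℂ (Fin (n + 1) → ℂ)} {v : Fin (n + 1) → ℂ}
    {hv : v ≠ 0} : Projectivization.mk ℂ v hv ∈ linearSubspace W ↔ v ∈ W := by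
  change (Projectivization.mk ℂ v hv).submodule ≤ W ↔ _
  rw [Projectivization.submodule_mk, Submodule.span_singleton_le_iff_mem]

lemma exists_mk_eq (x : PPoints n) : ∃ (v : Fin (n + 1) → ℂ) (hv : v ≠ 0),
    Projectivization.mk ℂ v hv = x :=
  ⟨x.rep, x.rep_nonzero, x.mk_rep⟩

/-- A subspace of codimension two is the common kernel of two functionals. -/
lemma exists_functionals (W : Submodule ℂ (Fin (n + 1) → ℂ)) (hW : Module.finrank ℂ W + 2 = n + 1) :
    ∃ T T' : Fin (n + 1) → ℂ, ∀ c, c ∈ W ↔ ∑ k, T k * c k = 0 ∧ ∑ k, T' k * c k = 0 := by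
  have h1 := W.finrank_quotient_add_finrank
  rw [Module.finrank_fin_fun] at h1
  let B := Module.finBasisOfFinrankEq ℂ ((Fin (n + 1) → ℂ) ⧸ W) (by omega : _ = 2)
  have hf : ∀ (f : (Fin (n + 1) → ℂ) →ₗ[ℂ] ℂ) (c : Fin (n + 1) → ℂ),
      ∑ k, f (Pi.single k 1) * c k = f c := by
    intro f c
    conv_rhs => rw [LinearMap.pi_apply_eq_sum_univ f c]
    refine Finset.sum_congr rfl fun k _ ↦ ?_
    rw [smul_eq_mul, mul_comm]
    congr 2
    ext l
    simp [Pi.single_apply, eq_comm]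
  refine ⟨fun k ↦ (B.coord 0 ∘ₗ W.mkQ) (Pi.single k 1),
    fun k ↦ (B.coord 1 ∘ₗ W.mkQ) (Pi.single k 1), fun c ↦ ?_⟩
  rw [hf, hf]
  constructor
  · intro hc
    simp [(Submodule.Quotient.mk_eq_zero W).2 hc]
  · rintro ⟨h1, h2⟩
    rw [← Submodule.Quotient.mk_eq_zero, ← B.forall_coord_eq_zero_iff]
    intro i
    fin_cases i
    · exact h1
    · exact h2

lemma infinite_linearSubspace {W : Submodule ℂ (Fin (n + 1) → ℂ)} (hW : 2 ≤ Module.finrank ℂ W) :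
    (linearSubspace W).Infinite := by
  obtain ⟨f, hf⟩ := exists_linearIndependent_of_le_finrank hW
  have hf' : ∀ s t : ℂ, s • f 0 + t • f 1 = 0 → s = 0 ∧ t = 0 := by
    have h2 : f = ![f 0, f 1] := by ext k : 1; fin_cases k <;> rfl
    rw [h2] at hf
    exact LinearIndependent.pair_iff.1 hf
  have hne : ∀ t : ℂ, ((f 0 + t • f 1 : W) : Fin (n + 1) → ℂ) ≠ 0 := by
    intro t h
    have := hf' 1 t (by rw [one_smul]; exact Subtype.ext h)
    exact one_ne_zero this.1
  refine Set.infinite_of_injective_forall_mem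
    (f := fun t : ℂ ↦ Projectivization.mk ℂ ((f 0 + t • f 1 : W) : Fin (n + 1) → ℂ) (hne t)) ?_ ?_
  · intro t t' h
    obtain ⟨a, ha⟩ := (Projectivization.mk_eq_mk_iff' ℂ _ _ _ _).1 h
    have ha' : a • (f 0 + t' • f 1) = f 0 + t • f 1 := Subtype.ext ha
    have := hf' (a - 1) (a * t' - t) (by
      have : a • (f 0 + t' • f 1) - (f 0 + t • f 1) = 0 := sub_eq_zero.2 ha'
      rw [← this]
      module)
    have h1 : a = 1 := sub_eq_zero.1 this.1
    have h2 := this.2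
    rw [h1, one_mul] at h2
    exact (sub_eq_zero.1 h2).symm
  · intro t
    exact mk_mem_linearSubspace.2 (f 0 + t • f 1 : W).2

lemma finrank_le_one_of_finite {W : Submodule ℂ (Fin (n + 1) → ℂ)}
    (hW : (linearSubspace W).Finite) : Module.finrank ℂ W ≤ 1 := by
  by_contra! h
  exact infinite_linearSubspace h hW

lemma mk_eq_mk_of_finrank_le_one {W : Submodule ℂ (Fin (n + 1) → ℂ)}
    (hW : Module.finrank ℂ W ≤ 1) {v w : Fin (n + 1) → ℂ} (hv : v ≠ 0) (hw : w ≠ 0)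
    (hvW : v ∈ W) (hwW : w ∈ W) : Projectivization.mk ℂ v hv = Projectivization.mk ℂ w hw := by
  obtain ⟨z, hz⟩ := finrank_le_one_iff.1 hW
  obtain ⟨a, ha⟩ := hz ⟨v, hvW⟩
  obtain ⟨b, hb⟩ := hz ⟨w, hwW⟩
  have ha' : a • (z : Fin (n + 1) → ℂ) = v := congrArg Subtype.val ha
  have hb' : b • (z : Fin (n + 1) → ℂ) = w := congrArg Subtype.val hb
  have hb0 : b ≠ 0 := by
    rintro rfl
    exact hw (by rw [← hb', zero_smul])
  rw [Projectivization.mk_eq_mk_iff']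
  exact ⟨a * b⁻¹, by rw [← hb', ← ha', smul_smul, mul_assoc, inv_mul_cancel₀ hb0, mul_one]⟩

end Linear

section Scroll

variable {K : Type} [Field K] [Algebra ℂ K] {n : ℕ}

/-- The scroll of a plane `Λ` in `Kⁿ⁺¹`: the union over the places of `K` of the lines given by the
reductions of `Λ`. -/
def scroll (Λ : Submodule K (Fin (n + 1) → K)) : Set (PPoints n) :=
  ⋃ V : Place K, linearSubspace (red V Λ)

lemma mk_mem_scroll {Λ : Submodule K (Fin (n + 1) → K)} {v : Fin (n + 1) → ℂ} {hv : v ≠ 0} :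
    Projectivization.mk ℂ v hv ∈ scroll Λ ↔ ∃ V, v ∈ red V Λ := by
  simp only [scroll, Set.mem_iUnion, mk_mem_linearSubspace]

variable [IsCurveField K] {Λ : Submodule K (Fin (n + 1) → K)} {b b' : Fin (n + 1) → K}

/-- A function that takes finitely many values, outside a finite set of places, is constant. -/
lemma mem_range_of_finite_values {f : K} {B : Set (Place K)} (hB : B.Finite) {S : Set ℂ}
    (hS : S.Finite)
    (h : ∀ V ∉ B, ∃ c ∈ S, f - algebraMap ℂ K c ∈ V.1.nonunits) :
    f ∈ Set.range (algebraMap ℂ K) := by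
  by_contra hf
  have hinf : (Bᶜ : Set (Place K)).Infinite := hB.infinite_compl
  refine hinf (Set.Finite.subset (hS.biUnion fun c _ ↦ finite_mem_nonunits
    (f := f - algebraMap ℂ K c) ?_) ?_)
  · intro h0
    exact hf ⟨c, (sub_eq_zero.1 h0).symm⟩
  · intro V hV
    obtain ⟨c, hc, hc'⟩ := h V hV
    exact Set.mem_biUnion hc hc'

/-- If the determinant of two functionals vanishes on the plane `Λ`, and their common kernel `W`
meets the scroll in finitely many points, then `Λ` contains a constant vector of `W`. -/
lemma exists_constant_of_pairDet_eq_zero (hΛ : Λ = Submodule.span K {b, b'})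
    (hl : LinearIndependent K ![b, b'])
    {W : Submodule ℂ (Fin (n + 1) → ℂ)} {T T' : Fin (n + 1) → ℂ}
    (hW : ∀ c, c ∈ W ↔ ∑ k, T k * c k = 0 ∧ ∑ k, T' k * c k = 0)
    (hD : pairDet T T' b b' = 0) (hfin : (scroll Λ ∩ linearSubspace W).Finite) :
    ∃ c : Fin (n + 1) → ℂ, c ≠ 0 ∧ c ∈ W ∧ ∀ V, c ∈ red V Λ := by
  obtain ⟨z, hz0, hzΛ, hz1, hz2⟩ : ∃ z : Fin (n + 1) → K, z ≠ 0 ∧ z ∈ Λ ∧ functional T z = 0 ∧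
      functional T' z = 0 := by
    have hbΛ : b ∈ Λ := hΛ ▸ Submodule.subset_span (by simp)
    have hbΛ' : b' ∈ Λ := hΛ ▸ Submodule.subset_span (by simp)
    rw [pairDet] at hD
    have hmk : ∀ x y : K, (x ≠ 0 ∨ y ≠ 0) → x • b + y • b' ≠ 0 := fun x y hxy h ↦ by
      have := LinearIndependent.pair_iff.1 hl x y h
      tauto
    by_cases h1 : functional T b = 0 ∧ functional T b' = 0
    · by_cases h2 : functional T' b = 0 ∧ functional T' b' = 0
      · exact ⟨b, hl.ne_zero 0, hbΛ, h1.1, h2.1⟩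
      · refine ⟨functional T' b' • b + (-functional T' b) • b', hmk _ _ ?_,
          add_mem (Λ.smul_mem _ hbΛ) (Λ.smul_mem _ hbΛ'), ?_, ?_⟩
        · by_contra! hcon
          exact h2 ⟨neg_eq_zero.1 hcon.2, hcon.1⟩
        · simp [h1.1, h1.2]
        · simp; ring
    · refine ⟨functional T b' • b + (-functional T b) • b', hmk _ _ ?_,
          add_mem (Λ.smul_mem _ hbΛ) (Λ.smul_mem _ hbΛ'), ?_, ?_⟩
      · by_contra! hcon
        exact h1 ⟨neg_eq_zero.1 hcon.2, hcon.1⟩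
      · simp; ring
      · simp; linear_combination -hD
  obtain ⟨m, hm⟩ := Function.ne_iff.1 hz0
  have hm : z m ≠ 0 := hm
  -- normalize one coordinate to `1`
  obtain ⟨x, hxm, hxΛ, hx1, hx2⟩ : ∃ x : Fin (n + 1) → K, x m = 1 ∧ x ∈ Λ ∧ functional T x = 0 ∧
      functional T' x = 0 :=
    ⟨(z m)⁻¹ • z, by simp [hm], Λ.smul_mem _ hzΛ, by simp [hz1], by simp [hz2]⟩
  have hB : (⋃ k, {V : Place K | x k ∉ V.1}).Finite := Set.finite_iUnion fun k ↦ finite_notMem _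
  set B := ⋃ k, {V : Place K | x k ∉ V.1} with hBdef
  have hreg : ∀ V ∉ B, ∀ k, x k ∈ V.1 := by
    intro V hV k
    by_contra hcon
    exact hV (Set.mem_iUnion.2 ⟨k, hcon⟩)
  have hWmem : ∀ V : Place K, ∀ c : Fin (n + 1) → ℂ,
      (∀ k, x k - algebraMap ℂ K (c k) ∈ V.1.nonunits) → c ∈ W := by
    intro V c hc
    rw [hW]
    have h1 := functional_sub_mem hc T
    have h2 := functional_sub_mem hc T'
    rw [hx1, zero_sub, neg_mem_iff, algebraMap_mem_nonunits_iff] at h1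
    rw [hx2, zero_sub, neg_mem_iff, algebraMap_mem_nonunits_iff] at h2
    exact ⟨h1, h2⟩
  have hval : ∀ V ∉ B, resVec V x m = 1 ∧ resVec V x ∈ W ∧ resVec V x ∈ red V Λ := by
    intro V hV
    refine ⟨resVec_eq (by rw [hxm, map_one, sub_self]; exact zero_mem _),
      hWmem V _ fun k ↦ sub_resVec_mem (hreg V hV k), resVec_mem_red hxΛ (hreg V hV)⟩
  have hconst : ∀ k, x k ∈ Set.range (algebraMap ℂ K) := by
    intro k
    -- the ratio of the coordinates `k` and `m` takes finitely many values on the intersection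
    refine mem_range_of_finite_values hB (S := (fun p : PPoints n ↦ p.rep k / p.rep m) ''
      (scroll Λ ∩ linearSubspace W)) (hfin.image _) fun V hV ↦ ?_
    obtain ⟨h1, h2, h3⟩ := hval V hV
    have hne : resVec V x ≠ 0 := fun h ↦ by
      rw [h] at h1
      exact zero_ne_one h1
    refine ⟨resVec V x k, ⟨Projectivization.mk ℂ _ hne, ⟨mk_mem_scroll.2 ⟨V, h3⟩,
      mk_mem_linearSubspace.2 h2⟩, ?_⟩, sub_resVec_mem (hreg V hV k)⟩
    obtain ⟨a, ha⟩ := Projectivization.exists_smul_eq_mk_rep ℂ _ hne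
    simp only [← ha, Pi.smul_apply, Units.smul_def, smul_eq_mul, h1, mul_one]
    rw [mul_div_cancel_left₀ _ a.ne_zero]
  choose c hc using hconst
  have hcm : c m = 1 := by
    have := hc m
    rw [hxm] at this
    exact (algebraMap ℂ K).injective (this.trans (map_one _).symm)
  have hall : ∀ V : Place K, ∀ k, x k - algebraMap ℂ K (c k) ∈ V.1.nonunits := fun V k ↦ by
    rw [hc, sub_self]; exact zero_mem _
  obtain ⟨V0⟩ : Nonempty (Place K) := inferInstance
  exact ⟨c, fun h ↦ by rw [h] at hcm; exact zero_ne_one hcm, hWmem V0 c (hall V0),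
    fun V ↦ ⟨x, hxΛ, hall V⟩⟩

/-- A point off the line given by `red V Λ` and that line can be separated: some subspace of
codimension two contains the point and misses the line. -/
lemma exists_functionals_disjoint (V : Place K) (hΛ : Module.finrank K Λ = 2)
    {y : Fin (n + 1) → ℂ} (hy : y ∉ red V Λ) :
    ∃ T T' : Fin (n + 1) → ℂ, (∑ k, T k * y k = 0 ∧ ∑ k, T' k * y k = 0) ∧
      ∀ c ∈ red V Λ, ∑ k, T k * c k = 0 → ∑ k, T' k * c k = 0 → c = 0 := by
  have hdisj : Disjoint (Submodule.span ℂ {y}) (red V Λ) := by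
    rw [Submodule.disjoint_def]
    intro x hx hx'
    obtain ⟨a, rfl⟩ := Submodule.mem_span_singleton.1 hx
    by_cases ha : a = 0
    · simp [ha]
    · exact absurd ((Submodule.smul_mem_iff _ ha).1 hx') hy
  obtain ⟨W, hyW, hW⟩ := hdisj.exists_isCompl
  have h1 := Submodule.finrank_add_eq_of_isCompl hW
  rw [finrank_red V hΛ, Module.finrank_fin_fun] at h1
  obtain ⟨T, T', hT⟩ := exists_functionals W h1
  refine ⟨T, T', (hT y).1 (hyW (Submodule.mem_span_singleton_self y)), fun c hc h1 h2 ↦ ?_⟩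
  exact Submodule.disjoint_def.1 hW.disjoint c ((hT c).2 ⟨h1, h2⟩) hc

/-- If the common kernel of two functionals misses one of the lines, then the determinant does not
vanish identically. -/
lemma pairDet_ne_zero (hΛ : Λ = Submodule.span K {b, b'})
    (hl : LinearIndependent K ![b, b']) {V : Place K} {T T' : Fin (n + 1) → ℂ}
    (h : ∀ c ∈ red V Λ, ∑ k, T k * c k = 0 → ∑ k, T' k * c k = 0 → c = 0) :
    pairDet T T' b b' ≠ 0 := by
  intro h0
  obtain ⟨i, j, hij, hm⟩ := exists_max_minor V.1 hl
  have hΛ2 : Module.finrank K Λ = 2 := by rw [hΛ]; exact finrank_span_pair hl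
  obtain ⟨_, h2⟩ := pairDet_div (V := V) hΛ2 (hΛ ▸ Submodule.subset_span (by simp))
    (hΛ ▸ Submodule.subset_span (by simp)) hij hm T T'
  rw [h0, zero_div] at h2
  obtain ⟨c, hc, hc0, h3, h4⟩ := h2.1 (zero_mem _)
  exact hc0 (h c hc h3 h4)

/-- A scroll with at least two different lines has positive degree: a general subspace through a
point of one line that is not on the other meets the scroll properly. -/
lemma one_le_planeDegree (hΛ : Λ = Submodule.span K {b, b'})
    (hl : LinearIndependent K ![b, b']) {V V' : Place K} (hV : red V Λ ≠ red V' Λ) :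
    1 ≤ planeDegree b b' := by
  have hΛ2 : Module.finrank K Λ = 2 := by rw [hΛ]; exact finrank_span_pair hl
  obtain ⟨y, hy, hy'⟩ : ∃ y ∈ red V Λ, y ∉ red V' Λ := by
    by_contra! h
    exact hV (Submodule.eq_of_le_of_finrank_eq h (by rw [finrank_red V hΛ2, finrank_red V' hΛ2]))
  have hy0 : y ≠ 0 := by
    rintro rfl
    exact hy' (zero_mem _)
  obtain ⟨T, T', hTy, hT⟩ := exists_functionals_disjoint V' hΛ2 hy'
  obtain ⟨h1, h2, -⟩ := ncard_meeting_le_planeDegree hΛ2 hl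
    (hΛ ▸ Submodule.subset_span (by simp)) (hΛ ▸ Submodule.subset_span (by simp)) T T'
    (pairDet_ne_zero hΛ hl hT)
  refine le_trans ?_ h2
  rw [Nat.one_le_cast]
  exact Nat.one_le_iff_ne_zero.2 (Set.ncard_ne_zero_of_mem (a := V) ⟨y, hy, hy0, hTy⟩ h1)

/-- The plane has degree zero if all its reductions are equal. -/
lemma planeDegree_eq_zero (hΛ : Λ = Submodule.span K {b, b'})
    (hl : LinearIndependent K ![b, b']) (h : ∀ V V' : Place K, red V Λ = red V' Λ) :
    planeDegree b b' = 0 := by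
  have hΛ2 : Module.finrank K Λ = 2 := by rw [hΛ]; exact finrank_span_pair hl
  obtain ⟨V0⟩ : Nonempty (Place K) := inferInstance
  obtain ⟨W, hW⟩ := (red V0 Λ).exists_isCompl
  have h1 := Submodule.finrank_add_eq_of_isCompl hW
  rw [finrank_red V0 hΛ2, Module.finrank_fin_fun, add_comm] at h1
  obtain ⟨T, T', hT⟩ := exists_functionals W h1
  have hT0 : ∀ V, ∀ c ∈ red V Λ, ∑ k, T k * c k = 0 → ∑ k, T' k * c k = 0 → c = 0 := by
    intro V c hc h1 h2
    rw [h V V0] at hc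
    exact Submodule.disjoint_def.1 hW.disjoint c hc ((hT c).2 ⟨h1, h2⟩)
  refine (ncard_meeting_le_planeDegree hΛ2 hl
    (hΛ ▸ Submodule.subset_span (by simp)) (hΛ ▸ Submodule.subset_span (by simp)) T T'
    (pairDet_ne_zero hΛ hl (hT0 V0))).2.2 ?_
  ext V
  simp only [Set.mem_ofPred_eq, Set.mem_empty_iff_false, iff_false]
  rintro ⟨c, hc, hc0, h1, h2⟩
  exact hc0 (hT0 V c hc h1 h2)

/-- A proper intersection of the scroll with a subspace `W` of codimension two has at most
`planeDegree b b'` points. If the determinant of two equations of `W` is not zero, its zeros are the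
places whose line meets `W`. If it is zero, all lines pass through one point of `W`, and this is the
only point of the intersection. -/
lemma encard_inter_le (hΛ : Λ = Submodule.span K {b, b'})
    (hl : LinearIndependent K ![b, b']) {V V' : Place K} (hV : red V Λ ≠ red V' Λ)
    (W : Submodule ℂ (Fin (n + 1) → ℂ)) (hW : Module.finrank ℂ W + 2 = n + 1)
    (hfin : (scroll Λ ∩ linearSubspace W).Finite) :
    (scroll Λ ∩ linearSubspace W).encard ≤ (planeDegree b b').toNat := by
  have hΛ2 : Module.finrank K Λ = 2 := by rw [hΛ]; exact finrank_span_pair hl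
  obtain ⟨T, T', hT⟩ := exists_functionals W hW
  -- each line meets `W` in at most one point
  have hone : ∀ V, Module.finrank ℂ (red V Λ ⊓ W : Submodule ℂ (Fin (n + 1) → ℂ)) ≤ 1 := by
    intro V
    refine finrank_le_one_of_finite (hfin.subset fun x hx ↦ ?_)
    obtain ⟨v, hv, rfl⟩ := exists_mk_eq x
    have hx' := mk_mem_linearSubspace.1 hx
    exact ⟨mk_mem_scroll.2 ⟨V, hx'.1⟩, mk_mem_linearSubspace.2 hx'.2⟩
  by_cases hD : pairDet T T' b b' = 0
  · obtain ⟨c, hc0, hcW, hc⟩ := exists_constant_of_pairDet_eq_zero hΛ hl hT hD hfin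
    have hsub : scroll Λ ∩ linearSubspace W ⊆ {Projectivization.mk ℂ c hc0} := by
      rintro x ⟨hx, hxW⟩
      obtain ⟨v, hv, rfl⟩ := exists_mk_eq x
      obtain ⟨V, hvV⟩ := mk_mem_scroll.1 hx
      exact mk_eq_mk_of_finrank_le_one (hone V) _ _ ⟨hvV, mk_mem_linearSubspace.1 hxW⟩
        ⟨hc V, hcW⟩
    refine (Set.encard_le_encard hsub).trans ?_
    rw [Set.encard_singleton]
    have := one_le_planeDegree hΛ hl hV
    exact_mod_cast (by omega : 1 ≤ (planeDegree b b').toNat)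
  · obtain ⟨h1, h2, -⟩ := ncard_meeting_le_planeDegree hΛ2 hl
      (hΛ ▸ Submodule.subset_span (by simp)) (hΛ ▸ Submodule.subset_span (by simp)) T T' hD
    set B := {V : Place K | ∃ c ∈ red V Λ, c ≠ 0 ∧ ∑ k, T k * c k = 0 ∧ ∑ k, T' k * c k = 0}
      with hB
    have hex : ∀ x ∈ scroll Λ ∩ linearSubspace W, ∃ V ∈ B, x ∈ linearSubspace (red V Λ ⊓ W) := by
      rintro x ⟨hx, hxW⟩
      obtain ⟨v, hv, rfl⟩ := exists_mk_eq x
      obtain ⟨V, hvV⟩ := mk_mem_scroll.1 hx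
      rw [mk_mem_linearSubspace] at hxW
      exact ⟨V, ⟨v, hvV, hv, (hT v).1 hxW⟩, mk_mem_linearSubspace.2 ⟨hvV, hxW⟩⟩
    choose! F hFB hF using hex
    have hle : (scroll Λ ∩ linearSubspace W).encard ≤ B.encard := by
      refine Set.encard_le_encard_of_injOn hFB fun x hx y hy hxy ↦ ?_
      have hx' := hF x hx
      have hy' := hF y hy
      rw [← hxy] at hy'
      obtain ⟨v, hv, rfl⟩ := exists_mk_eq x
      obtain ⟨w, hw, rfl⟩ := exists_mk_eq y
      exact mk_eq_mk_of_finrank_le_one (hone _) _ _ (mk_mem_linearSubspace.1 hx')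
        (mk_mem_linearSubspace.1 hy')
    refine hle.trans ?_
    rw [← h1.cast_ncard_eq]
    exact_mod_cast (by omega : B.ncard ≤ (planeDegree b b').toNat)

/-- The degree of a scroll is at most the degree of its plane. -/
theorem surfaceDegree_scroll_le (hΛ : Λ = Submodule.span K {b, b'})
    (hl : LinearIndependent K ![b, b']) {V V' : Place K} (hV : red V Λ ≠ red V' Λ) :
    surfaceDegree (scroll Λ) ≤ (planeDegree b b').toNat :=
  iSup_le fun W ↦ iSup_le fun hW ↦ iSup_le fun hfin ↦ encard_inter_le hΛ hl hV W hW hfin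

end Scroll

/-! ### The ideal and the dimension of the scroll of a plane -/

section Residues

/-- The restriction of a valuation ring to a subfield is dominated by it. -/
lemma algebraMap_mem_nonunits_of_comap {K L : Type*} [Field K] [Field L] [Algebra K L]
    {V : ValuationSubring L} {x : K} (hx : x ∈ (V.comap (algebraMap K L)).nonunits) :
    algebraMap K L x ∈ V.nonunits := by
  by_contra h
  have h1 := inv_mem_of_notMem_nonunits h
  rw [← map_inv₀] at h1
  have h2 := mul_mem_nonunits (V := V.comap (algebraMap K L)) h1 hx
  rcases eq_or_ne x 0 with rfl | h0
  · exact h (by rw [map_zero]; exact zero_mem _)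
  · rw [inv_mul_cancel₀ h0] at h2
    exact one_notMem_nonunits _ h2

lemma eq_zero_of_algebraMap_mem_nonunits {K L : Type*} [Field K] [Field L] [Algebra K L]
    {V : ValuationSubring L} {x : K} (hx : algebraMap K L x ∈ V.nonunits)
    (hV : algebraMap K L x⁻¹ ∈ V) : x = 0 := by
  by_contra h0
  have := mul_mem_nonunits hV hx
  rw [← map_mul, inv_mul_cancel₀ h0, map_one] at this
  exact one_notMem_nonunits _ this

variable {K : Type} [Field K] [Algebra ℂ K]

/-- The value of a polynomial commutes with the reduction at a place. -/
lemma aeval_sub_mem_nonunits {ι : Type} {V : Place K} {v : ι → K} {c : ι → ℂ}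
    (h : ∀ k, v k - algebraMap ℂ K (c k) ∈ V.1.nonunits) (f : MvPolynomial ι ℂ) :
    MvPolynomial.aeval v f - algebraMap ℂ K (MvPolynomial.eval c f) ∈ V.1.nonunits := by
  have hv : ∀ k, v k ∈ V.1 := fun k ↦ mem_of_sub_mem_nonunits (h k)
  induction f using MvPolynomial.induction_on with
  | C a => simp
  | add p q hp hq =>
    convert add_mem hp hq using 1
    simp only [map_add]
    ring
  | mul_X p k hp =>
    have hp' : algebraMap ℂ K (MvPolynomial.eval c p) ∈ V.1 := V.2.1 _
    convert add_mem (mul_mem_nonunits (hv k) hp) (mul_mem_nonunits hp' (h k)) using 1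
    simp only [map_mul, MvPolynomial.aeval_X, MvPolynomial.eval_X]
    ring

/-- The restriction of polynomials to the plane spanned by `b` and `b'`. -/
def planeRestriction {ι : Type} (b b' : ι → K) :
    MvPolynomial ι ℂ →ₐ[ℂ] MvPolynomial (Fin 2) K :=
  MvPolynomial.aeval fun k ↦
    MvPolynomial.C (b k) * MvPolynomial.X 0 + MvPolynomial.C (b' k) * MvPolynomial.X 1

lemma eval_planeRestriction {ι : Type} (b b' : ι → K) (x : Fin 2 → K) (f : MvPolynomial ι ℂ) :
    MvPolynomial.eval x (planeRestriction b b' f) =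
      MvPolynomial.aeval (x 0 • b + x 1 • b') f := by
  induction f using MvPolynomial.induction_on with
  | C a =>
    rw [planeRestriction, MvPolynomial.aeval_C, MvPolynomial.aeval_C,
      IsScalarTower.algebraMap_apply ℂ K (MvPolynomial (Fin 2) K), MvPolynomial.algebraMap_eq,
      MvPolynomial.eval_C]
  | add p q hp hq => simp only [map_add, hp, hq]
  | mul_X p k hp =>
    simp only [map_mul, hp]
    congr 1
    simp [planeRestriction]
    ring

lemma planeRestriction_eq_zero_iff {ι : Type} {b b' : ι → K} {Λ : Submodule K (ι → K)}
    (hΛ : Λ = Submodule.span K {b, b'}) (f : MvPolynomial ι ℂ) :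
    planeRestriction b b' f = 0 ↔ ∀ v ∈ Λ, MvPolynomial.aeval v f = 0 := by
  have : Infinite K := Infinite.of_injective _ (algebraMap ℂ K).injective
  rw [MvPolynomial.funext_iff]
  constructor
  · intro h v hv
    rw [hΛ] at hv
    obtain ⟨s, t, rfl⟩ := Submodule.mem_span_pair.1 hv
    have := h ![s, t]
    rw [eval_planeRestriction, map_zero] at this
    exact this
  · intro h x
    rw [eval_planeRestriction, map_zero]
    refine h _ ?_
    rw [hΛ]
    exact Submodule.mem_span_pair.2 ⟨_, _, rfl⟩

end Residues

section ScrollIdeal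

variable {K : Type} [Field K] [Algebra ℂ K] [IsCurveField K] {n : ℕ}
  {Λ : Submodule K (Fin (n + 1) → K)} {b b' : Fin (n + 1) → K}

lemma mem_idealOf_iff {S : Set (PPoints n)} {f : MvPolynomial (Fin (n + 1)) ℂ} :
    f ∈ idealOf S ↔ ∀ v (hv : v ≠ 0), Projectivization.mk ℂ v hv ∈ S →
      MvPolynomial.eval v f = 0 := by
  rw [idealOf, MvPolynomial.mem_vanishingIdeal_iff]
  constructor
  · intro h v hv hvS
    exact h v ⟨hv, hvS⟩
  · rintro h v ⟨hv, hvS⟩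
    exact h v hv hvS

/-- The polynomials that vanish on the scroll of `Λ` are those that vanish on `Λ`: a function that
vanishes at infinitely many places is zero. -/
theorem mem_idealOf_scroll_iff (hΛ : Λ = Submodule.span K {b, b'})
    (hl : LinearIndependent K ![b, b']) {f : MvPolynomial (Fin (n + 1)) ℂ} :
    f ∈ idealOf (scroll Λ) ↔ planeRestriction b b' f = 0 := by
  rw [mem_idealOf_iff]
  constructor
  · intro h
    by_contra h0
    -- a vector of `Λ` at which neither `f` nor the first coefficient vanishes
    obtain ⟨x, hx⟩ : ∃ x : Fin 2 → K,
        MvPolynomial.eval x (planeRestriction b b' f * MvPolynomial.X 0) ≠ 0 := by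
      by_contra! hcon
      have : Infinite K := Infinite.of_injective _ (algebraMap ℂ K).injective
      have := MvPolynomial.funext (p := planeRestriction b b' f * MvPolynomial.X 0) (q := 0)
        (fun x ↦ by rw [hcon x, map_zero])
      exact (mul_ne_zero h0 (MvPolynomial.X_ne_zero 0)) this
    rw [map_mul, MvPolynomial.eval_X, eval_planeRestriction] at hx
    obtain ⟨hx1, hx0⟩ := mul_ne_zero_iff.1 hx
    set v := x 0 • b + x 1 • b' with hv
    have hvΛ : v ∈ Λ := by rw [hΛ]; exact Submodule.mem_span_pair.2 ⟨_, _, rfl⟩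
    have hv0 : v ≠ 0 := fun h ↦ hx0 (LinearIndependent.pair_iff.1 hl _ _ h).1
    obtain ⟨m, hm⟩ := Function.ne_iff.1 hv0
    have hfin : ((⋃ k, {V : Place K | v k ∉ V.1}) ∪ {V : Place K | v m ∈ V.1.nonunits} ∪
        {V : Place K | MvPolynomial.aeval v f ∈ V.1.nonunits}).Finite :=
      ((Set.finite_iUnion fun k ↦ finite_notMem _).union (finite_mem_nonunits hm)).union
        (finite_mem_nonunits hx1)
    obtain ⟨V, hV⟩ := hfin.infinite_compl.nonempty
    simp only [Set.mem_compl_iff, Set.mem_union, not_or, Set.mem_iUnion, not_exists,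
      Set.mem_ofPred_eq, not_not] at hV
    obtain ⟨⟨hV1, hV2⟩, hV3⟩ := hV
    have hres : ∀ k, v k - algebraMap ℂ K (resVec V v k) ∈ V.1.nonunits :=
      fun k ↦ sub_resVec_mem (hV1 k)
    have hne : resVec V v ≠ 0 := by
      intro h
      have := hres m
      rw [h, Pi.zero_apply, map_zero, sub_zero] at this
      exact hV2 this
    have h1 := h _ hne (mk_mem_scroll.2 ⟨V, resVec_mem_red hvΛ hV1⟩)
    have h2 := aeval_sub_mem_nonunits hres f
    rw [h1, map_zero, sub_zero] at h2
    exact hV3 h2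
  · intro h c hc hcS
    obtain ⟨V, v, hv, hvc⟩ := mk_mem_scroll.1 hcS
    have h1 := aeval_sub_mem_nonunits hvc f
    rw [(planeRestriction_eq_zero_iff hΛ f).1 h v hv, zero_sub, neg_mem_iff,
      algebraMap_mem_nonunits_iff] at h1
    exact h1

/-- The scroll is irreducible: its ideal is the kernel of a homomorphism to the polynomial ring
`K[s, t]`. -/
lemma isPrime_idealOf_scroll (hΛ : Λ = Submodule.span K {b, b'})
    (hl : LinearIndependent K ![b, b']) : (idealOf (scroll Λ)).IsPrime := by
  have : idealOf (scroll Λ) = RingHom.ker (planeRestriction b b') := by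
    ext f
    rw [mem_idealOf_scroll_iff hΛ hl, RingHom.mem_ker]
  rw [this]
  exact RingHom.ker_isPrime _

/-- The scroll is closed. A point in its closure is the center of a valuation of the function field
of `Λ`; the restriction of that valuation to `K` is a place, or it is trivial, and then the point is
a constant vector of `Λ`. -/
lemma isZariskiClosed_scroll (hΛ : Λ = Submodule.span K {b, b'})
    (hl : LinearIndependent K ![b, b']) : IsZariskiClosed (scroll Λ) := by
  intro c hc0 hc
  have hΛ2 : Module.finrank K Λ = 2 := by rw [hΛ]; exact finrank_span_pair hl
  rw [mk_mem_scroll]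
  let P := MvPolynomial (Fin 2) K
  let L := FractionRing P
  let ψ : MvPolynomial (Fin (n + 1)) ℂ →+* L :=
    (algebraMap P L).comp (planeRestriction b b').toRingHom
  have hψ0 : ∀ f, ψ f = 0 → MvPolynomial.eval c f = 0 := by
    intro f hf
    refine hc f ((mem_idealOf_scroll_iff hΛ hl).2 ?_)
    exact (map_eq_zero_iff _ (IsFractionRing.injective P L)).1 hf
  let I : Ideal ψ.range := (RingHom.ker (MvPolynomial.eval c)).map ψ.rangeRestrict
  have hI : I ≠ ⊤ := by
    rw [Ne, Ideal.eq_top_iff_one, Ideal.mem_map_iff_of_surjective _ ψ.rangeRestrict_surjective]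
    rintro ⟨f, hf, hf1⟩
    have h1 : ψ (f - 1) = 0 := by
      have : ψ f = 1 := congrArg Subtype.val hf1
      rw [map_sub, this, map_one, sub_self]
    have h2 := hψ0 _ h1
    rw [map_sub, (RingHom.mem_ker).1 hf, map_one, zero_sub, neg_eq_zero] at h2
    exact one_ne_zero h2
  obtain ⟨𝒱, h𝒱, hI𝒱⟩ := Ideal.image_subset_nonunits_valuationSubring I hI
  have hz : ∀ f, MvPolynomial.eval c f = 0 → ψ f ∈ 𝒱.nonunits := fun f hf ↦
    hI𝒱 ⟨ψ.rangeRestrict f, Ideal.mem_map_of_mem _ hf, rfl⟩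
  let x : Fin (n + 1) → L := fun k ↦ ψ (MvPolynomial.X k)
  let s : L := algebraMap P L (MvPolynomial.X 0)
  let t : L := algebraMap P L (MvPolynomial.X 1)
  have hKL : ∀ a : K, algebraMap P L (MvPolynomial.C a) = algebraMap K L a := fun a ↦
    (IsScalarTower.algebraMap_apply K P L a).symm
  have hψC : ∀ a : ℂ, ψ (MvPolynomial.C a) = algebraMap K L (algebraMap ℂ K a) := by
    intro a
    change algebraMap P L (planeRestriction b b' (MvPolynomial.C a)) = _
    rw [planeRestriction, MvPolynomial.aeval_C,
      IsScalarTower.algebraMap_apply ℂ K (MvPolynomial (Fin 2) K), MvPolynomial.algebraMap_eq, hKL]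
  have hC𝒱 : ∀ a : ℂ, algebraMap K L (algebraMap ℂ K a) ∈ 𝒱 := fun a ↦
    h𝒱 ⟨MvPolynomial.C a, hψC a⟩
  have hxc : ∀ k, x k - algebraMap K L (algebraMap ℂ K (c k)) ∈ 𝒱.nonunits := by
    intro k
    have := hz (MvPolynomial.X k - MvPolynomial.C (c k)) (by simp)
    rwa [map_sub, hψC] at this
  have hx : ∀ k, x k = s * algebraMap K L (b k) + t * algebraMap K L (b' k) := by
    intro k
    change algebraMap P L (planeRestriction b b' (MvPolynomial.X k)) = _
    rw [planeRestriction, MvPolynomial.aeval_X, map_add, map_mul, map_mul, hKL, hKL]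
    ring
  have hbΛ : b ∈ Λ := hΛ ▸ Submodule.subset_span (by simp)
  have hbΛ' : b' ∈ Λ := hΛ ▸ Submodule.subset_span (by simp)
  -- the generic vector of `Λ` in terms of a chart
  have hchart : ∀ {V : ValuationSubring K} {i j : Fin (n + 1)} {u w : Fin (n + 1) → K},
      Chart V Λ i j u w → ∀ k, x k = x i * algebraMap K L (u k) + x j * algebraMap K L (w k) := by
    intro V i j u w h k
    have e1 := congrFun (h.eq_add hΛ2 hbΛ) k
    have e2 := congrFun (h.eq_add hΛ2 hbΛ') k
    simp only [Pi.add_apply, Pi.smul_apply, smul_eq_mul] at e1 e2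
    rw [hx k, hx i, hx j, e1, e2]
    simp only [map_add, map_mul]
    ring
  let V0 : ValuationSubring K := 𝒱.comap (algebraMap K L)
  have hx𝒱 : ∀ k, x k ∈ 𝒱 := fun k ↦ h𝒱 ⟨MvPolynomial.X k, rfl⟩
  by_cases hV0 : V0 = ⊤
  · have hK𝒱 : ∀ a : K, algebraMap K L a ∈ 𝒱 := fun a ↦ by
      have : a ∈ V0 := by rw [hV0]; exact ValuationSubring.mem_top a
      exact this
    obtain ⟨V⟩ : Nonempty (Place K) := inferInstance
    obtain ⟨i, j, u, w, h⟩ := exists_chart V.1 hΛ2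
    refine ⟨V, fun k ↦ algebraMap ℂ K (c k), ?_, fun k ↦ by rw [sub_self]; exact zero_mem _⟩
    have hcuw : (fun k ↦ algebraMap ℂ K (c k)) =
        algebraMap ℂ K (c i) • u + algebraMap ℂ K (c j) • w := by
      ext k
      simp only [Pi.add_apply, Pi.smul_apply, smul_eq_mul]
      rw [← sub_eq_zero]
      refine eq_zero_of_algebraMap_mem_nonunits (L := L) (V := 𝒱) ?_ (hK𝒱 _)
      have h1 := mul_mem_nonunits (hK𝒱 (u k)) (hxc i)
      have h2 := mul_mem_nonunits (hK𝒱 (w k)) (hxc j)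
      convert sub_mem (add_mem h1 h2) (hxc k) using 1
      rw [hchart h k]
      simp only [map_sub, map_add, map_mul]
      ring
    rw [hcuw]
    exact add_mem (Λ.smul_mem _ h.u_mem) (Λ.smul_mem _ h.w_mem)
  · let V : Place K := ⟨V0, fun a ↦ hC𝒱 a, hV0⟩
    obtain ⟨i, j, u, w, h⟩ := exists_chart V.1 hΛ2
    refine ⟨V, (h.mem_red_iff hΛ2).2 ?_⟩
    ext k
    simp only [Pi.add_apply, Pi.smul_apply, smul_eq_mul]
    rw [← sub_eq_zero]
    apply (algebraMap ℂ K).injective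
    rw [map_zero]
    refine eq_zero_of_algebraMap_mem_nonunits (L := L) (V := 𝒱) ?_
      (by rw [← map_inv₀]; exact hC𝒱 _)
    have hu : algebraMap K L (u k) ∈ 𝒱 := h.u_int k
    have hw : algebraMap K L (w k) ∈ 𝒱 := h.w_int k
    have hu' : u k - algebraMap ℂ K (resVec V u k) ∈ V0.nonunits :=
      sub_resVec_mem (V := V) (h.u_int k)
    have hw' : w k - algebraMap ℂ K (resVec V w k) ∈ V0.nonunits :=
      sub_resVec_mem (V := V) (h.w_int k)
    have h1 := mul_mem_nonunits hu (hxc i)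
    have h2 := mul_mem_nonunits hw (hxc j)
    have h3 := mul_mem_nonunits (hC𝒱 (c i))
      (algebraMap_mem_nonunits_of_comap (L := L) (V := 𝒱) hu')
    have h4 := mul_mem_nonunits (hC𝒱 (c j))
      (algebraMap_mem_nonunits_of_comap (L := L) (V := 𝒱) hw')
    convert sub_mem (add_mem (add_mem h1 h2) (add_mem h3 h4)) (hxc k) using 1
    rw [hchart h k]
    simp only [map_sub, map_add, map_mul]
    ring

lemma ringKrullDim_le_of_isIntegral {R S : Type*} [CommRing R] [CommRing S] (f : R →+* S)
    (hf : f.IsIntegral) : ringKrullDim S ≤ ringKrullDim R := by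
  let _ := f.toAlgebra
  have : Algebra.IsIntegral R S := ⟨hf⟩
  refine Order.krullDim_le_of_strictMono (PrimeSpectrum.comap f) fun p q hpq ↦ ?_
  exact Ideal.IsIntegral.comap_lt_comap (R := R) (I := p.asIdeal) (J := q.asIdeal) hpq

/-- The coordinate ring of the scroll embeds in `K[s, t]`, which has transcendence degree three. -/
lemma ringKrullDim_scroll_le (hΛ : Λ = Submodule.span K {b, b'})
    (hl : LinearIndependent K ![b, b']) :
    ringKrullDim (MvPolynomial (Fin (n + 1)) ℂ ⧸ idealOf (scroll Λ)) ≤ 3 := by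
  have hp := isPrime_idealOf_scroll hΛ hl
  set A := MvPolynomial (Fin (n + 1)) ℂ ⧸ idealOf (scroll Λ) with hA
  obtain ⟨s, g, hg, hgi⟩ := exists_integral_inj_algHom_of_fg ℂ A
  refine (ringKrullDim_le_of_isIntegral g.toRingHom hgi).trans ?_
  rw [MvPolynomial.ringKrullDim_of_isNoetherianRing, ringKrullDim_eq_zero_of_field, zero_add,
    Nat.card_eq_fintype_card, Fintype.card_fin]
  have hs : s ≤ 3 := by
    let χ : A →ₐ[ℂ] MvPolynomial (Fin 2) K := Ideal.Quotient.liftₐ _ (planeRestriction b b')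
      fun f hf ↦ (mem_idealOf_scroll_iff hΛ hl).1 hf
    have hχ : Function.Injective χ := by
      rw [injective_iff_map_eq_zero]
      intro a ha
      obtain ⟨f, rfl⟩ := Ideal.Quotient.mk_surjective a
      exact Ideal.Quotient.eq_zero_iff_mem.2 ((mem_idealOf_scroll_iff hΛ hl).2 ha)
    have h1 := trdeg_le_of_injective (χ.comp g) (hχ.comp hg)
    have h2 := trdeg_add_eq ℂ K (A := MvPolynomial (Fin 2) K)
    rw [IsCurveField.trdeg_eq (K := K), MvPolynomial.trdeg_of_isDomain] at h2
    rw [← h2, MvPolynomial.trdeg_of_isDomain] at h1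
    simp only [Cardinal.mk_fin, Cardinal.lift_natCast] at h1
    norm_cast at h1
  exact_mod_cast hs

/-- The coordinate ring of the scroll has a proper quotient that is a polynomial ring in two
variables: the coordinate ring of one of the lines, which is not the whole scroll because another
line is different. -/
lemma le_ringKrullDim_scroll (hΛ : Λ = Submodule.span K {b, b'})
    (hl : LinearIndependent K ![b, b']) {V V' : Place K} (hV : red V Λ ≠ red V' Λ) :
    3 ≤ ringKrullDim (MvPolynomial (Fin (n + 1)) ℂ ⧸ idealOf (scroll Λ)) := by
  have hp := isPrime_idealOf_scroll hΛ hl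
  have hΛ2 : Module.finrank K Λ = 2 := by rw [hΛ]; exact finrank_span_pair hl
  obtain ⟨y, hy, hy'⟩ : ∃ y ∈ red V' Λ, y ∉ red V Λ := by
    by_contra! h
    exact hV (Submodule.eq_of_le_of_finrank_eq h
      (by rw [finrank_red V hΛ2, finrank_red V' hΛ2])).symm
  have hy0 : y ≠ 0 := by
    rintro rfl
    exact hy' (zero_mem _)
  obtain ⟨i, j, u, w, h⟩ := exists_chart V.1 hΛ2
  -- the restriction of polynomials to the line over `V`
  let χ : MvPolynomial (Fin (n + 1)) ℂ →ₐ[ℂ] MvPolynomial (Fin 2) ℂ :=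
    planeRestriction (resVec V u) (resVec V w)
  have hχX : ∀ k, χ (MvPolynomial.X k) = MvPolynomial.C (resVec V u k) * MvPolynomial.X 0 +
      MvPolynomial.C (resVec V w k) * MvPolynomial.X 1 := fun k ↦ MvPolynomial.aeval_X _ _
  have hχ0 : ∀ f ∈ idealOf (scroll Λ), χ f = 0 := by
    intro f hf
    refine (planeRestriction_eq_zero_iff (h.red_eq_span hΛ2) f).2 fun v hv ↦ ?_
    by_cases hv0 : v = 0
    · -- `f` has no constant term, because it vanishes at the zero vector of `Λ`
      have hX : MvPolynomial.eval 0 f = 0 := by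
        have h1 := (planeRestriction_eq_zero_iff hΛ f).1
          ((mem_idealOf_scroll_iff hΛ hl).1 hf) 0 (zero_mem _)
        have h2 := aeval_sub_mem_nonunits (V := V) (v := (0 : Fin (n + 1) → K))
          (c := (0 : Fin (n + 1) → ℂ)) (fun k ↦ by simp) f
        rwa [h1, zero_sub, neg_mem_iff, algebraMap_mem_nonunits_iff] at h2
      rw [hv0]
      exact hX
    · exact mem_idealOf_iff.1 hf v hv0 (mk_mem_scroll.2 ⟨V, hv⟩)
  have hχs : Function.Surjective χ := by
    rw [← AlgHom.range_eq_top, eq_top_iff, ← MvPolynomial.adjoin_range_X, Algebra.adjoin_le_iff]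
    rintro _ ⟨k, rfl⟩
    fin_cases k
    · refine ⟨MvPolynomial.X i, ?_⟩
      change χ _ = _
      rw [hχX, h.resVec_u_i, h.resVec_w_i]
      simp
    · refine ⟨MvPolynomial.X j, ?_⟩
      change χ _ = _
      rw [hχX, h.resVec_u_j, h.resVec_w_j]
      simp
  obtain ⟨k, hk⟩ : ∃ k, y k ≠ y i * resVec V u k + y j * resVec V w k := by
    by_contra! hcon
    exact hy' ((h.mem_red_iff hΛ2).2 (funext hcon))
  let r : MvPolynomial (Fin (n + 1)) ℂ := MvPolynomial.X k -
    (MvPolynomial.X i * MvPolynomial.C (resVec V u k) +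
      MvPolynomial.X j * MvPolynomial.C (resVec V w k))
  have hr : χ r = 0 := by
    have hC : ∀ a, χ (MvPolynomial.C a) = MvPolynomial.C a := fun a ↦ MvPolynomial.aeval_C _ _
    simp only [r, map_sub, map_add, map_mul, hχX, hC, h.resVec_u_i, h.resVec_u_j, h.resVec_w_i,
      h.resVec_w_j]
    simp
    ring
  have hrX : r ∉ idealOf (scroll Λ) := by
    intro hcon
    have := mem_idealOf_iff.1 hcon y hy0 (mk_mem_scroll.2 ⟨V', hy⟩)
    simp [r] at this
    exact hk (sub_eq_zero.1 this)
  let χ' : MvPolynomial (Fin (n + 1)) ℂ ⧸ idealOf (scroll Λ) →+* MvPolynomial (Fin 2) ℂ :=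
    Ideal.Quotient.lift _ χ.toRingHom hχ0
  have := ringKrullDim_succ_le_of_surjective χ'
    (Ideal.Quotient.lift_surjective_of_surjective _ _ hχs)
    (r := Ideal.Quotient.mk _ r)
    (mem_nonZeroDivisors_of_ne_zero fun h ↦ hrX (Ideal.Quotient.eq_zero_iff_mem.1 h)) hr
  rw [MvPolynomial.ringKrullDim_of_isNoetherianRing, ringKrullDim_eq_zero_of_field, zero_add,
    Nat.card_eq_fintype_card, Fintype.card_fin] at this
  refine le_trans ?_ this
  norm_num

/-- The scroll of a plane `Λ` is a surface scroll unless all its lines coincide. -/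
theorem isSurfaceScroll_scroll (hΛ : Λ = Submodule.span K {b, b'})
    (hl : LinearIndependent K ![b, b']) {V V' : Place K} (hV : red V Λ ≠ red V' Λ) :
    IsSurfaceScroll (scroll Λ) where
  isClosed := isZariskiClosed_scroll hΛ hl
  irreducible := isPrime_idealOf_scroll hΛ hl
  dim_eq := le_antisymm (ringKrullDim_scroll_le hΛ hl) (le_ringKrullDim_scroll hΛ hl hV)
  ruled := by
    intro x hx
    obtain ⟨W, hW⟩ := Set.mem_iUnion.1 hx
    have hΛ2 : Module.finrank K Λ = 2 := by rw [hΛ]; exact finrank_span_pair hl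
    exact ⟨linearSubspace (red W Λ), ⟨_, finrank_red W hΛ2, rfl⟩, hW,
      Set.subset_iUnion (fun V ↦ linearSubspace (red V Λ)) W⟩

end ScrollIdeal

/-! ### Étale algebras over the affine line -/

lemma isPrincipalIdealRing_mvPolynomial_fin_one (k : Type) [Field k] :
    IsPrincipalIdealRing (MvPolynomial (Fin 1) k) :=
  IsPrincipalIdealRing.of_surjective (MvPolynomial.uniqueAlgEquiv k (Fin 1)).symm.toRingEquiv
    (MvPolynomial.uniqueAlgEquiv k (Fin 1)).symm.surjective

/-- The local rings of an étale algebra over the affine line are discrete valuation rings: their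
maximal ideals are generated by those of the affine line. -/
lemma isDiscreteValuationRing_of_etale (k : Type) {S : Type} [Field k] [CommRing S] [IsDomain S]
    [Algebra (MvPolynomial (Fin 1) k) S] [Algebra.Etale (MvPolynomial (Fin 1) k) S]
    (q : Ideal S) [q.IsPrime] (hq : q ≠ ⊥) :
    IsDiscreteValuationRing (Localization.AtPrime q) := by
  let A := MvPolynomial (Fin 1) k
  have : IsPrincipalIdealRing A := isPrincipalIdealRing_mvPolynomial_fin_one k
  let p : Ideal A := q.under A
  let _ := Localization.AtPrime.algebraOfLiesOver p q
  have : Algebra.FiniteType A S := inferInstance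
  have : IsNoetherianRing S := Algebra.FiniteType.isNoetherianRing A S
  have : IsNoetherianRing (Localization.AtPrime q) :=
    IsLocalization.isNoetherianRing q.primeCompl _ inferInstance
  have h1 : Algebra.IsUnramifiedAt A q := by
    have : Algebra.FormallyEtale A (Localization q.primeCompl) :=
      .comp A S _
    exact inferInstanceAs (Algebra.FormallyUnramified A (Localization q.primeCompl))
  have h2 := ((Algebra.isUnramifiedAt_iff_map_eq A p q).1 h1).2
  have h3 : (IsLocalRing.maximalIdeal (Localization.AtPrime q)).IsPrincipal := by
    obtain ⟨a, ha⟩ := (IsPrincipalIdealRing.principal p).principal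
    have ha' : p = Ideal.span {a} := ha
    rw [← h2, ha', Ideal.map_span, Set.image_singleton]
    exact { principal := ⟨_, rfl⟩ }
  have h4 := ((tfae_of_isNoetherianRing_of_isLocalRing_of_isDomain
    (Localization.AtPrime q)).out 4 0).1 h3
  refine { h4 with not_a_field' := ?_ }
  intro h5
  apply hq
  rw [← Localization.AtPrime.map_eq_maximalIdeal, Ideal.map_eq_bot_iff_of_injective
    (IsLocalization.injective _ q.primeCompl_le_nonZeroDivisors)] at h5
  exact h5

/-- The fraction field of an étale algebra over the affine line is a function field in one variable.
-/
lemma isCurveField_of_etale (S : Type) [CommRing S] [IsDomain S]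
    [Algebra (MvPolynomial (Fin 1) ℂ) S] [Algebra.Etale (MvPolynomial (Fin 1) ℂ) S]
    (K : Type) [Field K] [Algebra S K] [IsFractionRing S K] [Algebra ℂ K]
    [Algebra (MvPolynomial (Fin 1) ℂ) K] [IsScalarTower (MvPolynomial (Fin 1) ℂ) S K]
    [IsScalarTower ℂ (MvPolynomial (Fin 1) ℂ) K] : IsCurveField K := by
  let A := MvPolynomial (Fin 1) ℂ
  have hflat : Module.Flat A S := Algebra.WeaklyEtale.flat
  have htf : Module.IsTorsionFree A S := inferInstance
  have hinj : FaithfulSMul A S := inferInstance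
  have hinj' : FaithfulSMul A K := by
    rw [faithfulSMul_iff_algebraMap_injective, IsScalarTower.algebraMap_eq A S K]
    exact (IsFractionRing.injective S K).comp (FaithfulSMul.algebraMap_injective A S)
  have h1 : Algebra.EssFiniteType S K := .of_isLocalization _ (nonZeroDivisors S)
  have h2 : Algebra.EssFiniteType A K := .comp A S K
  have h3 : Algebra.EssFiniteType ℂ K := .comp ℂ A K
  let F := FractionRing A
  let _ : Algebra F K := FractionRing.liftAlgebra A K
  have h4 : Algebra.EssFiniteType F K := .of_comp A F K
  have h5 : Algebra.FormallyUnramified S K := .of_isLocalization (nonZeroDivisors S)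
  have h6 : Algebra.FormallyUnramified A K := .comp A S K
  have h7 : Algebra.FormallyUnramified F K := .of_restrictScalars A F K
  have h8 : Module.Finite F K := Algebra.FormallyUnramified.finite_of_free F K
  have h9 : Algebra.IsAlgebraic A K :=
    (IsFractionRing.comap_isAlgebraic_iff (A := A) (K := F) (C := K)).2 inferInstance
  refine ⟨h3, ?_⟩
  rw [← trdeg_add_eq ℂ A (A := K), trdeg_eq_zero_iff.2 h9, MvPolynomial.trdeg_of_isDomain]
  simp

/-! ### The places of the function field of a smooth proper curve -/

/-- A place is not contained in another one. -/
lemma place_eq_of_le {K : Type} [Field K] [Algebra ℂ K] [IsCurveField K] {V W : Place K}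
    (h : V.1 ≤ W.1) : V = W := by
  by_contra hne
  have h1 : ¬ W.1 ≤ V.1 := fun h' ↦ hne (Subtype.ext (le_antisymm h h'))
  obtain ⟨x, hxW, hxV⟩ := SetLike.not_le_iff_exists.1 h1
  refine W.2.2 (top_unique fun y _ ↦ ?_)
  have hx0 : x ≠ 0 := fun hx ↦ hxV (hx ▸ zero_mem _)
  have hx : ord V x < 0 := by
    by_contra h2
    exact hxV ((mem_iff_ord hx0).2 (not_lt.1 h2))
  by_cases hy0 : y = 0
  · exact hy0 ▸ zero_mem _
  have h3 : y * (x ^ (ord V y).natAbs)⁻¹ ∈ V.1 := by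
    rw [mem_iff_ord (mul_ne_zero hy0 (inv_ne_zero (pow_ne_zero _ hx0))),
      ord_mul hy0 (inv_ne_zero (pow_ne_zero _ hx0)), ord_inv, ← zpow_natCast, ord_zpow]
    have : (ord V y).natAbs * (ord V x + 1) ≤ 0 :=
      mul_nonpos_of_nonneg_of_nonpos (by positivity) (by omega)
    have h5 : ((ord V y).natAbs : ℤ) * ord V x ≤ - ((ord V y).natAbs : ℤ) := by linarith
    have h4 : -((ord V y).natAbs : ℤ) ≤ ord V y := by omega
    linarith
  have h4 := mul_mem (h h3) (pow_mem hxW (ord V y).natAbs)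
  rwa [inv_mul_cancel_right₀ (pow_ne_zero _ hx0)] at h4

/-- Locally, a smooth curve is étale over the affine line, compatibly with the constants. -/
lemma exists_etale_chart {C : Scheme.{0}} (c : C ⟶ Spec (.of ℂ))
    [SmoothOfRelativeDimension 1 c] (x : C) :
    ∃ (V : C.Opens) (_ : IsAffineOpen V) (_ : x ∈ V)
      (g : MvPolynomial (Fin 1) ℂ →+* Γ(C, V)), g.Etale ∧
        ∀ a : ℂ, g (MvPolynomial.C a) =
          (C.presheaf.map (homOfLE le_top : V ⟶ ⊤).op).hom (constFn c a) := by
  obtain ⟨U, hU, V, hV, hx, e, hf⟩ :=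
    SmoothOfRelativeDimension.exists_isStandardSmoothOfRelativeDimension (n := 1) (f := c) x
  have hUtop : U = ⊤ := by
    ext y
    have : y = c x := Subsingleton.elim (α := PrimeSpectrum ℂ) _ _
    simpa [this] using e hx
  subst hUtop
  have hf' := (RingHom.isStandardSmoothOfRelativeDimension_respectsIso (n := 1)).right _
    (Scheme.ΓSpecIso (.of ℂ)).symm.commRingCatIsoToRingEquiv hf
  obtain ⟨g, hg, hg'⟩ := hf'.exists_etale_mvPolynomial
  refine ⟨V, hV, hx, g, hg', fun a ↦ ?_⟩
  have := congr($hg a)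
  exact this

lemma fromSpecStalk_comp {C : Scheme.{0}} {A : CommRingCat} (c : C ⟶ Spec A) (x : C) :
    C.fromSpecStalk x ≫ c =
      Spec.map ((Scheme.ΓSpecIso A).inv ≫ c.appTop ≫ C.presheaf.germ ⊤ x trivial) := by
  rw [← cancel_mono (Spec.map (Scheme.ΓSpecIso A).hom), Category.assoc,
    SpecMap_ΓSpecIso_hom, Scheme.toSpecΓ_naturality, Scheme.fromSpecStalk_toSpecΓ_assoc,
    ← SpecMap_ΓSpecIso_hom, ← Spec.map_comp, ← Spec.map_comp, Iso.hom_inv_id_assoc]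

section Curve

variable {C : Scheme.{0}} [IsIntegral C] (c : C ⟶ Spec (.of ℂ))

/-- The function field of a scheme over `ℂ` as a `ℂ`-algebra. -/
abbrev functionFieldAlgebra : Algebra ℂ C.functionField :=
  ((C.presheaf.germ ⊤ (genericPoint C) trivial).hom.comp
    (c.appTop.hom.comp (Scheme.ΓSpecIso (.of ℂ)).inv.hom)).toAlgebra

lemma isCurveField_functionField [SmoothOfRelativeDimension 1 c] :
    letI := functionFieldAlgebra c
    IsCurveField C.functionField := by
  let _ := functionFieldAlgebra c
  obtain ⟨V, hV, hx, g, hg, hg'⟩ := exists_etale_chart c (genericPoint C)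
  have : Nonempty V := ⟨⟨_, hx⟩⟩
  have := functionField_isFractionRing_of_isAffineOpen C V hV
  let _ := g.toAlgebra
  have : Algebra.Etale (MvPolynomial (Fin 1) ℂ) Γ(C, V) := hg
  let _ : Algebra (MvPolynomial (Fin 1) ℂ) C.functionField :=
    ((algebraMap Γ(C, V) C.functionField).comp g).toAlgebra
  have : IsScalarTower (MvPolynomial (Fin 1) ℂ) Γ(C, V) C.functionField := .of_algebraMap_eq' rfl
  have : IsScalarTower ℂ (MvPolynomial (Fin 1) ℂ) C.functionField := by
    refine .of_algebraMap_eq fun a ↦ ?_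
    change _ = algebraMap Γ(C, V) C.functionField (g (MvPolynomial.C a))
    rw [hg']
    exact (C.presheaf.germ_res_apply (homOfLE le_top : V ⟶ ⊤) (genericPoint C) hx _).symm
  exact isCurveField_of_etale Γ(C, V) _

/-- The local rings of a smooth curve, other than the function field, are discrete valuation rings.
-/
lemma isDiscreteValuationRing_stalk [SmoothOfRelativeDimension 1 c] {x : C}
    (hxg : x ≠ genericPoint C) : IsDiscreteValuationRing (C.presheaf.stalk x) := by
  obtain ⟨V, hV, hx, g, hg, -⟩ := exists_etale_chart c x
  have : Nonempty V := ⟨⟨_, hx⟩⟩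
  let _ := g.toAlgebra
  have : Algebra.Etale (MvPolynomial (Fin 1) ℂ) Γ(C, V) := hg
  let q := (hV.primeIdealOf ⟨x, hx⟩).asIdeal
  have hq : q ≠ ⊥ := by
    intro h0
    have h1 : hV.primeIdealOf ⟨x, hx⟩ = genericPoint (Spec Γ(C, V)) := by
      rw [genericPoint_eq_bot_of_affine]
      exact PrimeSpectrum.ext h0
    rw [← hV.primeIdealOf_genericPoint] at h1
    have h2 := congr(hV.fromSpec $h1)
    rw [hV.fromSpec_primeIdealOf, hV.fromSpec_primeIdealOf] at h2
    exact hxg h2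
  have := isDiscreteValuationRing_of_etale ℂ q hq
  let _ := C.presheaf.algebra_section_stalk ⟨x, hx⟩
  have : IsLocalization.AtPrime (C.presheaf.stalk x) q := hV.isLocalization_stalk ⟨x, hx⟩
  exact IsDiscreteValuationRing.RingEquivClass.isDiscreteValuationRing
    (IsLocalization.algEquiv q.primeCompl (Localization.AtPrime q) (C.presheaf.stalk x))

/-- The place defined by a point other than the generic one: the image of its local ring. -/
def stalkPlace [SmoothOfRelativeDimension 1 c] (x : C) (hx : x ≠ genericPoint C) :
    letI := functionFieldAlgebra c
    Place C.functionField :=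
  letI := functionFieldAlgebra c
  ⟨{ (algebraMap (C.presheaf.stalk x) C.functionField).range with
      mem_or_inv_mem' := by
        intro a
        have := isDiscreteValuationRing_stalk c hx
        exact ValuationRing.isInteger_or_isInteger (C.presheaf.stalk x) a }, by
    refine ⟨fun a ↦ ⟨C.presheaf.germ ⊤ x trivial (constFn c a), ?_⟩, fun h ↦ ?_⟩
    · exact C.presheaf.germ_stalkSpecializes_apply _ _ _
    · have := isDiscreteValuationRing_stalk c hx
      refine IsDiscreteValuationRing.not_isField (C.presheaf.stalk x)
        (MulEquiv.isField (Field.toIsField C.functionField)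
          (RingEquiv.ofBijective (algebraMap (C.presheaf.stalk x) C.functionField)
            ⟨IsFractionRing.injective _ _, fun a ↦ ?_⟩).toMulEquiv)
      have : a ∈ (⊤ : ValuationSubring C.functionField) := trivial
      rw [← h] at this
      exact this⟩

lemma mem_stalkPlace [SmoothOfRelativeDimension 1 c] {x : C} (hx : x ≠ genericPoint C)
    {a : C.functionField} : a ∈ (stalkPlace c x hx).1 ↔
      ∃ r, algebraMap (C.presheaf.stalk x) C.functionField r = a := Iff.rfl

/-- The morphism from the spectrum of a valuation ring that dominates a local ring. -/
def valuationLift {V : ValuationSubring C.functionField} {x : C}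
    (h : ∀ r, algebraMap (C.presheaf.stalk x) C.functionField r ∈ V) : Spec (.of V) ⟶ C :=
  Spec.map (CommRingCat.ofHom ((algebraMap (C.presheaf.stalk x) C.functionField).codRestrict
    V.toSubring h)) ≫ C.fromSpecStalk x

lemma valuationLift_generic {V : ValuationSubring C.functionField} {x : C}
    (h : ∀ r, algebraMap (C.presheaf.stalk x) C.functionField r ∈ V) :
    Spec.map (CommRingCat.ofHom (algebraMap V C.functionField)) ≫ valuationLift h =
      C.fromSpecStalk (genericPoint C) := by
  rw [valuationLift, ← Spec.map_comp_assoc,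
    ← Scheme.SpecMap_stalkSpecializes_fromSpecStalk ((genericPoint_spec C).specializes trivial)]
  rfl

lemma valuationLift_comp {V : ValuationSubring C.functionField} {x : C}
    (h : ∀ r, algebraMap (C.presheaf.stalk x) C.functionField r ∈ V)
    (hV : letI := functionFieldAlgebra c; ∀ a : ℂ, algebraMap ℂ C.functionField a ∈ V) :
    valuationLift h ≫ c = Spec.map (CommRingCat.ofHom
      ((letI := functionFieldAlgebra c; algebraMap ℂ C.functionField).codRestrict
        V.toSubring hV)) := by
  rw [valuationLift, Category.assoc, fromSpecStalk_comp, ← Spec.map_comp]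
  congr 1
  refine CommRingCat.hom_ext (RingHom.ext fun a ↦ ?_)
  refine Subtype.ext (α := C.functionField) (p := (· ∈ V))
    (?_ : (algebraMap (C.presheaf.stalk x) C.functionField)
    (C.presheaf.germ ⊤ x trivial (constFn c a)) =
      C.presheaf.germ ⊤ (genericPoint C) trivial (constFn c a))
  exact C.presheaf.germ_stalkSpecializes_apply _ _ _

/-- The valuative square of a place of the function field. -/
def placeSquare (V : letI := functionFieldAlgebra c; Place C.functionField) :
    ValuativeCommSq c :=
  letI := functionFieldAlgebra c
  { R := V.1
    K := C.functionField
    i₁ := C.fromSpecStalk (genericPoint C)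
    i₂ := Spec.map (CommRingCat.ofHom ((algebraMap ℂ C.functionField).codRestrict V.1.toSubring
      V.2.1))
    commSq := ⟨by
      rw [← Spec.map_comp, fromSpecStalk_comp]
      rfl⟩ }

variable {c}

/-- A lift of a valuative square lands in a point whose local ring is contained in the valuation
ring. -/
lemma algebraMap_mem_of_lift {V : letI := functionFieldAlgebra c; Place C.functionField}
    (l : (placeSquare c V).commSq.LiftStruct) (r : C.presheaf.stalk
      (l.l (IsLocalRing.closedPoint (placeSquare c V).R))) :
    algebraMap _ C.functionField r ∈ V.1 := by
  let x := l.l (IsLocalRing.closedPoint (placeSquare c V).R)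
  let φ : C.presheaf.stalk x ⟶ .of V.1 := Scheme.stalkClosedPointTo l.l
  have h1 : Spec.map (φ ≫ CommRingCat.ofHom (algebraMap V.1 C.functionField)) =
      Spec.map (C.presheaf.stalkSpecializes ((genericPoint_spec C).specializes trivial)) := by
    rw [← cancel_mono (C.fromSpecStalk x), Scheme.SpecMap_stalkSpecializes_fromSpecStalk,
      Spec.map_comp, Category.assoc]
    exact (congrArg _ (Scheme.Spec_stalkClosedPointTo_fromSpecStalk l.l)).trans l.fac_left
  have h2 := Spec.map_injective h1
  have h3 := congr($(h2).hom r)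
  exact h3 ▸ (φ.hom r).2

/-- The point in which the closed point of a valuation ring lands. -/
lemma valuationLift_closedPoint {V : ValuationSubring C.functionField} {x : C}
    (h : ∀ r, algebraMap (C.presheaf.stalk x) C.functionField r ∈ V)
    (h' : ∀ a ∈ V, ∃ r, algebraMap (C.presheaf.stalk x) C.functionField r = a) :
    valuationLift h (IsLocalRing.closedPoint V) = x := by
  have : IsLocalHom ((algebraMap (C.presheaf.stalk x) C.functionField).codRestrict
      V.toSubring h) := by
    refine ⟨fun a ha ↦ ?_⟩
    obtain ⟨b, hb⟩ := isUnit_iff_exists_inv.1 ha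
    obtain ⟨r, hr⟩ := h' b.1 b.2
    refine isUnit_iff_exists_inv.2 ⟨r, IsFractionRing.injective _ C.functionField ?_⟩
    rw [map_mul, hr, map_one]
    exact congrArg Subtype.val hb
  refine (Scheme.Hom.comp_apply _ _ _).trans ?_
  exact (congrArg _ (IsLocalRing.comap_closedPoint _)).trans Scheme.fromSpecStalk_closedPoint

variable [IsProper c] [SmoothOfRelativeDimension 1 c]

/-- A place comes from a closed point: the valuative criterion provides a point whose local ring is
dominated by the valuation ring, and a closed point in its closure has a smaller one. -/
lemma exists_stalkPlace_eq (V : letI := functionFieldAlgebra c; Place C.functionField) :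
    ∃ (p : C) (hp : p ≠ genericPoint C), IsClosed {p} ∧ stalkPlace c p hp = V := by
  let _ := functionFieldAlgebra c
  have := isCurveField_functionField c
  have hc : ValuativeCriterion c := by
    have h1 : IsProper c := inferInstance
    rw [IsProper.eq_valuativeCriterion] at h1
    exact h1.1.1.1
  obtain ⟨⟨l⟩⟩ := hc.existence (placeSquare c V)
  let x := l.l (IsLocalRing.closedPoint (placeSquare c V).R)
  have : CompactSpace C := by
    have : CompactSpace (Spec (.of ℂ)) := inferInstance
    exact QuasiCompact.compactSpace_of_compactSpace c
  obtain ⟨p, hpx, hp⟩ := (isClosed_closure (s := {x})).exists_closed_singleton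
    (Set.singleton_nonempty x).closure
  have hxp : x ⤳ p := specializes_iff_mem_closure.2 hpx
  have hpV (r : C.presheaf.stalk p) : algebraMap _ C.functionField r ∈ V.1 := by
    have h1 := algebraMap_mem_of_lift l ((C.presheaf.stalkSpecializes hxp).hom r)
    refine Eq.subst (motive := (· ∈ V.1)) ?_ h1
    exact C.presheaf.stalkSpecializes_comp_apply _ _ _
  have hpg : p ≠ genericPoint C := by
    intro h
    refine V.2.2 (top_unique fun a _ ↦ ?_)
    obtain ⟨r, rfl⟩ : ∃ r, algebraMap (C.presheaf.stalk p) C.functionField r = a := by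
      subst h
      refine ⟨a, ?_⟩
      exact congr($(C.presheaf.stalkSpecializes_refl _).hom a)
    exact hpV r
  refine ⟨p, hpg, hp, place_eq_of_le ?_⟩
  rintro _ ⟨r, rfl⟩
  exact hpV r

lemma ne_genericPoint_of_isClosed (c : C ⟶ Spec (.of ℂ)) [IsProper c]
    [SmoothOfRelativeDimension 1 c] {p : C} (hp : IsClosed ({p} : Set C)) : p ≠ genericPoint C := by
  let _ := functionFieldAlgebra c
  have := isCurveField_functionField c
  rintro rfl
  obtain ⟨x, hx, -⟩ := exists_stalkPlace_eq (c := c) (Classical.arbitrary _)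
  refine hx ?_
  have h : x ∈ closure {genericPoint C} := (genericPoint_spec C).symm ▸ trivial
  rwa [hp.closure_eq] at h

/-- A point is determined by its place: this is the uniqueness in the valuative criterion. -/
lemma stalkPlace_injective {x y : C} {hx : x ≠ genericPoint C} {hy : y ≠ genericPoint C}
    (h : stalkPlace c x hx = stalkPlace c y hy) : x = y := by
  let _ := functionFieldAlgebra c
  have hc : ValuativeCriterion c := by
    have h1 : IsProper c := inferInstance
    rw [IsProper.eq_valuativeCriterion] at h1
    exact h1.1.1.1
  obtain ⟨V, hV⟩ : ∃ V, stalkPlace c x hx = V := ⟨_, rfl⟩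
  rw [hV] at h
  have key (z : C) (hz : z ≠ genericPoint C) (hzV : stalkPlace c z hz = V) :
      ∃ l : (placeSquare c V).commSq.LiftStruct, l.l (IsLocalRing.closedPoint V.1) = z := by
    have h1 : ∀ r, algebraMap (C.presheaf.stalk z) C.functionField r ∈ V.1 := by
      subst hzV; exact fun r ↦ ⟨r, rfl⟩
    refine ⟨⟨valuationLift h1, valuationLift_generic h1, valuationLift_comp c h1 V.2.1⟩,
      valuationLift_closedPoint h1 ?_⟩
    subst hzV; exact fun _ h ↦ h
  have := hc.uniqueness (placeSquare c V)
  obtain ⟨l, hl⟩ := key x hx hV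
  obtain ⟨l', hl'⟩ := key y hy h.symm
  rw [← hl, ← hl', Subsingleton.elim l l']

end Curve

/-! ### Sections and germs of sheaves of modules -/

/-- If the right adjoint `G` is fully faithful, a map that kills the image of an epimorphism under
`G` is killed by the left adjoint. -/
lemma map_eq_zero_of_epi {A B : Type*} [Category* A] [Category* B] [HasZeroMorphisms A]
    [HasZeroMorphisms B] {F : A ⥤ B} {G : B ⥤ A} (adj : F ⊣ G) [IsIso adj.counit]
    [F.PreservesZeroMorphisms] {M N : B} (f : M ⟶ N) [Epi f] {P : A} (q : G.obj N ⟶ P)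
    (h : G.map f ≫ q = 0) : F.map q = 0 := by
  have h1 : F.map (G.map f) = adj.counit.app M ≫ f ≫ inv (adj.counit.app N) := by
    rw [← Category.assoc, IsIso.eq_comp_inv]
    exact adj.counit.naturality f
  have h4 : Epi (F.map (G.map f)) := by
    rw [h1]
    infer_instance
  rw [← cancel_epi (F.map (G.map f)), ← F.map_comp, h, comp_zero, F.map_zero]

/-- An epimorphism of sheaves of modules is locally surjective: a section that is not locally in the
image would survive in the sheafification of the cokernel presheaf. -/
lemma exists_cover_of_epi {C : Type} [SmallCategory C] {J : GrothendieckTopology C}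
    {R : Sheaf J RingCat.{0}} {M N : SheafOfModules.{0} R} (f : M ⟶ N) [Epi f] {U : C}
    (n : N.val.obj (.op U)) : ∃ S ∈ J U, ∀ V (g : V ⟶ U), S g →
      ∃ m : M.val.obj (.op V), f.val.app _ m = N.val.map g.op n := by
  let a := PresheafOfModules.sheafification.{0} (𝟙 R.obj)
  let f' : M.val ⟶ N.val := f.val
  let q := cokernel.π f'
  have hq : a.map q = 0 := map_eq_zero_of_epi
    (PresheafOfModules.sheafificationAdjunction (𝟙 R.obj)) (M := M) (N := N) f q
    (cokernel.condition _)
  have hq' : (PresheafOfModules.toPresheaf _).map q ≫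
      CategoryTheory.toSheafify J (cokernel f').presheaf = 0 := by
    refine (CategoryTheory.toSheafify_naturality J
      ((PresheafOfModules.toPresheaf _).map q)).trans ?_
    have : CategoryTheory.sheafifyMap J ((PresheafOfModules.toPresheaf _).map q) = 0 :=
      congr((PresheafOfModules.toPresheaf _).map $(hq).val)
    rw [this, comp_zero]
    rfl
  have hq'' : (CategoryTheory.toSheafify J (cokernel f').presheaf).app (.op U) (q.app _ n) = 0 :=
    congr($(hq').app (.op U) n)
  have hinj : Presheaf.IsLocallyInjective J (CategoryTheory.toSheafify J (cokernel f').presheaf) :=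
    inferInstance
  have h1 := hinj.equalizerSieve_mem (X := .op U) (q.app _ n) 0 (by rw [hq'', map_zero])
  refine ⟨_, h1, fun V g hg ↦ ?_⟩
  have h2 : q.app (.op V) (N.val.map g.op n) = 0 := by
    rw [PresheafOfModules.naturality_apply]
    exact Eq.trans hg (map_zero ((cokernel f').map g.op).hom)
  let G := PresheafOfModules.evaluation R.obj (.op V)
  have h3 : (ShortComplex.mk _ _ (cokernel.condition f')).Exact :=
    ShortComplex.exact_cokernel f'
  have h4 := h3.map_of_epi_of_preservesCokernel G inferInstance inferInstance
  rw [ShortComplex.moduleCat_exact_iff] at h4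
  exact h4 _ h2

section Sheaves

variable {X : Scheme.{0}} {M N P : X.Modules}

lemma germ_smul {x : X} {U : X.Opens} (hx : x ∈ U) (r : Γ(X, U)) (m : Γ(M, U)) :
    M.presheaf.germ U x hx (r • m) =
      (X.presheaf.germ U x hx r : X.presheaf.stalk x) • M.presheaf.germ U x hx m :=
  PresheafOfModules.germ_smul (X := X) (R := X.presheaf) M.val x U hx r m

lemma app_map (f : M ⟶ N) {U V : X.Opens} (i : U ⟶ V) (m : Γ(M, V)) :
    f.app U (M.presheaf.map i.op m) = N.presheaf.map i.op (f.app V m) :=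
  congr($(f.mapPresheaf.naturality i.op) m)

variable (X) in
/-- The functor of sections over an open set. -/
def sectionsFunctor (U : X.Opens) : X.Modules ⥤ Ab :=
  Scheme.Modules.toPresheaf X ⋙ (evaluation (TopologicalSpace.Opens X)ᵒᵖ Ab).obj (.op U)

instance preservesLimits_sectionsFunctor (U : X.Opens) :
    PreservesLimits (sectionsFunctor X U) :=
  have : PreservesLimits ((evaluation (TopologicalSpace.Opens X)ᵒᵖ Ab.{0}).obj (.op U)) :=
    ⟨fun {_} _ ↦ evaluation_preservesLimitsOfShape _⟩
  comp_preservesLimits _ _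

/-- Taking sections over an open set is left exact. -/
lemma exists_of_kernel_app (f : M ⟶ N) (U : X.Opens) (m : Γ(M, U)) (hm : f.app U m = 0) :
    ∃ k : Γ((kernel f : X.Modules), U), (kernel.ι f).app U k = m := by
  let G := sectionsFunctor X U
  have : G.PreservesZeroMorphisms := ⟨fun _ _ ↦ rfl⟩
  have : PreservesLimits G := preservesLimits_sectionsFunctor U
  have h1 : (ShortComplex.mk _ _ (kernel.condition f)).Exact :=
    ShortComplex.exact_kernel f
  have h2 := h1.map_of_mono_of_preservesKernel G inferInstance inferInstance
  rw [ShortComplex.ab_exact_iff] at h2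
  exact h2 m hm

lemma app_injective (f : M ⟶ N) [Mono f] (U : X.Opens) : Function.Injective (f.app U) := by
  let G := sectionsFunctor X U
  have : PreservesLimits G := preservesLimits_sectionsFunctor U
  have : Mono (G.map f) := inferInstance
  exact (AddCommGrpCat.mono_iff_injective _).1 this

lemma pi_section_ext {J : Type} [Finite J] (F : J → X.Modules) (U : X.Opens)
    (m : Γ((∏ᶜ F : X.Modules), U)) (hm : ∀ j, (Pi.π F j).app U m = 0) : m = 0 := by
  let G := sectionsFunctor X U
  have : PreservesLimits G := preservesLimits_sectionsFunctor U
  have h := isLimitOfPreserves G (limit.isLimit (Discrete.functor F))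
  refine Concrete.isLimit_ext _ h m 0 fun ⟨j⟩ ↦ ?_
  rw [map_zero]
  exact hm j

lemma exists_germ_eq_of_epi (f : M ⟶ N) [Epi f] (x : X) (t : N.presheaf.stalk x) :
    ∃ (U : X.Opens) (hx : x ∈ U) (m : Γ(M, U)), N.presheaf.germ U x hx (f.app U m) = t := by
  obtain ⟨U, hxU, n, rfl⟩ := N.presheaf.exists_germ_eq t
  have : Epi (C := SheafOfModules X.ringCatSheaf) f := ‹Epi f›
  obtain ⟨S, hS, h⟩ := exists_cover_of_epi (R := X.ringCatSheaf) (M := M) (N := N) f n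
  obtain ⟨V, i, hi, hxV⟩ := hS x hxU
  obtain ⟨m, hm⟩ := h V i hi
  refine ⟨V, hxV, m, ?_⟩
  refine Eq.trans ?_ (N.presheaf.germ_res_apply i x hxV n)
  exact congrArg _ hm

end Sheaves

/-! ### Free modules in coordinates -/

section Free

open scoped Classical in
/-- The `i`-th coordinate of a section of a free module. -/
def freeCoord (X : Scheme.{0}) {I : Type} (i : I) : freeModule X I ⟶ structureModule X :=
  Cofan.IsColimit.desc (SheafOfModules.isColimitFreeCofan (R := X.ringCatSheaf) I)
    (fun j ↦ if j = i then 𝟙 _ else 0)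

/-- The inclusion of the `i`-th summand of a free module. -/
def freeInc (X : Scheme.{0}) {I : Type} (i : I) : structureModule X ⟶ freeModule X I :=
  SheafOfModules.ιFree (R := X.ringCatSheaf) i

variable {X : Scheme.{0}} {I : Type} {M : X.Modules}

open scoped Classical in
lemma freeInc_coord (i j : I) :
    freeInc X j ≫ freeCoord X i = if j = i then 𝟙 _ else 0 :=
  Cofan.IsColimit.fac (SheafOfModules.isColimitFreeCofan (R := X.ringCatSheaf) I) _ j

lemma free_hom_ext {f g : freeModule X I ⟶ M} (h : ∀ i, freeInc X i ≫ f = freeInc X i ≫ g) :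
    f = g :=
  Cofan.IsColimit.hom_ext (SheafOfModules.isColimitFreeCofan (R := X.ringCatSheaf) I) _ _ h

lemma sum_coord_inc [Fintype I] : ∑ i : I, freeCoord X i ≫ freeInc X i = 𝟙 _ := by
  classical
  refine free_hom_ext fun j ↦ ?_
  rw [Preadditive.comp_sum]
  simp_rw [← Category.assoc, freeInc_coord]
  rw [Finset.sum_eq_single j]
  · simp
  · intro i _ hi
    rw [if_neg (Ne.symm hi), zero_comp]
  · simp

lemma app_sum {M N : X.Modules} {J : Type} (s : Finset J) (f : J → (M ⟶ N)) (U : X.Opens)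
    (m : Γ(M, U)) : (∑ j ∈ s, f j : M ⟶ N).app U m = ∑ j ∈ s, (f j).app U m := by
  classical
  induction s using Finset.induction_on with
  | empty => simp
  | insert a s ha ih => rw [Finset.sum_insert ha, Finset.sum_insert ha, ← ih]; rfl

/-- The value of a function, regarded as a section of the structure sheaf. -/
abbrev toFn {U : X.Opens} (r : Γ(structureModule X, U)) : Γ(X, U) := r

/-- A function, regarded as a section of the structure sheaf. -/
abbrev ofFn {U : X.Opens} (r : Γ(X, U)) : Γ(structureModule X, U) := r

lemma unit_app (g : structureModule X ⟶ M) (U : X.Opens) (r : Γ(structureModule X, U)) :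
    g.app U r = toFn r • g.app U (ofFn 1) := by
  rw [← Scheme.Modules.Hom.app_smul]
  congr 1
  exact (mul_one (toFn r)).symm

/-- The coordinates of a section of a free module. -/
def coords {U : X.Opens} (a : Γ(freeModule X I, U)) (i : I) : Γ(X, U) :=
  toFn ((freeCoord X i).app U a)

/-- The section of a free module with given coordinates. -/
def ofCoords [Fintype I] {U : X.Opens} (r : I → Γ(X, U)) : Γ(freeModule X I, U) :=
  ∑ i, (freeInc X i).app U (ofFn (r i))

@[simp] lemma coords_ofCoords [Fintype I] {U : X.Opens} (r : I → Γ(X, U)) :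
    coords (ofCoords r) = r := by
  classical
  ext i
  rw [coords, ofCoords, map_sum, Finset.sum_eq_single i]
  · rw [← AddCommGrpCat.comp_apply, ← Scheme.Modules.Hom.comp_app, freeInc_coord, if_pos rfl]
    rfl
  · intro j _ hj
    rw [← AddCommGrpCat.comp_apply, ← Scheme.Modules.Hom.comp_app, freeInc_coord, if_neg hj]
    rfl
  · simp

lemma ofCoords_coords [Fintype I] {U : X.Opens} (a : Γ(freeModule X I, U)) :
    ofCoords (coords a) = a := by
  have h := congr(($(sum_coord_inc (X := X) (I := I))).app U a)
  rw [app_sum] at h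
  exact h

lemma coords_injective [Finite I] {U : X.Opens} : Function.Injective
    (coords : Γ(freeModule X I, U) → I → Γ(X, U)) := by
  have := Fintype.ofFinite I
  exact Function.LeftInverse.injective ofCoords_coords

lemma coords_map {U V : X.Opens} (i : U ⟶ V) (a : Γ(freeModule X I, V)) (k : I) :
    coords ((freeModule X I).presheaf.map i.op a) k = X.presheaf.map i.op (coords a k) :=
  app_map (freeCoord X k) i a

lemma coords_smul {U : X.Opens} (r : Γ(X, U)) (a : Γ(freeModule X I, U)) (i : I) :
    coords (r • a) i = r * coords a i :=
  Scheme.Modules.Hom.app_smul (freeCoord X i) r a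

lemma free_app [Fintype I] (f : freeModule X I ⟶ M) {U : X.Opens} (a : Γ(freeModule X I, U)) :
    f.app U a = ∑ i, coords a i • (freeInc X i ≫ f).app U (ofFn 1) := by
  conv_lhs => rw [← ofCoords_coords a, ofCoords, map_sum]
  refine Finset.sum_congr rfl fun i _ ↦ ?_
  exact unit_app (freeInc X i ≫ f) U _

/-- The value of a global section on an open set. -/
abbrev sectionAt (s : M.val.sections) (U : X.Opens) : Γ(M, U) := s.val (.op U)

lemma freeHomEquiv_symm_app [Fintype I] (s : I → M.val.sections) {U : X.Opens}
    (a : Γ(freeModule X I, U)) :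
    Scheme.Modules.Hom.app (M := freeModule X I) (N := M)
      ((SheafOfModules.freeHomEquiv (R := X.ringCatSheaf) M).symm s) U a =
      ∑ i, coords a i • sectionAt (s i) U := by
  obtain ⟨f, rfl⟩ := (SheafOfModules.freeHomEquiv (R := X.ringCatSheaf) M).surjective s
  rw [Equiv.symm_apply_apply]
  exact free_app (M := M) f a

end Free

section Euler

variable {X : Scheme.{0}} {n : ℕ}

lemma pairing_app (c : X ⟶ Spec (.of ℂ)) (v : Fin (n + 1) → ℂ) {U : X.Opens}
    (a : Γ(freeModule X (Fin (n + 1)), U)) :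
    toFn ((pairing c v).app U a) =
      ∑ i, coords a i * X.presheaf.map (homOfLE le_top : U ⟶ ⊤).op (constFn c (v i)) :=
  freeHomEquiv_symm_app (M := structureModule X) (fun i ↦ globalSection (constFn c (v i))) a

/-- A section over `V` of `j_* 𝒪_U`, as a function on `U ∩ V`. -/
abbrev toExtFn {U V : X.Opens} (t : Γ(extendedFunctions U, V)) :
    Γ(X, U.ι ''ᵁ (U.ι ⁻¹ᵁ V)) := t

lemma toExtFn_smul {U V : X.Opens} (r : Γ(X, V)) (t : Γ(extendedFunctions U, V)) :
    toExtFn (r • t) = X.presheaf.map (homOfLE (U.ι.image_preimage_le V) :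
      U.ι ''ᵁ (U.ι ⁻¹ᵁ V) ⟶ V).op r * toExtFn t := by
  rw [← Scheme.Opens.ι_app]
  rfl

variable (h : X ⟶ PSpace n)

/-- The chart `h⁻¹(D₊(x_j))`. -/
abbrev chartOpen (j : Fin (n + 1)) : X.Opens :=
  h ⁻¹ᵁ Proj.basicOpen (grading n) (MvPolynomial.X j)

lemma eulerMap_comp_pi (j : Fin (n + 1)) : eulerMap h ≫ Pi.π _ j =
    (SheafOfModules.freeHomEquiv (R := X.ringCatSheaf) (extendedFunctions (chartOpen h j))).symm
      (fun i ↦ sectionOfFunction _ (coordFn h i j)) :=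
  Pi.lift_π _ _

lemma eulerMap_app_pi {V : X.Opens} (a : Γ(freeModule X (Fin (n + 1)), V)) (j : Fin (n + 1)) :
    toExtFn ((eulerMap h ≫ Pi.π _ j).app V a) = ∑ i,
      X.presheaf.map (homOfLE ((chartOpen h j).ι.image_preimage_le V)).op (coords a i) *
        X.presheaf.map (homOfLE ((chartOpen h j).ι_image_le _)).op (coordFn h i j) := by
  rw [eulerMap_comp_pi]
  refine (congrArg toExtFn (freeHomEquiv_symm_app (M := extendedFunctions (chartOpen h j))
    (fun i ↦ sectionOfFunction _ (coordFn h i j)) a)).trans ?_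
  exact Finset.sum_congr rfl fun i _ ↦ toExtFn_smul _ _

end Euler

/-! ### Local rings of projective space -/

section Proj

variable {n : ℕ}

instance isPrime_asHomogeneousIdeal (y : PSpace n) : y.asHomogeneousIdeal.toIdeal.IsPrime :=
  y.isPrime

/-- A form of degree `d`, evaluated at a multiple of a point. -/
lemma eval₂_mul_of_isHomogeneous {σ R S : Type*} [CommSemiring R] [CommSemiring S]
    {f : MvPolynomial σ R} {d : ℕ} (hf : f.IsHomogeneous d) (g : R →+* S) (u : S) (v : σ → S) :
    f.eval₂ g (fun i ↦ u * v i) = u ^ d * f.eval₂ g v := by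
  rw [MvPolynomial.eval₂_eq, MvPolynomial.eval₂_eq, Finset.mul_sum]
  refine Finset.sum_congr rfl fun m hm ↦ ?_
  have h1 : m.degree = d := by
    rw [Finsupp.degree_eq_weight_one]
    exact hf (MvPolynomial.mem_support_iff.1 hm)
  simp_rw [mul_pow]
  rw [Finset.prod_mul_distrib, Finset.prod_pow_eq_pow_sum, ← h1, Finsupp.degree_apply]
  ring

/-- The local ring of a point of projective space, as a ring of fractions. -/
abbrev fractionsAt (y : PSpace n) : Type :=
  HomogeneousLocalization.AtPrime (grading n) y.asHomogeneousIdeal.toIdeal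

/-- The fraction `x_i / x_j` in the local ring of a point at which `x_j` does not vanish. -/
def coordFraction (y : PSpace n) (i j : Fin (n + 1))
    (hj : MvPolynomial.X j ∉ y.asHomogeneousIdeal) : fractionsAt y :=
  HomogeneousLocalization.mk ⟨1, ⟨_, MvPolynomial.isHomogeneous_X ℂ i⟩,
    ⟨_, MvPolynomial.isHomogeneous_X ℂ j⟩, hj⟩

/-- The complex numbers in the local ring of a point. -/
def constFraction (y : PSpace n) : ℂ →+* fractionsAt y :=
  (HomogeneousLocalization.fromZeroRingHom (grading n) _).comp (algebraMap ℂ (grading n 0))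

/-- The isomorphism of the ring of fractions at `y` with the stalk at `y`. -/
def fractionsEquivStalk (y : PSpace n) : fractionsAt y ≃+* (PSpace n).presheaf.stalk y :=
  (Proj.stalkIso' (grading n) y).symm

lemma germ_awayToSection (y : PSpace n) (j : Fin (n + 1))
    (hj : y ∈ Proj.basicOpen (grading n) (MvPolynomial.X j))
    (z : HomogeneousLocalization.Away (grading n) (MvPolynomial.X j)) :
    (PSpace n).presheaf.germ _ y hj ((Proj.awayToSection (grading n) (MvPolynomial.X j)).hom z) =
      fractionsEquivStalk y (HomogeneousLocalization.mapId (grading n)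
        (Submonoid.powers_le.mpr hj) z) :=
  congr(($(ProjectiveSpectrum.Proj.awayToSection_germ (grading n) (MvPolynomial.X j) y hj)).hom z)

lemma X_mem_grading (j : Fin (n + 1)) : MvPolynomial.X j ∈ grading n 1 :=
  MvPolynomial.isHomogeneous_X ℂ j

lemma exists_coord_notMem (y : PSpace n) :
    ∃ j : Fin (n + 1), MvPolynomial.X j ∉ y.asHomogeneousIdeal := by
  by_contra! h
  refine y.not_irrelevant_le fun f hf ↦ ?_
  have h1 : f ∈ Ideal.span (MvPolynomial.X '' (Set.univ : Set (Fin (n + 1)))) := by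
    rw [MvPolynomial.mem_ideal_span_X_image]
    intro m hm
    by_contra! h2
    have h3 : m = 0 := Finsupp.ext fun i ↦ h2 i trivial
    subst h3
    refine MvPolynomial.mem_support_iff.1 hm ?_
    have h4 := (HomogeneousIdeal.mem_irrelevant_iff (grading n) f).1 hf
    have h5 : MvPolynomial.homogeneousComponent 0 f = 0 := by
      rw [← MvPolynomial.decomposition.decompose'_apply]
      exact h4
    rw [MvPolynomial.homogeneousComponent_zero, MvPolynomial.C_eq_zero] at h5
    exact h5
  refine (Ideal.span_le.2 ?_) h1
  rintro _ ⟨j, -, rfl⟩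
  exact h j

/-- On a chart, the structure morphism of `ℙⁿ` is given by the constants in its coordinate ring. -/
lemma basicOpen_comp_toSpecZero (j : Fin (n + 1)) :
    (Proj.basicOpen (grading n) (MvPolynomial.X j)).ι ≫ Proj.toSpecZero (grading n) =
      (Proj.basicOpen (grading n) (MvPolynomial.X j)).toSpecΓ ≫
        Spec.map (CommRingCat.ofHom (HomogeneousLocalization.fromZeroRingHom (grading n) _) ≫
          Proj.awayToSection (grading n) (MvPolynomial.X j)) := by
  have h : (Proj.basicOpenIsoSpec (grading n) (MvPolynomial.X j)
      (X_mem_grading j) one_pos).inv ≫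
      (Proj.basicOpen (grading n) (MvPolynomial.X j)).ι ≫ Proj.toSpecZero (grading n) =
        Spec.map (CommRingCat.ofHom (HomogeneousLocalization.fromZeroRingHom (grading n) _)) :=
    Proj.awayι_toSpecZero (grading n) (f := MvPolynomial.X j) (m := 1)
      (X_mem_grading j) one_pos
  rw [Iso.inv_comp_eq, Proj.basicOpenIsoSpec_hom, Proj.basicOpenToSpec, Category.assoc,
    ← Spec.map_comp] at h
  exact h

lemma germ_constFn_toSpec (y : PSpace n) (a : ℂ) :
    (PSpace n).presheaf.germ ⊤ y trivial (constFn (PSpace.toSpec n) a) =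
      fractionsEquivStalk y (constFraction y a) := by
  obtain ⟨j, hj⟩ := exists_coord_notMem y
  let V := Proj.basicOpen (grading n) (MvPolynomial.X j)
  have hy : y ∈ V := hj
  have h1 : (PSpace n).fromSpecStalk y ≫ PSpace.toSpec n =
      Spec.map (CommRingCat.ofHom (algebraMap ℂ (grading n 0)) ≫
        CommRingCat.ofHom (HomogeneousLocalization.fromZeroRingHom (grading n) _) ≫
          Proj.awayToSection (grading n) (MvPolynomial.X j) ≫
          (PSpace n).presheaf.germ V y hy) := by
    rw [PSpace.toSpec, ← Scheme.Opens.fromSpecStalkOfMem_ι V y hy, Category.assoc,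
      reassoc_of% basicOpen_comp_toSpecZero j,
      Scheme.Opens.fromSpecStalkOfMem_toSpecΓ_assoc, ← Spec.map_comp, ← Spec.map_comp]
    simp only [Category.assoc]
  rw [fromSpecStalk_comp] at h1
  have h2 := congr(($(Spec.map_injective h1)).hom a)
  refine h2.trans ?_
  exact germ_awayToSection y j hy _

end Proj

section Pullback

variable {n : ℕ} {X : Scheme.{0}} (h : X ⟶ PSpace n)

/-- Pullback of fractions along a morphism to projective space. -/
def pullbackFraction (x : X) : fractionsAt (h x) →+* X.presheaf.stalk x :=
  (h.stalkMap x).hom.comp (fractionsEquivStalk (h x)).toRingHom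

instance isLocalHom_pullbackFraction (x : X) : IsLocalHom (pullbackFraction h x) :=
  ⟨fun a ha ↦ by
    have h1 : IsUnit (fractionsEquivStalk (h x) a) := isUnit_of_map_unit (h.stalkMap x).hom _ ha
    exact (MulEquiv.isUnit_map (fractionsEquivStalk (h x))).1 h1⟩

lemma germ_coordFn (x : X) (i j : Fin (n + 1)) (hj : x ∈ chartOpen h j) :
    X.presheaf.germ _ x hj (coordFn h i j) = pullbackFraction h x (coordFraction (h x) i j hj) := by
  rw [coordFn]
  refine (Scheme.Hom.germ_stalkMap_apply h _ x hj _).symm.trans ?_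
  rw [germ_awayToSection (h x) j hj]
  refine congrArg (pullbackFraction h x) (HomogeneousLocalization.val_injective _ ?_)
  refine (HomogeneousLocalization.val_mk _).trans ?_
  refine Eq.trans ?_ (HomogeneousLocalization.val_mk _).symm
  simp

lemma germ_constFn (x : X) (a : ℂ) :
    X.presheaf.germ ⊤ x trivial (constFn (h ≫ PSpace.toSpec n) a) =
      pullbackFraction h x (constFraction (h x) a) := by
  have h1 : constFn (h ≫ PSpace.toSpec n) a = h.appTop.hom (constFn (PSpace.toSpec n) a) := by
    rw [constFn, Scheme.Hom.comp_appTop]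
    rfl
  rw [h1]
  refine (Scheme.Hom.germ_stalkMap_apply h ⊤ x trivial _).symm.trans ?_
  rw [germ_constFn_toSpec (h x)]
  rfl

lemma coordFraction_mul (y : PSpace n) (i j k : Fin (n + 1))
    (hj : MvPolynomial.X j ∉ y.asHomogeneousIdeal) (hk : MvPolynomial.X k ∉ y.asHomogeneousIdeal) :
    coordFraction y i j hj * coordFraction y j k hk = coordFraction y i k hk := by
  apply HomogeneousLocalization.val_injective
  simp only [coordFraction, HomogeneousLocalization.val_mul, HomogeneousLocalization.val_mk,
    Localization.mk_mul]
  rw [Localization.mk_eq_mk_iff, Localization.r_iff_exists]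
  refine ⟨1, ?_⟩
  simp
  ring

lemma coordFraction_self (y : PSpace n) (j : Fin (n + 1))
    (hj : MvPolynomial.X j ∉ y.asHomogeneousIdeal) : coordFraction y j j hj = 1 := by
  apply HomogeneousLocalization.val_injective
  simp only [coordFraction, HomogeneousLocalization.val_mk, HomogeneousLocalization.val_one]
  exact Localization.mk_self ⟨MvPolynomial.X j, hj⟩

/-- The fraction `f / x_j ^ d` for a form `f` of degree `d`. -/
def formFraction (y : PSpace n) (j : Fin (n + 1))
    (hj : MvPolynomial.X j ∉ y.asHomogeneousIdeal) {d : ℕ}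
    {f : MvPolynomial (Fin (n + 1)) ℂ} (hf : f.IsHomogeneous d) : fractionsAt y :=
  HomogeneousLocalization.mk ⟨d, ⟨f, hf⟩, ⟨MvPolynomial.X j ^ d,
    MvPolynomial.isHomogeneous_X_pow j d⟩, fun h ↦ hj (y.isPrime.mem_of_pow_mem d h)⟩

/-- The value of a form of degree `d` at the point with coordinates `x_i / x_j`. -/
lemma eval₂_coordFraction (y : PSpace n) (j : Fin (n + 1))
    (hj : MvPolynomial.X j ∉ y.asHomogeneousIdeal) {d : ℕ}
    {f : MvPolynomial (Fin (n + 1)) ℂ} (hf : f.IsHomogeneous d) :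
    f.eval₂ (constFraction y) (fun i ↦ coordFraction y i j hj) =
      formFraction y j hj hf := by
  apply HomogeneousLocalization.val_injective
  let P := y.asHomogeneousIdeal.toIdeal
  let u : Localization.AtPrime P := Localization.mk 1 ⟨MvPolynomial.X j, hj⟩
  rw [← HomogeneousLocalization.algebraMap_apply, MvPolynomial.hom_eval₂, formFraction,
    HomogeneousLocalization.val_mk]
  have h1 : (algebraMap (fractionsAt y) (Localization.AtPrime P)).comp (constFraction y) =
      (algebraMap (MvPolynomial (Fin (n + 1)) ℂ) (Localization.AtPrime P)).comp MvPolynomial.C := by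
    ext a
    exact (Localization.mk_one_eq_algebraMap _)
  have h2 : (fun i ↦ algebraMap (fractionsAt y) (Localization.AtPrime P)
      (coordFraction y i j hj)) =
      fun i ↦ u * algebraMap (MvPolynomial (Fin (n + 1)) ℂ) (Localization.AtPrime P)
        (MvPolynomial.X i) := by
    ext i
    rw [← Localization.mk_one_eq_algebraMap, Localization.mk_mul, one_mul, mul_one]
    rfl
  rw [h1, h2, eval₂_mul_of_isHomogeneous hf]
  have h3 : f.eval₂
      ((algebraMap (MvPolynomial (Fin (n + 1)) ℂ) (Localization.AtPrime P)).comp MvPolynomial.C)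
      (fun i ↦ algebraMap (MvPolynomial (Fin (n + 1)) ℂ) (Localization.AtPrime P)
        (MvPolynomial.X i)) =
      algebraMap _ (Localization.AtPrime P) f := by
    conv_rhs => rw [← MvPolynomial.eval₂_eta f]
    exact (MvPolynomial.hom_eval₂ _ _ _ _).symm
  rw [h3, Localization.mk_pow, ← Localization.mk_one_eq_algebraMap, Localization.mk_mul,
    one_pow, one_mul, mul_one]
  rfl

lemma isUnit_formFraction_iff (y : PSpace n) (j : Fin (n + 1))
    (hj : MvPolynomial.X j ∉ y.asHomogeneousIdeal) {d : ℕ}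
    {f : MvPolynomial (Fin (n + 1)) ℂ} (hf : f.IsHomogeneous d) :
    IsUnit (formFraction y j hj hf) ↔ f ∉ y.asHomogeneousIdeal.toIdeal := by
  rw [← HomogeneousLocalization.isUnit_iff_isUnit_val, formFraction,
    HomogeneousLocalization.val_mk, Localization.mk_eq_mk', IsLocalization.AtPrime.isUnit_mk'_iff]
  rfl

/-- A form lies in the homogeneous prime of `h x` if and only if its value at the point with
coordinates `x_i / x_j` is not a unit. -/
lemma mem_asHomogeneousIdeal_iff (x : X) (j : Fin (n + 1)) (hj : x ∈ chartOpen h j) {d : ℕ}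
    {f : MvPolynomial (Fin (n + 1)) ℂ} (hf : f.IsHomogeneous d) :
    f ∈ (h x).asHomogeneousIdeal.toIdeal ↔ ¬ IsUnit (f.eval₂
      ((pullbackFraction h x).comp (constFraction (h x)))
      (fun i ↦ X.presheaf.germ _ x hj (coordFn h i j))) := by
  simp_rw [germ_coordFn]
  have h1 := MvPolynomial.hom_eval₂ f (constFraction (h x)) (pullbackFraction h x)
    (fun i ↦ coordFraction (h x) i j hj)
  rw [← h1, eval₂_coordFraction _ j hj hf, isUnit_map_iff]
  exact (not_iff_comm.1 (isUnit_formFraction_iff (h x) j hj hf).symm).symm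

end Pullback

/-! ### The local contribution to the degree -/

section LocalDegree

variable {C : Scheme.{0}} [IsIntegral C] {M N : C.Modules}

lemma mem_of_genericPoint_mem {U : C.Opens} {x : C} (hx : x ∈ U) : genericPoint C ∈ U :=
  ((genericPoint_spec C).mem_open_set_iff U.isOpen).2 ⟨x, trivial, hx⟩

lemma toGenericStalk_germ {p : C} {U : C.Opens} (hp : p ∈ U) (m : Γ(M, U)) :
    toGenericStalk M p (M.presheaf.germ U p hp m) =
      M.presheaf.germ U (genericPoint C) (mem_of_genericPoint_mem hp) m :=
  M.presheaf.germ_stalkSpecializes_apply _ _ _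

lemma algebraMap_germ {p : C} {U : C.Opens} (hp : p ∈ U) (r : Γ(C, U)) :
    algebraMap (C.presheaf.stalk p) C.functionField (C.presheaf.germ U p hp r) =
      C.presheaf.germ U (genericPoint C) (mem_of_genericPoint_mem hp) r :=
  C.presheaf.germ_stalkSpecializes_apply _ _ _

lemma toGenericStalk_add (p : C) (m m' : M.presheaf.stalk p) :
    toGenericStalk M p (m + m') = toGenericStalk M p m + toGenericStalk M p m' :=
  map_add _ _ _

lemma toGenericStalk_smul (p : C) (r : C.presheaf.stalk p) (m : M.presheaf.stalk p) :
    toGenericStalk M p (r • m) =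
      algebraMap (C.presheaf.stalk p) C.functionField r • toGenericStalk M p m := by
  obtain ⟨U, hU, m, rfl⟩ := M.presheaf.exists_germ_eq m
  obtain ⟨U', hU', r, rfl⟩ := C.presheaf.exists_germ_eq r
  have hW : p ∈ U ⊓ U' := ⟨hU, hU'⟩
  rw [← M.presheaf.germ_res_apply (homOfLE inf_le_left : U ⊓ U' ⟶ U) p hW,
    ← C.presheaf.germ_res_apply (homOfLE inf_le_right : U ⊓ U' ⟶ U') p hW, ← germ_smul,
    toGenericStalk_germ, toGenericStalk_germ, algebraMap_germ, germ_smul]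

/-- In terms of the rational section `τ`, the stalk of `M` at `p` modulo torsion is generated by `x
• τ`. -/
def GeneratesAt (M : C.Modules) (τ : genericStalk M) (p : C) (x : C.functionField) : Prop :=
  (∀ m : M.presheaf.stalk p, ∃ r : C.presheaf.stalk p,
    toGenericStalk M p m = (algebraMap (C.presheaf.stalk p) C.functionField r * x) • τ) ∧
  ∃ m : M.presheaf.stalk p, toGenericStalk M p m = x • τ

/-- The coefficient with respect to the generator `x • τ` is a linear map from the stalk onto the
local ring, whose kernel is the torsion. -/
lemma GeneratesAt.exists_linearMap {τ : genericStalk M} {p : C} {x : C.functionField}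
    (hτ : τ ≠ 0) (hx : x ≠ 0) (hM : GeneratesAt M τ p x) :
    ∃ ψ : M.presheaf.stalk p →ₗ[C.presheaf.stalk p] C.presheaf.stalk p,
      Function.Surjective ψ ∧ ∀ m, toGenericStalk M p m =
        (algebraMap (C.presheaf.stalk p) C.functionField (ψ m) * x) • τ := by
  obtain ⟨h1, m₀, hm₀⟩ := hM
  choose ψ hψ using h1
  have hinj {r s : C.presheaf.stalk p}
      (h : (algebraMap (C.presheaf.stalk p) C.functionField r * x) • τ =
        (algebraMap (C.presheaf.stalk p) C.functionField s * x) • τ) : r = s :=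
    IsFractionRing.injective _ C.functionField
      (mul_right_cancel₀ hx (smul_left_injective _ hτ h))
  have hsmul (r : C.presheaf.stalk p) (m) : ψ (r • m) = r * ψ m := by
    apply hinj
    rw [← hψ, toGenericStalk_smul, hψ m, map_mul, smul_smul, mul_assoc]
  refine ⟨⟨⟨ψ, fun m m' ↦ hinj ?_⟩, hsmul⟩, fun r ↦ ⟨r • m₀, ?_⟩, hψ⟩
  · rw [← hψ, toGenericStalk_add, hψ m, hψ m', map_add, add_mul, add_smul]
  · refine (hsmul r m₀).trans ?_
    rw [hinj (s := 1) ((hψ m₀).symm.trans (by rw [hm₀, map_one, one_mul])), mul_one]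

variable (c : C ⟶ Spec (.of ℂ)) [SmoothOfRelativeDimension 1 c]

/-- The length of the quotient by an element of the local ring is its order. -/
lemma length_stalk_eq_ord {p : C} (hp : p ≠ genericPoint C) {a : C.presheaf.stalk p} (ha : a ≠ 0)
    {l : ℕ} (hl : Module.length (C.presheaf.stalk p) (C.presheaf.stalk p ⧸ Ideal.span {a}) = l) :
    letI := functionFieldAlgebra c
    haveI := isCurveField_functionField c
    (l : ℤ) = ord (stalkPlace c p hp) (algebraMap (C.presheaf.stalk p) C.functionField a) := by
  let _ := functionFieldAlgebra c
  have := isCurveField_functionField c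
  let V := stalkPlace c p hp
  let f : C.presheaf.stalk p →+* V.1 :=
    (algebraMap (C.presheaf.stalk p) C.functionField).codRestrict V.1.toSubring fun r ↦ ⟨r, rfl⟩
  have hf : Function.Bijective f := by
    refine ⟨fun r s h ↦ IsFractionRing.injective _ C.functionField (congrArg Subtype.val h), ?_⟩
    rintro ⟨_, r, rfl⟩
    exact ⟨r, rfl⟩
  have h0 := length_eq_ord (V := V) (f a).2 (fun h ↦ ha (IsFractionRing.injective _
    C.functionField (h.trans (map_zero _).symm)))
  refine Eq.trans ?_ h0
  have h1 := length_quotient_ringEquiv (RingEquiv.ofBijective f hf) (Ideal.span {a})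
    (Ideal.span {f a}) (by rw [Ideal.map_span, Set.image_singleton]; rfl)
  rw [hl] at h1
  exact congrArg (fun t : ℕ∞ ↦ (t.toNat : ℤ)) h1

/-- Torsion in the stalk can only increase the local degree. -/
lemma GeneratesAt.le_localDegree {τ : genericStalk M} {p : C} {x y : C.functionField}
    (hτ : τ ≠ 0) (hx : x ≠ 0) (hy : y ≠ 0) (hM : GeneratesAt M τ p x) (hp : p ≠ genericPoint C)
    {d : ℤ} (hd : IsLocalDegree M (y • τ) p d) :
    letI := functionFieldAlgebra c
    haveI := isCurveField_functionField c
    ord (stalkPlace c p hp) y - ord (stalkPlace c p hp) x ≤ d ∧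
    (Function.Injective (toGenericStalk M p) →
      d = ord (stalkPlace c p hp) y - ord (stalkPlace c p hp) x) := by
  let _ := functionFieldAlgebra c
  have := isCurveField_functionField c
  obtain ⟨ψ, hψs, hψ⟩ := hM.exists_linearMap hτ hx
  obtain ⟨a, q, lq, la, ha, hq, hlq, hla, rfl⟩ := hd
  have hinj := IsFractionRing.injective (C.presheaf.stalk p) C.functionField
  have ha' : algebraMap (C.presheaf.stalk p) C.functionField a ≠ 0 :=
    fun h ↦ ha (hinj (h.trans (map_zero _).symm))
  have h1 : algebraMap (C.presheaf.stalk p) C.functionField (ψ q) * x =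
      algebraMap (C.presheaf.stalk p) C.functionField a * y := by
    refine smul_left_injective _ hτ ?_
    change _ • τ = _ • τ
    rw [← hψ, hq, smul_smul]
  have hr' : algebraMap (C.presheaf.stalk p) C.functionField (ψ q) ≠ 0 := by
    intro h
    rw [h, zero_mul] at h1
    exact mul_ne_zero ha' hy h1.symm
  have hr : ψ q ≠ 0 := fun h ↦ hr' (by rw [h, map_zero])
  have h2 : ord (stalkPlace c p hp) (algebraMap (C.presheaf.stalk p) C.functionField (ψ q)) +
      ord (stalkPlace c p hp) x = ord (stalkPlace c p hp)
        (algebraMap (C.presheaf.stalk p) C.functionField a) + ord (stalkPlace c p hp) y := by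
    rw [← ord_mul hr' hx, h1, ord_mul ha' hy]
  have hmap : Submodule.span (C.presheaf.stalk p) {q} ≤
      Submodule.comap ψ (Submodule.span (C.presheaf.stalk p) {ψ q}) := by
    rw [Submodule.span_singleton_le_iff_mem, Submodule.mem_comap]
    exact Submodule.mem_span_singleton_self _
  let φ := Submodule.mapQ _ _ ψ hmap
  have hφ : Function.Surjective φ := by
    intro t
    obtain ⟨r, rfl⟩ := Submodule.mkQ_surjective _ t
    obtain ⟨m, rfl⟩ := hψs r
    exact ⟨Submodule.Quotient.mk m, rfl⟩
  have hle := Module.length_le_of_surjective φ hφ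
  rw [hlq] at hle
  obtain ⟨lr, hlr⟩ : ∃ lr : ℕ, Module.length (C.presheaf.stalk p)
      (C.presheaf.stalk p ⧸ Ideal.span {ψ q}) = lr :=
    ⟨_, (ENat.natCast_toNat (ne_top_of_le_ne_top (ENat.natCast_ne_top lq) hle)).symm⟩
  have h3 := length_stalk_eq_ord c hp ha hla
  have h4 := length_stalk_eq_ord c hp hr hlr
  rw [← h3, ← h4] at h2
  rw [hlr, Nat.cast_le] at hle
  refine ⟨by omega, fun htor ↦ ?_⟩
  have hφ' : Function.Injective φ := by
    rw [← LinearMap.ker_eq_bot, Submodule.ker_mapQ, ← le_bot_iff, Submodule.map_le_iff_le_comap]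
    intro m hm
    obtain ⟨s, hs⟩ := Submodule.mem_span_singleton.1 (Submodule.mem_comap.1 hm)
    have h5 : m = s • q := htor (by rw [hψ, hψ, ← hs, ψ.map_smul])
    rw [Submodule.mem_comap, Submodule.mem_bot]
    exact (Submodule.Quotient.mk_eq_zero _).2 (h5 ▸ Submodule.smul_mem _ s
      (Submodule.mem_span_singleton_self q))
  have hge := Module.length_le_of_injective φ hφ'
  rw [hlq, hlr, Nat.cast_le] at hge
  omega

end LocalDegree

/-! ### The Euler sequence at the generic point -/

section Rational

variable {C : Scheme.{0}} [IsIntegral C] {M N : C.Modules} {U V : C.Opens}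

/-- A function on an open set, as a rational function. -/
def ratFn (hU : genericPoint C ∈ U) : Γ(C, U) →+* C.functionField :=
  (C.presheaf.germ U (genericPoint C) hU).hom

/-- A section over an open set, as a rational section. -/
def ratSec (hU : genericPoint C ∈ U) : Γ(M, U) →+ genericStalk M :=
  (M.presheaf.germ U (genericPoint C) hU).hom

lemma ratFn_injective (hU : genericPoint C ∈ U) : Function.Injective (ratFn hU) :=
  germ_injective_of_isIntegral C _ hU

lemma ratFn_map (hU : genericPoint C ∈ U) (i : U ⟶ V) (r : Γ(C, V)) :
    ratFn hU (C.presheaf.map i.op r) = ratFn (i.le hU) r :=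
  C.presheaf.germ_res_apply i _ hU r

lemma ratSec_map (hU : genericPoint C ∈ U) (i : U ⟶ V) (m : Γ(M, V)) :
    ratSec hU (M.presheaf.map i.op m) = ratSec (i.le hU) m :=
  M.presheaf.germ_res_apply i _ hU m

lemma ratSec_smul (hU : genericPoint C ∈ U) (r : Γ(C, U)) (m : Γ(M, U)) :
    ratSec hU (r • m) = ratFn hU r • ratSec hU m :=
  germ_smul hU r m

lemma algebraMap_germ_eq_ratFn {p : C} (hp : p ∈ U) (r : Γ(C, U)) :
    algebraMap (C.presheaf.stalk p) C.functionField (C.presheaf.germ U p hp r) =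
      ratFn (mem_of_genericPoint_mem hp) r :=
  algebraMap_germ hp r

lemma toGenericStalk_germ_eq_ratSec {p : C} (hp : p ∈ U) (m : Γ(M, U)) :
    toGenericStalk M p (M.presheaf.germ U p hp m) = ratSec (mem_of_genericPoint_mem hp) m :=
  toGenericStalk_germ hp m

lemma exists_ratSec_eq (f : M ⟶ N) [Epi f] (t : genericStalk N) :
    ∃ (U : C.Opens) (hU : genericPoint C ∈ U) (m : Γ(M, U)), ratSec hU (f.app U m) = t :=
  exists_germ_eq_of_epi f _ t

/-- An open set that does not contain the generic point is empty, so the only function on it is `0`.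
-/
lemma eq_zero_of_genericPoint_notMem (hU : genericPoint C ∉ U) (r : Γ(C, U)) : r = 0 := by
  have h0 : U = ⊥ := by
    ext x
    exact ⟨fun hx ↦ hU (mem_of_genericPoint_mem hx), fun hx ↦ hx.elim⟩
  subst h0
  exact Subsingleton.elim _ _

/-- The coordinates of a section of a free module, as a vector of rational functions. -/
def ratVec {I : Type} (hU : genericPoint C ∈ U) (a : Γ(freeModule C I, U)) : I → C.functionField :=
  fun i ↦ ratFn hU (coords a i)

lemma ratVec_map {I : Type} (hU : genericPoint C ∈ U) (i : U ⟶ V) (a : Γ(freeModule C I, V)) :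
    ratVec hU ((freeModule C I).presheaf.map i.op a) = ratVec (i.le hU) a := by
  ext k
  rw [ratVec, coords_map, ratFn_map]
  rfl

lemma ratVec_add {I : Type} (hU : genericPoint C ∈ U) (a b : Γ(freeModule C I, U)) :
    ratVec hU (a + b) = ratVec hU a + ratVec hU b := by
  ext k
  simp only [ratVec, coords, map_add, Pi.add_apply]
  exact map_add (ratFn hU) _ _

lemma ratVec_sub {I : Type} (hU : genericPoint C ∈ U) (a b : Γ(freeModule C I, U)) :
    ratVec hU (a - b) = ratVec hU a - ratVec hU b := by
  rw [eq_sub_iff_add_eq, ← ratVec_add, sub_add_cancel]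

lemma ratVec_smul {I : Type} (hU : genericPoint C ∈ U) (r : Γ(C, U)) (a : Γ(freeModule C I, U)) :
    ratVec hU (r • a) = ratFn hU r • ratVec hU a := by
  ext k
  rw [ratVec, coords_smul, map_mul]
  rfl

lemma ratVec_injective {I : Type} [Finite I] (hU : genericPoint C ∈ U) :
    Function.Injective (ratVec hU : Γ(freeModule C I, U) → I → C.functionField) :=
  fun _ _ hab ↦ coords_injective (funext fun i ↦ ratFn_injective hU (congrFun hab i))

/-- The `i`-th basis section of a free module. -/
def basisSection {I : Type} [Fintype I] [DecidableEq I] (U : C.Opens) (i : I) :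
    Γ(freeModule C I, U) :=
  ofCoords (Pi.single i 1)

lemma ratVec_basisSection {I : Type} [Fintype I] [DecidableEq I] (hU : genericPoint C ∈ U) (i : I) :
    ratVec hU (basisSection U i) = Pi.single i 1 := by
  ext k
  rw [ratVec, basisSection, coords_ofCoords]
  by_cases hk : k = i
  · subst hk
    simp
  · simp [hk]

lemma sum_ratVec_basisSection {I : Type} [Fintype I] [DecidableEq I]
    (hU : genericPoint C ∈ U) (i : I) (g : I → C.functionField) :
    ∑ k, ratVec hU (basisSection U i) k * g k = g i := by
  rw [ratVec_basisSection, Finset.sum_eq_single i (fun k _ hk ↦ by simp [hk]) (by simp)]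
  simp

end Rational

section Euler

variable {C : Scheme.{0}} [IsIntegral C] {n : ℕ} (h : C ⟶ PSpace n)

/-- The index of a homogeneous coordinate that does not vanish at the generic point. -/
def genericIndex : Fin (n + 1) := (exists_coord_notMem (h (genericPoint C))).choose

lemma genericPoint_mem_chartOpen : genericPoint C ∈ chartOpen h (genericIndex h) :=
  (exists_coord_notMem (h (genericPoint C))).choose_spec

/-- The homogeneous coordinates of the generic point of the curve, normalised by one of them. -/
def genericCoord (i : Fin (n + 1)) : C.functionField :=
  ratFn (genericPoint_mem_chartOpen h) (coordFn h i (genericIndex h))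

variable {h}

lemma ratFn_coordFn_mul {j : Fin (n + 1)} (hj : genericPoint C ∈ chartOpen h j)
    (i : Fin (n + 1)) : ratFn hj (coordFn h i j) * genericCoord h j = genericCoord h i := by
  rw [genericCoord, genericCoord]
  refine Eq.trans (congrArg₂ (· * ·) (germ_coordFn h _ i j hj)
    (germ_coordFn h _ j _ (genericPoint_mem_chartOpen h))) ?_
  refine Eq.trans ?_ (germ_coordFn h _ i _ (genericPoint_mem_chartOpen h)).symm
  exact (map_mul _ _ _).symm.trans (congrArg _ (coordFraction_mul _ _ _ _ _ _))

lemma ratFn_coordFn_self {j : Fin (n + 1)} (hj : genericPoint C ∈ chartOpen h j) :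
    ratFn hj (coordFn h j j) = 1 :=
  (germ_coordFn h _ j j hj).trans ((congrArg _ (coordFraction_self _ _ hj)).trans (map_one _))

variable (h) in
lemma genericCoord_genericIndex : genericCoord h (genericIndex h) = 1 :=
  ratFn_coordFn_self (genericPoint_mem_chartOpen h)

lemma genericCoord_ne_zero {j : Fin (n + 1)} (hj : genericPoint C ∈ chartOpen h j) :
    genericCoord h j ≠ 0 := by
  intro h0
  have := ratFn_coordFn_mul hj (genericIndex h)
  rw [h0, mul_zero, genericCoord_genericIndex] at this
  exact zero_ne_one this

lemma ratFn_coordFn {j : Fin (n + 1)} (hj : genericPoint C ∈ chartOpen h j)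
    (i : Fin (n + 1)) : ratFn hj (coordFn h i j) = genericCoord h i / genericCoord h j :=
  eq_div_of_mul_eq (genericCoord_ne_zero hj) (ratFn_coordFn_mul hj i)

/-- The Euler map is evaluation on the generic point. -/
lemma ratFn_eulerMap {U : C.Opens} {j : Fin (n + 1)} (_ : genericPoint C ∈ chartOpen h j)
    (hU : genericPoint C ∈ U) (a : Γ(freeModule C (Fin (n + 1)), U))
    (hW : genericPoint C ∈ (chartOpen h j).ι ''ᵁ ((chartOpen h j).ι ⁻¹ᵁ U)) :
    ratFn hW (toExtFn ((eulerMap h ≫ Pi.π _ j).app U a)) =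
      (∑ i, ratVec hU a i * genericCoord h i) / genericCoord h j := by
  rw [eulerMap_app_pi, map_sum, Finset.sum_div]
  refine Finset.sum_congr rfl fun i _ ↦ ?_
  rw [map_mul, ratFn_map, ratFn_map, ratFn_coordFn, mul_div_assoc]
  rfl

/-- A section of `𝒪^{n+1}` lies in `h^* Ω(1)` if and only if it is orthogonal to the generic point
of the curve. -/
lemma eulerMap_app_eq_zero_iff {U : C.Opens} (hU : genericPoint C ∈ U)
    (a : Γ(freeModule C (Fin (n + 1)), U)) :
    (eulerMap h).app U a = 0 ↔ ∑ i, ratVec hU a i * genericCoord h i = 0 := by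
  have hmem {j : Fin (n + 1)} (hj : genericPoint C ∈ chartOpen h j) :
      genericPoint C ∈ (chartOpen h j).ι ''ᵁ ((chartOpen h j).ι ⁻¹ᵁ U) := by
    rw [Scheme.Hom.image_preimage_eq_opensRange_inf, Scheme.Opens.opensRange_ι]
    exact ⟨hj, hU⟩
  constructor
  · intro h0
    have h1 := ratFn_eulerMap (genericPoint_mem_chartOpen h) hU a
      (hmem (genericPoint_mem_chartOpen h))
    rw [genericCoord_genericIndex, div_one] at h1
    rw [← h1]
    have h2 : (eulerMap h ≫ Pi.π _ (genericIndex h)).app U a = 0 := by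
      rw [Scheme.Modules.Hom.comp_app, AddCommGrpCat.comp_apply, h0, map_zero]
    rw [h2]
    exact map_zero _
  · intro h0
    refine pi_section_ext _ U _ fun j ↦ ?_
    by_cases hj : genericPoint C ∈ chartOpen h j
    · refine ratFn_injective (hmem hj) (Eq.trans ?_ (map_zero _).symm)
      refine (ratFn_eulerMap hj hU a (hmem hj)).trans ?_
      rw [h0, zero_div]
    · exact eq_zero_of_genericPoint_notMem (C := C)
        (fun hW ↦ hj ((chartOpen h j).ι_image_le _ hW)) _

lemma ratVec_eulerInclusion {U : C.Opens} (hU : genericPoint C ∈ U) (b : Γ(pullbackOmegaOne h, U)) :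
    ∑ i, ratVec hU ((eulerInclusion h).app U b) i * genericCoord h i = 0 := by
  rw [← eulerMap_app_eq_zero_iff hU, ← AddCommGrpCat.comp_apply, ← Scheme.Modules.Hom.comp_app]
  have : eulerInclusion h ≫ eulerMap h = 0 := kernel.condition _
  rw [this]
  rfl

variable (h) in
/-- The evaluation map onto the pullback of `𝒪(1)`. -/
def evaluation : freeModule C (Fin (n + 1)) ⟶ pullbackOOne h :=
  Abelian.factorThruImage (eulerMap h)

instance epi_evaluation : Epi (evaluation h) :=
  inferInstanceAs (Epi (Abelian.factorThruImage (eulerMap h)))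

lemma evaluation_app_eq_zero_iff {U : C.Opens} (hU : genericPoint C ∈ U)
    (a : Γ(freeModule C (Fin (n + 1)), U)) :
    (evaluation h).app U a = 0 ↔ ∑ i, ratVec hU a i * genericCoord h i = 0 := by
  rw [← eulerMap_app_eq_zero_iff hU]
  let ι : pullbackOOne h ⟶ _ := Abelian.image.ι (eulerMap h)
  have hι : Mono ι := inferInstanceAs (Mono (Abelian.image.ι (eulerMap h)))
  have h1 : evaluation h ≫ ι = eulerMap h := Abelian.image.fac (eulerMap h)
  have h3 : (eulerMap h).app U a = ι.app U ((evaluation h).app U a) := by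
    rw [← AddCommGrpCat.comp_apply, ← Scheme.Modules.Hom.comp_app, h1]
  rw [h3]
  exact ⟨fun h0 ↦ by rw [h0, map_zero],
    fun h0 ↦ app_injective ι U (h0.trans (map_zero (ι.app U).hom).symm)⟩

variable (h) in
/-- The rational section of the pullback of `𝒪(1)` given by the coordinate that is normalised to
`1`. -/
def evalBase : genericStalk (pullbackOOne h) :=
  ratSec (U := ⊤) trivial ((evaluation h).app ⊤ (basisSection ⊤ (genericIndex h)))

/-- The evaluation map at the generic point: `h^* 𝒪(1)` has rank one, with basis `evalBase h`. -/
lemma ratSec_evaluation {U : C.Opens} (hU : genericPoint C ∈ U)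
    (a : Γ(freeModule C (Fin (n + 1)), U)) :
    ratSec hU ((evaluation h).app U a) =
      (∑ i, ratVec hU a i * genericCoord h i) • evalBase h := by
  let W := U ⊓ chartOpen h (genericIndex h)
  have hW : genericPoint C ∈ W := ⟨hU, genericPoint_mem_chartOpen h⟩
  let i1 : W ⟶ U := homOfLE inf_le_left
  let i2 : W ⟶ chartOpen h (genericIndex h) := homOfLE inf_le_right
  let i3 : W ⟶ ⊤ := homOfLE le_top
  let a' := (freeModule C (Fin (n + 1))).presheaf.map i1.op a
  let r : Γ(C, W) := ∑ i, coords a' i * C.presheaf.map i2.op (coordFn h i (genericIndex h))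
  let e := (freeModule C (Fin (n + 1))).presheaf.map i3.op (basisSection ⊤ (genericIndex h))
  have hr : ratFn hW r = ∑ i, ratVec hU a i * genericCoord h i := by
    rw [map_sum]
    refine Finset.sum_congr rfl fun i _ ↦ ?_
    rw [map_mul, ratFn_map, coords_map, ratFn_map]
    rfl
  have h1 : (evaluation h).app W (a' - r • e) = 0 := by
    rw [evaluation_app_eq_zero_iff hW, ratVec_sub, ratVec_smul, ratVec_map, ratVec_map, hr]
    simp only [Pi.sub_apply, Pi.smul_apply, smul_eq_mul, sub_mul, Finset.sum_sub_distrib, mul_assoc]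
    rw [← Finset.mul_sum, sum_ratVec_basisSection, genericCoord_genericIndex, mul_one, sub_self]
  rw [map_sub, sub_eq_zero] at h1
  rw [← ratSec_map hW i1, ← app_map, ← hr]
  change ratSec hW ((evaluation h).app W a') = _
  rw [h1, Scheme.Modules.Hom.app_smul, ratSec_smul, app_map, ratSec_map]
  rfl

lemma exists_eq_zero_of_ratSec {M : C.Modules} {U : C.Opens} (hU : genericPoint C ∈ U) {m : Γ(M, U)}
    (hm : ratSec hU m = 0) :
    ∃ (W : C.Opens) (_ : genericPoint C ∈ W) (i : W ⟶ U), M.presheaf.map i.op m = 0 := by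
  have h1 : M.presheaf.germ U _ hU m = M.presheaf.germ U _ hU 0 :=
    hm.trans (map_zero (M.presheaf.germ U (genericPoint C) hU).hom).symm
  obtain ⟨W, hW, i, i', h⟩ := M.presheaf.germ_eq _ hU hU _ _ h1
  exact ⟨W, hW, i, h.trans (map_zero _)⟩

lemma evaluation_app_eq_zero_of_ratSec {U : C.Opens} (hU : genericPoint C ∈ U)
    {a : Γ(freeModule C (Fin (n + 1)), U)} (ha : ratSec hU ((evaluation h).app U a) = 0) :
    (evaluation h).app U a = 0 := by
  obtain ⟨W, hW, i, h1⟩ := exists_eq_zero_of_ratSec hU ha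
  rw [← app_map, evaluation_app_eq_zero_iff hW, ratVec_map] at h1
  exact (evaluation_app_eq_zero_iff hU a).2 h1

variable (h) in
lemma evalBase_ne_zero : evalBase h ≠ 0 := by
  intro h0
  have hη : genericPoint C ∈ (⊤ : C.Opens) := trivial
  have h1 := evaluation_app_eq_zero_of_ratSec (h := h) hη h0
  rw [evaluation_app_eq_zero_iff hη, sum_ratVec_basisSection, genericCoord_genericIndex] at h1
  exact one_ne_zero h1

variable (h) in
/-- The pullback of `𝒪(1)` is torsion-free. -/
lemma toGenericStalk_pullbackOOne_injective (p : C) :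
    Function.Injective (toGenericStalk (pullbackOOne h) p) := by
  refine (injective_iff_map_eq_zero ((pullbackOOne h).presheaf.stalkSpecializes
    ((genericPoint_spec C).specializes trivial)).hom).2 fun t ht ↦ ?_
  obtain ⟨U, hp, a, rfl⟩ := exists_germ_eq_of_epi (evaluation h) p t
  rw [evaluation_app_eq_zero_of_ratSec (mem_of_genericPoint_mem hp)
    ((toGenericStalk_germ_eq_ratSec hp _).symm.trans ht), map_zero]

lemma exists_eq_smul_evalBase (t : genericStalk (pullbackOOne h)) :
    ∃ x : C.functionField, t = x • evalBase h := by
  obtain ⟨U, hU, m, rfl⟩ := exists_ratSec_eq (evaluation h) t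
  exact ⟨_, ratSec_evaluation hU m⟩

/-- The line bundle `h^* 𝒪(1)` is generated at `p` by each coordinate that does not vanish at `p`.
-/
lemma generatesAt_pullbackOOne {p : C} {j : Fin (n + 1)} (hj : p ∈ chartOpen h j) :
    GeneratesAt (pullbackOOne h) (evalBase h) p (genericCoord h j) := by
  refine ⟨fun t ↦ ?_, ?_⟩
  · obtain ⟨U, hp, a, rfl⟩ := exists_germ_eq_of_epi (evaluation h) p t
    refine ⟨∑ i, C.presheaf.germ U p hp (coords a i) *
      C.presheaf.germ _ p hj (coordFn h i j), ?_⟩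
    rw [toGenericStalk_germ_eq_ratSec, ratSec_evaluation, map_sum, Finset.sum_mul]
    congr 1
    refine Finset.sum_congr rfl fun i _ ↦ ?_
    rw [map_mul, algebraMap_germ_eq_ratFn, algebraMap_germ_eq_ratFn, mul_assoc,
      ratFn_coordFn_mul]
    rfl
  · refine ⟨(pullbackOOne h).presheaf.germ ⊤ p (TopologicalSpace.Opens.mem_top p)
      ((evaluation h).app ⊤ (basisSection ⊤ j)), ?_⟩
    rw [toGenericStalk_germ_eq_ratSec, ratSec_evaluation, sum_ratVec_basisSection]

end Euler

/-! ### Rank one quotients of `h^* Ω(1)` -/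

section Quotient

variable {C : Scheme.{0}} [IsIntegral C] {n : ℕ} {h : C ⟶ PSpace n} {U W : C.Opens}

lemma ratVec_sum {I J : Type} (s : Finset J) (hU : genericPoint C ∈ U)
    (a : J → Γ(freeModule C I, U)) :
    ratVec hU (∑ k ∈ s, a k) = ∑ k ∈ s, ratVec hU (a k) :=
  map_sum (AddMonoidHom.mk' (ratVec hU : Γ(freeModule C I, U) → I → C.functionField)
    (ratVec_add hU)) a s

instance mono_eulerInclusion : Mono (eulerInclusion h) :=
  inferInstanceAs (Mono (kernel.ι (eulerMap h)))

lemma exists_eulerInclusion_eq (hU : genericPoint C ∈ U) (a : Γ(freeModule C (Fin (n + 1)), U))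
    (ha : ∑ i, ratVec hU a i * genericCoord h i = 0) :
    ∃ b : Γ(pullbackOmegaOne h, U), (eulerInclusion h).app U b = a :=
  exists_of_kernel_app (eulerMap h) U a ((eulerMap_app_eq_zero_iff hU a).2 ha)

lemma exists_frameSection {j : Fin (n + 1)} (hj : genericPoint C ∈ chartOpen h j)
    (k : Fin (n + 1)) : ∃ b : Γ(pullbackOmegaOne h, chartOpen h j), (eulerInclusion h).app _ b =
      basisSection _ k - coordFn h k j • basisSection _ j := by
  refine exists_eulerInclusion_eq hj _ ?_
  rw [ratVec_sub, ratVec_smul]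
  simp only [Pi.sub_apply, Pi.smul_apply, smul_eq_mul, sub_mul, Finset.sum_sub_distrib, mul_assoc]
  rw [← Finset.mul_sum, sum_ratVec_basisSection, sum_ratVec_basisSection, ratFn_coordFn_mul,
    sub_self]

/-- The section `e_k - (x_k / x_j) e_j` of `h^* Ω(1)` on the chart `x_j ≠ 0`. These sections
generate `h^* Ω(1)` on this chart. -/
def frameSection {j : Fin (n + 1)} (hj : genericPoint C ∈ chartOpen h j) (k : Fin (n + 1)) :
    Γ(pullbackOmegaOne h, chartOpen h j) :=
  (exists_frameSection hj k).choose

lemma eulerInclusion_frameSection {j : Fin (n + 1)} (hj : genericPoint C ∈ chartOpen h j)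
    (k : Fin (n + 1)) : (eulerInclusion h).app _ (frameSection hj k) =
      basisSection _ k - coordFn h k j • basisSection _ j :=
  (exists_frameSection hj k).choose_spec

lemma ratVec_frameSection {j : Fin (n + 1)} (hj : genericPoint C ∈ chartOpen h j)
    (k : Fin (n + 1)) : ratVec hj ((eulerInclusion h).app _ (frameSection hj k)) =
      ratVec hj (basisSection _ k) -
        (genericCoord h k / genericCoord h j) • ratVec hj (basisSection _ j) := by
  rw [eulerInclusion_frameSection, ratVec_sub, ratVec_smul, ratFn_coordFn]

/-- The coordinates of a section of `h^* Ω(1)` in the frame are its coordinates in `𝒪^{n+1}`: since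
`∑ a_k x_k = 0`, the multiples of `e_j` cancel. -/
lemma eq_sum_frameSection {j : Fin (n + 1)} (hj : genericPoint C ∈ chartOpen h j)
    (hW : genericPoint C ∈ W) (i : W ⟶ chartOpen h j) (b : Γ(pullbackOmegaOne h, W)) :
    b = ∑ k, coords ((eulerInclusion h).app W b) k •
      (pullbackOmegaOne h).presheaf.map i.op (frameSection hj k) := by
  refine app_injective (eulerInclusion h) W (ratVec_injective hW ?_)
  rw [map_sum, ratVec_sum]
  have h1 (k : Fin (n + 1)) : ratVec hW ((eulerInclusion h).app W
      (coords ((eulerInclusion h).app W b) k •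
        (pullbackOmegaOne h).presheaf.map i.op (frameSection hj k))) =
      ratVec hW ((eulerInclusion h).app W b) k • (Pi.single k 1 : Fin (n + 1) → C.functionField) -
      (ratVec hW ((eulerInclusion h).app W b) k * genericCoord h k) •
        ((genericCoord h j)⁻¹ • (Pi.single j 1 : Fin (n + 1) → C.functionField)) := by
    rw [Scheme.Modules.Hom.app_smul, app_map, ratVec_smul, ratVec_map, ratVec_frameSection,
      ratVec_basisSection, ratVec_basisSection, smul_sub, smul_smul, smul_smul, ← mul_div_assoc,
      div_eq_mul_inv]
    rfl
  simp_rw [h1]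
  rw [Finset.sum_sub_distrib, ← Finset.sum_smul, ratVec_eulerInclusion, zero_smul, sub_zero]
  ext l
  simp [Finset.sum_apply, Pi.single_apply]

variable {Q : C.Modules} {π : pullbackOmegaOne h ⟶ Q}

/-- The rational functions `w` describe `π` with respect to the rational section `τ` of `Q`: a
section `(a_0, …, a_n)` of `h^* Ω(1)` is sent to `(∑ a_i w_i) • τ`. -/
def IsCoframe (π : pullbackOmegaOne h ⟶ Q) (τ : genericStalk Q)
    (w : Fin (n + 1) → C.functionField) : Prop :=
  ∀ (U : C.Opens) (hU : genericPoint C ∈ U) (b : Γ(pullbackOmegaOne h, U)),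
    ratSec hU (π.app U b) = (∑ i, ratVec hU ((eulerInclusion h).app U b) i * w i) • τ

/-- A coframe is obtained from the values of `π` on the frame sections. -/
lemma exists_isCoframe (π : pullbackOmegaOne h ⟶ Q) {τ : genericStalk Q}
    (hτ : ∀ t : genericStalk Q, ∃ x : C.functionField, x • τ = t) :
    ∃ w, IsCoframe π τ w := by
  let hj := genericPoint_mem_chartOpen h
  choose w hw using fun k ↦ hτ (ratSec hj (π.app _ (frameSection hj k)))
  refine ⟨w, fun U hU b ↦ ?_⟩
  let W := U ⊓ chartOpen h (genericIndex h)
  have hW : genericPoint C ∈ W := ⟨hU, hj⟩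
  let i1 : W ⟶ U := homOfLE inf_le_left
  let i2 : W ⟶ chartOpen h (genericIndex h) := homOfLE inf_le_right
  rw [← ratSec_map hW i1, ← app_map, eq_sum_frameSection hj hW i2
    ((pullbackOmegaOne h).presheaf.map i1.op b), map_sum, map_sum, Finset.sum_smul]
  refine Finset.sum_congr rfl fun k _ ↦ ?_
  rw [Scheme.Modules.Hom.app_smul, ratSec_smul, app_map π, ratSec_map, ← hw, smul_smul, app_map,
    coords_map, ratFn_map]
  rfl

/-- A coframe of a rank one quotient is independent of the generic point of the curve: a multiple of
`genericCoord h` vanishes on `h^* Ω(1)`, whereas `π` does not vanish. So both span a plane. -/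
lemma exists_isCoframe_of_isRankOne [Epi π] (hQ : IsRankOne Q) :
    ∃ (τ : genericStalk Q) (w : Fin (n + 1) → C.functionField), τ ≠ 0 ∧
      (∀ t : genericStalk Q, ∃ x : C.functionField, x • τ = t) ∧ IsCoframe π τ w ∧
      LinearIndependent C.functionField ![genericCoord h, w] := by
  obtain ⟨τ, hτ0, hτ⟩ := finrank_eq_one_iff'.1 hQ
  obtain ⟨w, hw⟩ := exists_isCoframe π hτ
  refine ⟨τ, w, hτ0, hτ, hw, ?_⟩
  have h0 : genericCoord h ≠ 0 := fun h0 ↦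
    genericCoord_ne_zero (genericPoint_mem_chartOpen h) (congrFun h0 _)
  rw [LinearIndependent.pair_iff' h0]
  intro s hs
  obtain ⟨U, hU, b, hb⟩ := exists_ratSec_eq π τ
  apply hτ0
  rw [← hb, hw]
  have h1 : ∑ i, ratVec hU ((eulerInclusion h).app U b) i * w i =
      s * ∑ i, ratVec hU ((eulerInclusion h).app U b) i * genericCoord h i := by
    rw [Finset.mul_sum, ← hs]
    exact Finset.sum_congr rfl fun i _ ↦ mul_left_comm _ _ _
  rw [h1, ratVec_eulerInclusion, mul_zero, zero_smul]

lemma IsCoframe.ratSec_frameSection {τ : genericStalk Q} {w : Fin (n + 1) → C.functionField}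
    (hw : IsCoframe π τ w) {j : Fin (n + 1)} (hj : genericPoint C ∈ chartOpen h j)
    (k : Fin (n + 1)) : ratSec hj (π.app _ (frameSection hj k)) =
      (minor (genericCoord h) w j k / genericCoord h j) • τ := by
  rw [hw, ratVec_frameSection]
  simp only [Pi.sub_apply, Pi.smul_apply, smul_eq_mul, sub_mul, Finset.sum_sub_distrib, mul_assoc]
  rw [← Finset.mul_sum, sum_ratVec_basisSection, sum_ratVec_basisSection, minor, sub_div,
    mul_div_cancel_left₀ _ (genericCoord_ne_zero hj), div_mul_eq_mul_div]

lemma exists_max_row {K : Type} [Field K] {ι : Type} [Finite ι] (V : ValuationSubring K)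
    {x : ι → K} (hx : x ≠ 0) : ∃ k, x k ≠ 0 ∧ ∀ l, x l / x k ∈ V := by
  obtain ⟨i, hi⟩ := Function.ne_iff.1 hx
  have : Nonempty ι := ⟨i⟩
  obtain ⟨k, hk⟩ := Finite.exists_max fun k ↦ V.valuation (x k)
  refine ⟨k, fun h0 ↦ hi ?_, fun l ↦ ?_⟩
  · have := hk i
    simp only [h0, map_zero] at this
    exact (map_eq_zero _).1 (le_zero_iff.1 this)
  · rw [← V.valuation_le_one_iff, map_div₀]
    exact div_le_one_of_le₀ (hk l) zero_le

lemma minor_row_ne_zero {K : Type} [Field K] {ι : Type} {b b' : ι → K}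
    (hl : LinearIndependent K ![b, b']) {j : ι} (hj : b j ≠ 0) : minor b b' j ≠ 0 := by
  intro h0
  have := LinearIndependent.pair_iff.1 hl (b' j) (- b j) (by
    ext k
    have := congrFun h0 k
    simp only [minor, Pi.zero_apply] at this
    simp only [Pi.add_apply, Pi.smul_apply, smul_eq_mul, Pi.zero_apply]
    linear_combination -this)
  exact hj (neg_eq_zero.1 this.2)

/-- The Plücker relation with a fixed row. -/
lemma minor_div_mem {K : Type} [Field K] {ι : Type} {V : ValuationSubring K} {b b' : ι → K}
    {j k : ι} (hj : b j ≠ 0) (hb : ∀ l, b l / b j ∈ V)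
    (hk : ∀ l, minor b b' j l / minor b b' j k ∈ V) (l m : ι) :
    minor b b' l m / minor b b' j k ∈ V := by
  have h1 : minor b b' l m / minor b b' j k = b l / b j * (minor b b' j m / minor b b' j k) -
      b m / b j * (minor b b' j l / minor b b' j k) := by
    have h2 : minor b b' l m = (b l * minor b b' j m - b m * minor b b' j l) / b j := by
      rw [eq_div_iff hj]
      simp only [minor]
      ring
    rw [h2]
    ring
  rw [h1]
  exact sub_mem (mul_mem (hb _) (hk _)) (mul_mem (hb _) (hk _))

variable (c : C ⟶ Spec (.of ℂ)) [SmoothOfRelativeDimension 1 c]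

/-- At a point `p` with `x_j ≠ 0`, the quotient `Q` modulo torsion is generated by the images of the
frame sections, that is, by the minors with row `j`, divided by the `j`-th coordinate; hence by the
one of least order. -/
lemma generatesAt_quotient [Epi π] {τ : genericStalk Q} {w : Fin (n + 1) → C.functionField}
    (hw : IsCoframe π τ w) {p : C} (hp : p ≠ genericPoint C) {j k : Fin (n + 1)}
    (hj : p ∈ chartOpen h j)
    (h0 : minor (genericCoord h) w j k ≠ 0)
    (hk : letI := functionFieldAlgebra c
      ∀ l, minor (genericCoord h) w j l / minor (genericCoord h) w j k ∈ (stalkPlace c p hp).1) :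
    GeneratesAt Q τ p (minor (genericCoord h) w j k / genericCoord h j) := by
  let _ := functionFieldAlgebra c
  have hη := mem_of_genericPoint_mem hj
  refine ⟨fun t ↦ ?_, Q.presheaf.germ _ p hj (π.app _ (frameSection hη k)), ?_⟩
  · obtain ⟨U, hpU, b, rfl⟩ := exists_germ_eq_of_epi π p t
    let W := U ⊓ chartOpen h j
    have hpW : p ∈ W := ⟨hpU, hj⟩
    have hW := mem_of_genericPoint_mem hpW
    let i1 : W ⟶ U := homOfLE inf_le_left
    let i2 : W ⟶ chartOpen h j := homOfLE inf_le_right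
    choose r hr using hk
    refine ⟨∑ l, C.presheaf.germ W p hpW
      (coords ((eulerInclusion h).app W ((pullbackOmegaOne h).presheaf.map i1.op b)) l) * r l, ?_⟩
    rw [toGenericStalk_germ_eq_ratSec, ← ratSec_map hW i1, ← app_map, eq_sum_frameSection hη hW i2
      ((pullbackOmegaOne h).presheaf.map i1.op b), map_sum, map_sum, map_sum, Finset.sum_mul,
      Finset.sum_smul, ← eq_sum_frameSection hη hW i2]
    refine Finset.sum_congr rfl fun l _ ↦ ?_
    rw [Scheme.Modules.Hom.app_smul, ratSec_smul, app_map π, ratSec_map, hw.ratSec_frameSection,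
      map_mul, hr, algebraMap_germ_eq_ratFn, smul_smul]
    congr 1
    field_simp
  · rw [toGenericStalk_germ_eq_ratSec, hw.ratSec_frameSection]

end Quotient

/-! ### The degree of a quotient -/

section DegreeComparison

variable {C : Scheme.{0}} [IsIntegral C] {n : ℕ} {h : C ⟶ PSpace n}
  {Q : C.Modules} {π : pullbackOmegaOne h ⟶ Q} {τ : genericStalk Q}
  {w : Fin (n + 1) → C.functionField} (c : C ⟶ Spec (.of ℂ)) [SmoothOfRelativeDimension 1 c]

lemma genericCoord_div_mem {p : C} (hp : p ≠ genericPoint C) {j : Fin (n + 1)}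
    (hj : p ∈ chartOpen h j) (l : Fin (n + 1)) :
    letI := functionFieldAlgebra c
    genericCoord h l / genericCoord h j ∈ (stalkPlace c p hp).1 := by
  refine (mem_stalkPlace c hp).2 ⟨C.presheaf.germ _ p hj (coordFn h l j), ?_⟩
  rw [algebraMap_germ_eq_ratFn, ratFn_coordFn]

/-- The local form of the degree formula. At `p`, the line bundle `h^* 𝒪(1)` is generated by `x_j`,
and `Q` modulo torsion by a minor of least order divided by `x_j`; so their tensor product is
generated by that minor. -/
lemma localDegree_add [Epi π] (hτ : τ ≠ 0) (hw : IsCoframe π τ w)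
    (hl : LinearIndependent C.functionField ![genericCoord h, w])
    {p : C} (hp : p ≠ genericPoint C) {x y : C.functionField} (hx : x ≠ 0) (hy : y ≠ 0) {d d' : ℤ}
    (hd : IsLocalDegree (pullbackOOne h) (x • evalBase h) p d)
    (hd' : IsLocalDegree Q (y • τ) p d') :
    letI := functionFieldAlgebra c
    haveI := isCurveField_functionField c
    ord (stalkPlace c p hp) x + ord (stalkPlace c p hp) y -
      minorOrd (genericCoord h) w (stalkPlace c p hp) ≤ d + d' ∧
    (Function.Injective (toGenericStalk Q p) →
      ord (stalkPlace c p hp) x + ord (stalkPlace c p hp) y -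
        minorOrd (genericCoord h) w (stalkPlace c p hp) = d + d') := by
  let _ := functionFieldAlgebra c
  have := isCurveField_functionField c
  obtain ⟨j, hj⟩ := exists_coord_notMem (h p)
  have hv0 : genericCoord h j ≠ 0 := genericCoord_ne_zero (mem_of_genericPoint_mem hj)
  obtain ⟨k, hk0, hk⟩ := exists_max_row (stalkPlace c p hp).1 (minor_row_ne_zero hl hv0)
  have h1 := (generatesAt_pullbackOOne hj).le_localDegree c (evalBase_ne_zero h) hv0 hx hp hd
  have h1' := h1.2 (toGenericStalk_pullbackOOne_injective h p)
  have h2 := (generatesAt_quotient c hw hp hj hk0 hk).le_localDegree c hτ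
    (div_ne_zero hk0 hv0) hy hp hd'
  have h3 := minorOrd_eq (V := stalkPlace c p hp) hl hk0
    (minor_div_mem hv0 (genericCoord_div_mem c hp hj) hk)
  have h4 : ord (stalkPlace c p hp) (minor (genericCoord h) w j k / genericCoord h j) =
      ord (stalkPlace c p hp) (minor (genericCoord h) w j k) -
        ord (stalkPlace c p hp) (genericCoord h j) := by
    rw [div_eq_mul_inv, ord_mul hk0 (inv_ne_zero hv0), ord_inv, sub_eq_add_neg]
  rw [h4] at h2
  rw [h3]
  refine ⟨by linarith [h2.1], fun htor ↦ ?_⟩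
  linarith [h2.2 htor]

variable [IsProper c]

/-- The closed points of the curve are the places of its function field. -/
def closedPointsEquiv :
    letI := functionFieldAlgebra c
    {p : C // IsClosed ({p} : Set C)} ≃ Place C.functionField :=
  letI := functionFieldAlgebra c
  Equiv.ofBijective (fun p ↦ stalkPlace c p.1 (ne_genericPoint_of_isClosed c p.2)) <| by
    refine ⟨fun p q hpq ↦ Subtype.ext (stalkPlace_injective hpq), fun V ↦ ?_⟩
    obtain ⟨p, hp, hcl, hV⟩ := exists_stalkPlace_eq V
    exact ⟨⟨p, hcl⟩, hV⟩

lemma finsum_eq_finsupp_sum {α β : Type*} (e : α ≃ β) (D : α →₀ ℤ) :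
    (∑ᶠ b, D (e.symm b)) = D.sum fun _ k ↦ k := by
  rw [finsum_comp_equiv e.symm (f := D), Finsupp.sum,
    finsum_eq_sum_of_support_subset D (by rw [Finsupp.fun_support_eq])]

lemma finite_support_comp {α β : Type*} (e : α ≃ β) (D : α →₀ ℤ) :
    (Function.support fun b ↦ D (e.symm b)).Finite := by
  have h1 : (Function.support fun b ↦ D (e.symm b)) = e.symm ⁻¹' (D.support : Set α) := by
    ext b
    simp
  rw [h1]
  exact D.support.finite_toSet.preimage e.symm.injective.injOn

/-- The degree of the plane spanned by the generic point of the curve and the coframe is the sum of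
the degrees of `h^* 𝒪(1)` and `Q`, up to the torsion of `Q`. -/
theorem planeDegree_le_add [Epi π] (hτ : τ ≠ 0)
    (hτ' : ∀ t : genericStalk Q, ∃ x : C.functionField, x • τ = t) (hw : IsCoframe π τ w)
    (hl : LinearIndependent C.functionField ![genericCoord h, w])
    {e q : ℤ} (he : HasDegree (pullbackOOne h) e) (hq : HasDegree Q q) :
    letI := functionFieldAlgebra c
    haveI := isCurveField_functionField c
    planeDegree (genericCoord h) w ≤ e + q ∧
    ((∀ p, Function.Injective (toGenericStalk Q p)) → planeDegree (genericCoord h) w = e + q) := by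
  let _ := functionFieldAlgebra c
  have := isCurveField_functionField c
  obtain ⟨s, hs, D, hD, rfl⟩ := he
  obtain ⟨t, ht, D', hD', rfl⟩ := hq
  obtain ⟨x, rfl⟩ := exists_eq_smul_evalBase s
  obtain ⟨y, rfl⟩ := hτ' t
  have hx : x ≠ 0 := fun h0 ↦ hs (by rw [h0, zero_smul])
  have hy : y ≠ 0 := fun h0 ↦ ht (by rw [h0, zero_smul])
  let E := closedPointsEquiv c
  have hE (V : Place C.functionField) : stalkPlace c (E.symm V).1
      (ne_genericPoint_of_isClosed c (E.symm V).2) = V := E.apply_symm_apply V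
  have hloc (V : Place C.functionField) := localDegree_add c hτ hw hl
    (ne_genericPoint_of_isClosed c (E.symm V).2) hx hy (hD (E.symm V)) (hD' (E.symm V))
  simp only [hE] at hloc
  have h1 : ∑ᶠ V : Place C.functionField, (D (E.symm V) + D' (E.symm V)) =
      (D.sum fun _ k ↦ k) + D'.sum fun _ k ↦ k := by
    rw [finsum_add_distrib (finite_support_comp E D) (finite_support_comp E D'),
      finsum_eq_finsupp_sum, finsum_eq_finsupp_sum]
  have hfin : (Function.support fun V : Place C.functionField ↦ ord V x + ord V y).Finite :=
    ((finite_ord_ne_zero x).union (finite_ord_ne_zero y)).subset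
      (Function.support_add _ _)
  have h2 : ∑ᶠ V : Place C.functionField, (ord V x + ord V y - minorOrd (genericCoord h) w V) =
      planeDegree (genericCoord h) w := by
    rw [finsum_sub_distrib hfin (finite_minorOrd_ne_zero _ _),
      finsum_add_distrib (finite_ord_ne_zero x) (finite_ord_ne_zero y), finsum_ord, finsum_ord,
      planeDegree, add_zero, zero_sub]
  rw [← h1, ← h2]
  refine ⟨finsum_le_finsum' ?_ ?_ fun V ↦ (hloc V).1, fun htor ↦ ?_⟩
  · exact (hfin.union (finite_minorOrd_ne_zero _ _)).subset (Function.support_sub _ _)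
  · exact ((finite_support_comp E D).union (finite_support_comp E D')).subset
      (Function.support_add _ _)
  · exact finsum_congr fun V ↦ (hloc V).2 (htor _)

end DegreeComparison

/-! ### Line bundles are torsion-free -/

section LocallyFree

/-- If `N` is freely generated by sections, the generators and the coordinates with respect to them.
-/
lemma exists_coordinates {D : Type} [SmallCategory D] {J : GrothendieckTopology D}
    {R : Sheaf J RingCat.{0}} [HasWeakSheafify J AddCommGrpCat.{0}]
    [J.WEqualsLocallyBijective AddCommGrpCat.{0}]
    {N : SheafOfModules.{0} R} (σ : N.GeneratingSections) [IsIso σ.π] :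
    ∃ (α : σ.I → (SheafOfModules.unit R ⟶ N)) (β : σ.I → (N ⟶ SheafOfModules.unit R)),
      (∀ i, α i ≫ β i = 𝟙 _) ∧ (∀ i j, j ≠ i → α j ≫ β i = 0) ∧
      ∀ (P : SheafOfModules.{0} R) (f g : N ⟶ P), (∀ i, α i ≫ f = α i ≫ g) → f = g := by
  classical
  let c := SheafOfModules.isColimitFreeCofan (R := R) σ.I
  let γ (i : σ.I) : SheafOfModules.free σ.I ⟶ SheafOfModules.unit R :=
    Cofan.IsColimit.desc c fun j ↦ if j = i then 𝟙 _ else 0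
  have hγ (i j : σ.I) : SheafOfModules.ιFree j ≫ γ i = if j = i then 𝟙 _ else 0 :=
    Cofan.IsColimit.fac c _ j
  have h1 (i j : σ.I) : (SheafOfModules.ιFree j ≫ σ.π) ≫ inv σ.π ≫ γ i =
      if j = i then 𝟙 _ else 0 := by
    rw [Category.assoc, IsIso.hom_inv_id_assoc, hγ]
  refine ⟨fun i ↦ SheafOfModules.ιFree i ≫ σ.π, fun i ↦ inv σ.π ≫ γ i,
    fun i ↦ (h1 i i).trans (if_pos rfl), fun i j hij ↦ (h1 i j).trans (if_neg hij),
    fun P f g hfg ↦ ?_⟩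
  rw [← cancel_epi σ.π]
  refine Cofan.IsColimit.hom_ext c _ _ fun i ↦ ?_
  have := hfg i
  rwa [Category.assoc, Category.assoc] at this

variable {C : Scheme.{0}} {M N P : C.Modules} {U : C.Opens}

/-- The restriction of a sheaf of modules to an open set. -/
abbrev restrictOver (M : C.Modules) (U : C.Opens) : SheafOfModules (C.ringCatSheaf.over U) :=
  SheafOfModules.over (R := C.ringCatSheaf) M U

/-- A morphism between restrictions of sheaves of modules to `U`, on sections over `V ⊆ U`. -/
def overApp (f : restrictOver M U ⟶ restrictOver N U) {V : C.Opens} (i : V ⟶ U) :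
    Γ(M, V) →ₗ[Γ(C, V)] Γ(N, V) :=
  (f.val.app (.op (Over.mk i))).hom

lemma overApp_map (f : restrictOver M U ⟶ restrictOver N U) {V W : C.Opens} (i : V ⟶ U) (j : W ⟶ V)
    (m : Γ(M, V)) :
    overApp f (j ≫ i) (M.presheaf.map j.op m) = N.presheaf.map j.op (overApp f i m) :=
  PresheafOfModules.naturality_apply f.val
    (Over.homMk j : Over.mk (j ≫ i) ⟶ Over.mk i).op m

lemma overApp_of_comp_eq_id {f : restrictOver M U ⟶ restrictOver N U}
    {g : restrictOver N U ⟶ restrictOver M U} (hfg : f ≫ g = 𝟙 _) {V : C.Opens} (i : V ⟶ U)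
    (m : Γ(M, V)) : overApp g i (overApp f i m) = m := by
  have : overApp (f ≫ g) i m = m := by
    rw [hfg]
    rfl
  exact this

lemma overApp_of_comp_eq_zero {f : restrictOver M U ⟶ restrictOver N U}
    {g : restrictOver N U ⟶ restrictOver P U} (hfg : f ≫ g = 0) {V : C.Opens} (i : V ⟶ U)
    (m : Γ(M, V)) : overApp g i (overApp f i m) = 0 := by
  have : overApp (f ≫ g) i m = 0 := by
    rw [hfg]
    rfl
  exact this

/-- A locally free sheaf has generators and dual coordinates on a neighbourhood of each point. -/
lemma exists_trivialisation (hM : SheafOfModules.IsLocallyFree M) (p : C) :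
    ∃ (U : C.Opens) (_ : p ∈ U) (I : Type)
      (α : I → (restrictOver (structureModule C) U ⟶ restrictOver M U))
      (β : I → (restrictOver M U ⟶ restrictOver (structureModule C) U)),
      (∀ i, α i ≫ β i = 𝟙 _) ∧ (∀ i j, j ≠ i → α j ≫ β i = 0) ∧
      ∀ f : restrictOver M U ⟶ restrictOver M U, (∀ i, α i ≫ f = α i) → f = 𝟙 _ := by
  obtain ⟨q, hq⟩ := hM
  obtain ⟨V, v, hv, hpV⟩ := q.coversTop ⊤ p trivial
  obtain ⟨k, ⟨i⟩⟩ := (Sieve.mem_ofObjects_iff ..).1 hv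
  have hiso : IsIso (q.generators k).π := hq.isIso k
  obtain ⟨α, β, h1, h0, hext⟩ := exists_coordinates (q.generators k)
  exact ⟨q.X k, i.le hpV, _, α, β, h1, h0,
    fun f hf ↦ hext _ _ _ fun l ↦ (hf l).trans (Category.comp_id _).symm⟩

variable [IsIntegral C]

/-- A trivialisation of a locally free sheaf of rank one has at most one generator: two of them
would be independent at the generic point. -/
lemma subsingleton_of_isRankOne (hM : IsRankOne M) {I : Type} (hU : genericPoint C ∈ U)
    (α : I → (restrictOver (structureModule C) U ⟶ restrictOver M U))
    (β : I → (restrictOver M U ⟶ restrictOver (structureModule C) U))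
    (h1 : ∀ i, α i ≫ β i = 𝟙 _) (h0 : ∀ i j, j ≠ i → α j ≫ β i = 0) : Subsingleton I := by
  refine ⟨fun i j ↦ by_contra fun hij ↦ ?_⟩
  obtain ⟨τ, hτ0, hτ⟩ := finrank_eq_one_iff'.1 hM
  let s (k : I) : Γ(M, U) := overApp (α k) (𝟙 U) (ofFn 1)
  have hs (k : I) {W : C.Opens} (w : W ⟶ U) :
      toFn (overApp (β k) (w ≫ 𝟙 U) (M.presheaf.map w.op (s k))) = 1 := by
    rw [overApp_map, overApp_of_comp_eq_id (h1 k)]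
    exact map_one (C.presheaf.map w.op).hom
  have hs' {k l : I} (hkl : l ≠ k) {W : C.Opens} (w : W ⟶ U) :
      toFn (overApp (β k) (w ≫ 𝟙 U) (M.presheaf.map w.op (s l))) = 0 := by
    rw [overApp_map, overApp_of_comp_eq_zero (h0 k l hkl)]
    exact map_zero (C.presheaf.map w.op).hom
  obtain ⟨x, hx⟩ := hτ (ratSec hU (s i))
  obtain ⟨y, hy⟩ := hτ (ratSec hU (s j))
  have hy0 : y ≠ 0 := by
    rintro rfl
    rw [zero_smul] at hy
    obtain ⟨W, hW, w, h2⟩ := exists_eq_zero_of_ratSec hU hy.symm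
    have h3 := hs j w
    rw [h2, map_zero] at h3
    have h4 := congrArg (ratFn hW) h3
    rw [map_one] at h4
    exact zero_ne_one ((map_zero (ratFn hW)).symm.trans h4)
  obtain ⟨V, hV, r, hr⟩ := C.presheaf.exists_germ_eq x
  obtain ⟨V', hV', r', hr'⟩ := C.presheaf.exists_germ_eq y
  let W := V ⊓ V' ⊓ U
  have hW : genericPoint C ∈ W := ⟨⟨hV, hV'⟩, hU⟩
  let i1 : W ⟶ V := homOfLE (inf_le_left.trans inf_le_left)
  let i2 : W ⟶ V' := homOfLE (inf_le_left.trans inf_le_right)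
  let i3 : W ⟶ U := homOfLE inf_le_right
  have h2 : ratSec hW (C.presheaf.map i2.op r' • M.presheaf.map i3.op (s i) -
      C.presheaf.map i1.op r • M.presheaf.map i3.op (s j)) = 0 := by
    rw [map_sub, ratSec_smul, ratSec_smul, ratSec_map, ratSec_map, ← hx, ← hy, ratFn_map, ratFn_map,
      smul_smul, smul_smul]
    have h3 : ratFn hV r = x := hr
    have h4 : ratFn hV' r' = y := hr'
    rw [h3, h4, mul_comm, sub_self]
  obtain ⟨W', hW', w, h3⟩ := exists_eq_zero_of_ratSec hW h2
  rw [map_sub, Scheme.Modules.map_smul, Scheme.Modules.map_smul] at h3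
  have hres (m : Γ(M, U)) : M.presheaf.map w.op (M.presheaf.map i3.op m) =
      M.presheaf.map (w ≫ i3).op m := by
    rw [op_comp, M.presheaf.map_comp]
    rfl
  rw [hres, hres] at h3
  let L : Γ(M, W') →ₗ[Γ(C, W')] Γ(structureModule C, W') := overApp (β i) ((w ≫ i3) ≫ 𝟙 U)
  have h4 : L (M.presheaf.map (w ≫ i3).op (s i)) = ofFn 1 := hs i (w ≫ i3)
  have h5 : L (M.presheaf.map (w ≫ i3).op (s j)) = 0 := hs' (Ne.symm hij) (w ≫ i3)
  have h6 := congrArg L h3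
  rw [map_sub, L.map_smul, L.map_smul, h4, h5, smul_zero, sub_zero, map_zero] at h6
  have h7 : C.presheaf.map w.op (C.presheaf.map i2.op r') = 0 :=
    (mul_one (C.presheaf.map w.op (C.presheaf.map i2.op r'))).symm.trans h6
  have h8 := congrArg (ratFn hW') h7
  rw [ratFn_map, ratFn_map, map_zero] at h8
  exact hy0 (hr'.symm.trans h8)

/-- A line bundle is torsion-free. -/
lemma toGenericStalk_injective_of_isLineBundle (hM : IsLineBundle M) (p : C) :
    Function.Injective (toGenericStalk M p) := by
  obtain ⟨hfree, hrank⟩ := hM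
  obtain ⟨U, hpU, I, α, β, h1, h0, hext⟩ := exists_trivialisation hfree p
  have hsub := subsingleton_of_isRankOne hrank (mem_of_genericPoint_mem hpU) α β h1 h0
  refine (injective_iff_map_eq_zero (M.presheaf.stalkSpecializes
    ((genericPoint_spec C).specializes trivial)).hom).2 fun t ht ↦ ?_
  obtain ⟨W', hW', m', rfl⟩ := M.presheaf.exists_germ_eq t
  let W := W' ⊓ U
  have hpW : p ∈ W := ⟨hW', hpU⟩
  have hW := mem_of_genericPoint_mem hpW
  let i1 : W ⟶ W' := homOfLE inf_le_left
  let i2 : W ⟶ U := homOfLE inf_le_right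
  let m : Γ(M, W) := M.presheaf.map i1.op m'
  have hm : M.presheaf.germ W p hpW m = M.presheaf.germ W' p hW' m' :=
    M.presheaf.germ_res_apply i1 p hpW m'
  rw [← hm] at ht ⊢
  have ht' : ratSec hW m = 0 := (toGenericStalk_germ_eq_ratSec hpW m).symm.trans ht
  have hm0 : m = 0 := by
    rcases isEmpty_or_nonempty I with hI | ⟨⟨l⟩⟩
    · have h2 : (0 : restrictOver M U ⟶ restrictOver M U) = 𝟙 _ := hext 0 fun l ↦ hI.elim l
      exact congr(overApp $h2.symm i2 m)
    · have h2 : β l ≫ α l = 𝟙 (restrictOver M U) := by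
        refine hext _ fun l' ↦ ?_
        obtain rfl : l' = l := Subsingleton.elim _ _
        rw [← Category.assoc, h1, Category.id_comp]
      obtain ⟨W₁, hW₁, w, h3⟩ := exists_eq_zero_of_ratSec hW ht'
      have h4 : overApp (β l) i2 m = 0 := by
        have h5 := overApp_map (β l) i2 w m
        rw [h3, map_zero] at h5
        refine ratFn_injective hW (Eq.trans ?_ (map_zero (ratFn hW)).symm)
        refine (ratFn_map hW₁ w (toFn (overApp (β l) i2 m))).symm.trans ?_
        exact (congrArg (ratFn hW₁) h5.symm).trans (map_zero (ratFn hW₁))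
      have h5 := overApp_of_comp_eq_id h2 i2 m
      rw [h4, map_zero] at h5
      exact h5.symm
  rw [hm0, map_zero]

end LocallyFree

/-! ### The fibres of `ℙ(Q') ⟶ ℙⁿ` -/

section Fibres

/-- Finitely many germs are defined on a common open set. -/
lemma exists_germ_eq_of_finite {X : Scheme.{0}} {I : Type} [Finite I] {p : X}
    (r : I → X.presheaf.stalk p) :
    ∃ (U : X.Opens) (hp : p ∈ U) (s : I → Γ(X, U)), ∀ i, X.presheaf.germ U p hp (s i) = r i := by
  choose U hU s hs using fun i ↦ X.presheaf.exists_germ_eq (r i)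
  let W : X.Opens := ⟨⋂ i, (U i : Set X), isOpen_iInter_of_finite fun i ↦ (U i).isOpen⟩
  have hpW : p ∈ W := Set.mem_iInter.2 hU
  refine ⟨W, hpW, fun i ↦ X.presheaf.map (homOfLE (Set.iInter_subset _ i) : W ⟶ U i).op (s i),
    fun i ↦ ?_⟩
  rw [← hs i]
  exact X.presheaf.germ_res_apply _ p hpW (s i)

variable {C : Scheme.{0}} [IsIntegral C] {n : ℕ} {h : C ⟶ PSpace n}
  {Q : C.Modules} {π : pullbackOmegaOne h ⟶ Q} {τ : genericStalk Q}
  {w : Fin (n + 1) → C.functionField} (c : C ⟶ Spec (.of ℂ)) [SmoothOfRelativeDimension 1 c]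

lemma algebraMap_mem_nonunits_iff_not_isUnit {p : C} (hp : p ≠ genericPoint C)
    (r : C.presheaf.stalk p) :
    letI := functionFieldAlgebra c
    algebraMap (C.presheaf.stalk p) C.functionField r ∈ (stalkPlace c p hp).1.nonunits ↔
      ¬ IsUnit r := by
  let _ := functionFieldAlgebra c
  constructor
  · rintro hr ⟨u, rfl⟩
    have h1 := mul_mem_nonunits ((mem_stalkPlace c hp).2 ⟨(u⁻¹ : (C.presheaf.stalk p)ˣ), rfl⟩) hr
    rw [← map_mul, Units.inv_mul, map_one] at h1
    exact one_notMem_nonunits _ h1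
  · intro hr
    by_contra h0
    obtain ⟨s, hs⟩ := (mem_stalkPlace c hp).1 (inv_mem_of_notMem_nonunits h0)
    have h1 : algebraMap (C.presheaf.stalk p) C.functionField r ≠ 0 :=
      fun h1 ↦ h0 (h1 ▸ zero_mem _)
    refine hr (IsUnit.of_mul_eq_one s (IsFractionRing.injective _ C.functionField ?_))
    rw [map_mul, hs, mul_inv_cancel₀ h1, map_one]

lemma notMem_basicOpen_iff {p : C} (hp : p ≠ genericPoint C) {U : C.Opens} (hpU : p ∈ U)
    (f : Γ(C, U)) :
    letI := functionFieldAlgebra c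
    p ∉ C.basicOpen f ↔
      ratFn (mem_of_genericPoint_mem hpU) f ∈ (stalkPlace c p hp).1.nonunits := by
  let _ := functionFieldAlgebra c
  rw [Scheme.mem_basicOpen C f p hpU, ← algebraMap_germ_eq_ratFn hpU,
    algebraMap_mem_nonunits_iff_not_isUnit]

lemma ratFn_pairing (c : C ⟶ Spec (.of ℂ)) {U : C.Opens} (hU : genericPoint C ∈ U)
    (v : Fin (n + 1) → ℂ) (a : Γ(freeModule C (Fin (n + 1)), U)) :
    letI := functionFieldAlgebra c
    ratFn hU (toFn ((pairing c v).app U a)) =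
      ∑ i, ratVec hU a i * algebraMap ℂ C.functionField (v i) := by
  rw [pairing_app, map_sum]
  refine Finset.sum_congr rfl fun i _ ↦ ?_
  rw [map_mul, ratFn_map]
  rfl

/-- A vector of rational functions that is regular at `p` and orthogonal to `genericCoord h` and `w`
comes from a local section of the kernel of `π`. -/
lemma IsCoframe.exists_kernel_section (hw : IsCoframe π τ w) {p : C}
    (hinj : Function.Injective (toGenericStalk Q p)) (r : Fin (n + 1) → C.presheaf.stalk p)
    (h1 : ∑ i, algebraMap _ C.functionField (r i) * genericCoord h i = 0)
    (h2 : ∑ i, algebraMap _ C.functionField (r i) * w i = 0) :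
    ∃ (U : C.Opens) (hp : p ∈ U) (s : Γ((kernel π : C.Modules), U)),
      ratVec (mem_of_genericPoint_mem hp) ((kernel.ι π ≫ eulerInclusion h).app U s) =
        fun i ↦ algebraMap _ C.functionField (r i) := by
  obtain ⟨U, hp, a, ha⟩ := exists_germ_eq_of_finite r
  have hU := mem_of_genericPoint_mem hp
  have ha' : ratVec hU (ofCoords a) = fun i ↦ algebraMap _ C.functionField (r i) := by
    ext i
    rw [ratVec, coords_ofCoords, ← ha, algebraMap_germ_eq_ratFn]
  obtain ⟨b, hb⟩ := exists_eulerInclusion_eq (h := h) hU (ofCoords a) (by rw [ha']; exact h1)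
  have h3 : Q.presheaf.germ U p hp (π.app U b) = Q.presheaf.germ U p hp 0 := by
    refine hinj ?_
    rw [toGenericStalk_germ_eq_ratSec, toGenericStalk_germ_eq_ratSec, hw, hb, ha', h2, zero_smul,
      map_zero]
  obtain ⟨W, hpW, i, i', h4⟩ := Q.presheaf.germ_eq p hp hp _ _ h3
  rw [map_zero, ← app_map] at h4
  obtain ⟨s, hs⟩ := exists_of_kernel_app π W _ h4
  refine ⟨W, hpW, s, ?_⟩
  rw [Scheme.Modules.Hom.comp_app, AddCommGrpCat.comp_apply]
  refine (congrArg (fun m ↦ ratVec (mem_of_genericPoint_mem hpW)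
    ((eulerInclusion h).app W m)) hs).trans ?_
  simp only [app_map, ratVec_map, hb, ha']

/-- The sections of the kernel of `π` are orthogonal to the plane spanned by the generic point of
the curve and the coframe. -/
lemma IsCoframe.sum_eq_zero (hw : IsCoframe π τ w) (hτ : τ ≠ 0) {U : C.Opens}
    (hU : genericPoint C ∈ U) (s : Γ((kernel π : C.Modules), U))
    {u : Fin (n + 1) → C.functionField}
    (hu : u ∈ Submodule.span C.functionField {genericCoord h, w}) :
    ∑ i, ratVec hU ((kernel.ι π ≫ eulerInclusion h).app U s) i * u i = 0 := by
  obtain ⟨x, y, rfl⟩ := Submodule.mem_span_pair.1 hu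
  let b : Γ(pullbackOmegaOne h, U) := (kernel.ι π).app U s
  have hb : (kernel.ι π ≫ eulerInclusion h).app U s = (eulerInclusion h).app U b := rfl
  have h1 : π.app U b = 0 := by
    have h2 : (kernel.ι π ≫ π).app U s = 0 := by
      rw [kernel.condition]
      rfl
    exact h2
  have h2 := hw U hU b
  rw [h1, map_zero, eq_comm, smul_eq_zero] at h2
  have h3 := ratVec_eulerInclusion hU b
  have h4 := h2.resolve_right hτ
  rw [hb]
  simp only [Pi.add_apply, Pi.smul_apply, smul_eq_mul, mul_add, mul_left_comm _ x,
    mul_left_comm _ y, Finset.sum_add_distrib, ← Finset.mul_sum]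
  rw [h3, h4, mul_zero, mul_zero, add_zero]

/-- The fibre over `p` of `ℙ(Q') ⟶ ℙⁿ` is the line given by the reduction at `p` of the plane `Λ`
spanned by the generic point of the curve and the coframe. For every chart of `Λ` at `p`, with basis
`u`, `z`, the vectors `e_k - u_k e_i - z_k e_j` generate the annihilator of `Λ` at `p`, and they are
sections of the kernel of `π`; their vanishing at `v` says that `v` is in the reduction of `Λ`. -/
lemma fibreAt_eq (hw : IsCoframe π τ w) (hτ : τ ≠ 0)
    (hl : LinearIndependent C.functionField ![genericCoord h, w])
    {p : C} (hp : p ≠ genericPoint C) (hinj : Function.Injective (toGenericStalk Q p)) :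
    letI := functionFieldAlgebra c
    fibreAt c (kernel.ι π ≫ eulerInclusion h) p = linearSubspace (red (stalkPlace c p hp)
      (Submodule.span C.functionField {genericCoord h, w})) := by
  let _ := functionFieldAlgebra c
  set V := stalkPlace c p hp
  set Λ := Submodule.span C.functionField {genericCoord h, w}
  have hΛ2 : Module.finrank C.functionField Λ = 2 := finrank_span_pair hl
  have key (v : Fin (n + 1) → ℂ) : (∀ U : C.Opens, p ∈ U → ∀ s : Γ((kernel π : C.Modules), U),
      p ∉ C.basicOpen (U := U) (((kernel.ι π ≫ eulerInclusion h) ≫ pairing c v).app U s)) ↔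
      v ∈ red V Λ := by
    constructor
    · intro hv
      obtain ⟨i, j, u, z, hch⟩ := exists_chart V.1 hΛ2
      refine mem_red.2 ⟨_, add_mem (Λ.smul_mem (algebraMap ℂ _ (v i)) hch.u_mem)
        (Λ.smul_mem (algebraMap ℂ _ (v j)) hch.w_mem), fun k ↦ ?_⟩
      obtain ⟨r, hr⟩ := (mem_stalkPlace c hp).1 (hch.u_int k)
      obtain ⟨r', hr'⟩ := (mem_stalkPlace c hp).1 (hch.w_int k)
      -- the germ of `e_k - u_k e_i - z_k e_j`
      let a : Fin (n + 1) → C.presheaf.stalk p :=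
        Pi.single k 1 - r • Pi.single i 1 - r' • Pi.single j 1
      have ha (g : Fin (n + 1) → C.functionField) :
          ∑ l, algebraMap _ C.functionField (a l) * g l = g k - u k * g i - z k * g j := by
        have hs (m l : Fin (n + 1)) : algebraMap (C.presheaf.stalk p) C.functionField
            ((Pi.single m 1 : Fin (n + 1) → C.presheaf.stalk p) l) =
              (Pi.single m 1 : Fin (n + 1) → C.functionField) l := by
          by_cases hlm : l = m
          · subst hlm
            simp only [Pi.single_eq_same, map_one]
          · simp only [Pi.single_eq_of_ne hlm, map_zero]
        have hs' (m : Fin (n + 1)) :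
            ∑ l, (Pi.single m 1 : Fin (n + 1) → C.functionField) l * g l = g m := by
          simp only [Pi.single_apply, ite_mul, one_mul, zero_mul, Finset.sum_ite_eq',
            Finset.mem_univ, if_true]
        simp only [a, Pi.sub_apply, Pi.smul_apply, smul_eq_mul, map_sub, map_mul, hr, hr', hs,
          sub_mul, Finset.sum_sub_distrib, mul_assoc, ← Finset.mul_sum, hs']
      have ha' {g : Fin (n + 1) → C.functionField} (hg : g ∈ Λ) :
          ∑ l, algebraMap _ C.functionField (a l) * g l = 0 := by
        have := congrFun (hch.eq_add hΛ2 hg) k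
        simp only [Pi.add_apply, Pi.smul_apply, smul_eq_mul] at this
        rw [ha]
        linear_combination this
      obtain ⟨U, hpU, s, hs⟩ := hw.exists_kernel_section hinj a
        (ha' (Submodule.subset_span (by simp))) (ha' (Submodule.subset_span (by simp)))
      have h1 := (notMem_basicOpen_iff c hp hpU _).1 (hv U hpU s)
      have h2 := ratFn_pairing c (mem_of_genericPoint_mem hpU) v
        ((kernel.ι π ≫ eulerInclusion h).app U s)
      rw [hs, ha] at h2
      have h3 := neg_mem (h2 ▸ h1 : _ ∈ V.1.nonunits)
      convert h3 using 1
      simp only [Pi.add_apply, Pi.smul_apply, smul_eq_mul]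
      ring
    · intro hv U hpU s
      obtain ⟨u, hu, huv⟩ := mem_red.1 hv
      refine (notMem_basicOpen_iff c hp hpU _).2 ?_
      have hU := mem_of_genericPoint_mem hpU
      have h2 := ratFn_pairing c hU v ((kernel.ι π ≫ eulerInclusion h).app U s)
      have h3 := hw.sum_eq_zero hτ hU s hu
      have h4 : ∑ i, ratVec hU ((kernel.ι π ≫ eulerInclusion h).app U s) i *
          algebraMap ℂ C.functionField (v i) =
          -∑ i, ratVec hU ((kernel.ι π ≫ eulerInclusion h).app U s) i *
            (u i - algebraMap ℂ C.functionField (v i)) := by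
        simp only [mul_sub, Finset.sum_sub_distrib, h3]
        ring
      rw [h4] at h2
      refine Eq.mpr (congrArg (· ∈ V.1.nonunits) h2) ?_
      refine neg_mem (sum_mem fun i _ ↦ mul_mem_nonunits ?_ (huv i))
      exact (mem_stalkPlace c hp).2 ⟨_, algebraMap_germ_eq_ratFn hpU _⟩
  ext x
  constructor
  · intro hx
    obtain ⟨v, hv, rfl⟩ := exists_mk_eq x
    exact mk_mem_linearSubspace.2 ((key v).1 (hx v hv rfl))
  · rintro hx v hv rfl
    exact (key v).2 (mk_mem_linearSubspace.1 hx)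

end Fibres

/-! ### Incidence with the curve -/

section Incidence

variable {n : ℕ}

/-- The ideal of a set of points of projective space is homogeneous. -/
lemma homogeneousComponent_mem_idealOf {S : Set (PPoints n)} {f : MvPolynomial (Fin (n + 1)) ℂ}
    (hf : f ∈ idealOf S) (d : ℕ) : MvPolynomial.homogeneousComponent d f ∈ idealOf S := by
  rw [mem_idealOf_iff] at hf ⊢
  intro v hv hvS
  let P : Polynomial ℂ := ∑ k ∈ Finset.range (f.totalDegree + 1),
    Polynomial.monomial k (MvPolynomial.eval v (MvPolynomial.homogeneousComponent k f))
  have hP (t : ℂ) : P.eval t = MvPolynomial.eval (t • v) f := by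
    conv_rhs => rw [← MvPolynomial.sum_homogeneousComponent f, map_sum]
    rw [Polynomial.eval_finsetSum]
    refine Finset.sum_congr rfl fun k _ ↦ ?_
    rw [Polynomial.eval_monomial, mul_comm]
    exact (eval₂_mul_of_isHomogeneous (MvPolynomial.homogeneousComponent_isHomogeneous k f)
      (RingHom.id ℂ) t v).symm
  -- The polynomial vanishes at all nonzero numbers, since these do not move a projective point.
  have hP0 : P = 0 := by
    refine Polynomial.eq_zero_of_infinite_isRoot P (
      (Set.finite_singleton (0 : ℂ)).infinite_compl.mono
      fun t ht ↦ ?_)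
    have ht0 : t ≠ 0 := ht
    refine (hP t).trans (hf (t • v) (smul_ne_zero ht0 hv) ?_)
    rwa [(Projectivization.mk_eq_mk_iff' ℂ _ _ _ hv).2 ⟨t, rfl⟩]
  by_cases hd : d ∈ Finset.range (f.totalDegree + 1)
  · have h1 : P.coeff d = MvPolynomial.eval v (MvPolynomial.homogeneousComponent d f) := by
      rw [Polynomial.finsetSum_coeff]
      simp only [Polynomial.coeff_monomial]
      rw [Finset.sum_ite_eq_of_mem' _ _ _ hd]
    rw [← h1, hP0, Polynomial.coeff_zero]
  · rw [MvPolynomial.homogeneousComponent_eq_zero, map_zero]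
    rw [Finset.mem_range] at hd
    omega

/-- To check that a point lies on a closed subset, forms suffice. -/
lemma liesOn_of_isHomogeneous {y : PSpace n} {S : Set (PPoints n)}
    (hS : ∀ (d : ℕ) (f : MvPolynomial (Fin (n + 1)) ℂ), f.IsHomogeneous d → f ∈ idealOf S →
      f ∈ y.asHomogeneousIdeal.toIdeal) : LiesOn y S := by
  intro f hf
  rw [← MvPolynomial.sum_homogeneousComponent f]
  exact Ideal.sum_mem _ fun d _ ↦ hS d _ (MvPolynomial.homogeneousComponent_isHomogeneous d f)
    (homogeneousComponent_mem_idealOf hf d)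

variable {C : Scheme.{0}} [IsIntegral C] (h : C ⟶ PSpace n)

/-- A form, evaluated at the coordinates of the curve in the local ring at `x`, as a rational
function. -/
lemma algebraMap_eval₂_coordFn {x : C} {j : Fin (n + 1)} (hj : x ∈ chartOpen h j)
    (f : MvPolynomial (Fin (n + 1)) ℂ) :
    letI := functionFieldAlgebra (h ≫ PSpace.toSpec n)
    algebraMap (C.presheaf.stalk x) C.functionField (f.eval₂
      ((pullbackFraction h x).comp (constFraction (h x)))
      (fun i ↦ C.presheaf.germ _ x hj (coordFn h i j))) =
    MvPolynomial.aeval (fun i ↦ genericCoord h i / genericCoord h j) f := by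
  let _ := functionFieldAlgebra (h ≫ PSpace.toSpec n)
  have h1 : (algebraMap (C.presheaf.stalk x) C.functionField).comp
      ((pullbackFraction h x).comp (constFraction (h x))) = algebraMap ℂ C.functionField := by
    ext a
    rw [RingHom.comp_apply, RingHom.comp_apply, ← germ_constFn]
    exact algebraMap_germ (U := ⊤) trivial _
  rw [MvPolynomial.eval₂_comp_left, h1, MvPolynomial.aeval_def]
  congr 1
  ext i
  rw [Function.comp_apply, algebraMap_germ_eq_ratFn, ratFn_coordFn]

variable {h} [SmoothOfRelativeDimension 1 (h ≫ PSpace.toSpec n)]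
  {w : Fin (n + 1) → C.functionField}

/-- The curve lies on the scroll: its generic point is a point of the generic line. -/
lemma imageIn_scroll (hl : LinearIndependent C.functionField ![genericCoord h, w]) :
    letI := functionFieldAlgebra (h ≫ PSpace.toSpec n)
    haveI := isCurveField_functionField (h ≫ PSpace.toSpec n)
    ImageIn h (scroll (Submodule.span C.functionField {genericCoord h, w})) := by
  let _ := functionFieldAlgebra (h ≫ PSpace.toSpec n)
  have := isCurveField_functionField (h ≫ PSpace.toSpec n)
  refine fun x ↦ liesOn_of_isHomogeneous fun d f hfd hf ↦ ?_
  obtain ⟨j, hj⟩ : ∃ j, x ∈ chartOpen h j := exists_coord_notMem (h x)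
  rw [mem_asHomogeneousIdeal_iff h x j hj hfd]
  have h1 := (planeRestriction_eq_zero_iff rfl f).1 ((mem_idealOf_scroll_iff rfl hl).1 hf)
    _ (Submodule.smul_mem _ (genericCoord h j)⁻¹ (Submodule.subset_span (Set.mem_insert _ _)))
  have h2 := algebraMap_eval₂_coordFn h hj f
  have h3 : (fun i ↦ genericCoord h i / genericCoord h j) =
      (genericCoord h j)⁻¹ • genericCoord h := by
    ext i
    rw [Pi.smul_apply, smul_eq_mul, div_eq_inv_mul]
  rw [h3, h1] at h2
  rw [IsFractionRing.injective _ C.functionField (h2.trans (map_zero _).symm)]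
  exact not_isUnit_zero

/-- The line over `p` passes through `h p`, because the plane contains the generic point of the
curve. -/
lemma liesOn_red (w : Fin (n + 1) → C.functionField) {p : C} (hp : p ≠ genericPoint C) :
    letI := functionFieldAlgebra (h ≫ PSpace.toSpec n)
    LiesOn (h p) (linearSubspace (red (stalkPlace (h ≫ PSpace.toSpec n) p hp)
      (Submodule.span C.functionField {genericCoord h, w}))) := by
  let _ := functionFieldAlgebra (h ≫ PSpace.toSpec n)
  have := isCurveField_functionField (h ≫ PSpace.toSpec n)
  refine liesOn_of_isHomogeneous fun d f hfd hf ↦ ?_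
  obtain ⟨j, hj⟩ : ∃ j, p ∈ chartOpen h j := exists_coord_notMem (h p)
  have hj0 : genericCoord h j ≠ 0 := genericCoord_ne_zero (mem_of_genericPoint_mem hj)
  rw [mem_asHomogeneousIdeal_iff h p j hj hfd,
    ← algebraMap_mem_nonunits_iff_not_isUnit (h ≫ PSpace.toSpec n) hp, algebraMap_eval₂_coordFn]
  set V := stalkPlace (h ≫ PSpace.toSpec n) p hp
  let u : Fin (n + 1) → C.functionField := fun i ↦ genericCoord h i / genericCoord h j
  have hu (i) : u i ∈ V.1 := genericCoord_div_mem _ hp hj i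
  have huΛ : u ∈ Submodule.span C.functionField {genericCoord h, w} := by
    have h3 : u = (genericCoord h j)⁻¹ • genericCoord h := by
      ext i
      rw [Pi.smul_apply, smul_eq_mul, ← div_eq_inv_mul]
    rw [h3]
    exact Submodule.smul_mem _ _ (Submodule.subset_span (Set.mem_insert _ _))
  have h1 : resVec V u ≠ 0 := by
    intro h0
    have h2 : resVec V u j = 1 := resVec_eq (by
      rw [map_one, show u j = 1 from div_self hj0, sub_self]
      exact zero_mem _)
    rw [h0] at h2
    exact zero_ne_one h2
  have h2 := aeval_sub_mem_nonunits (fun k ↦ sub_resVec_mem (hu k)) f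
  rwa [mem_idealOf_iff.1 hf _ h1 (mk_mem_linearSubspace.2 (resVec_mem_red huΛ hu)), map_zero,
    sub_zero] at h2

/-- If the lines of the scroll do not vary, the curve lies on a line. -/
lemma exists_line_of_red_eq (hl : LinearIndependent C.functionField ![genericCoord h, w])
    (hred : letI := functionFieldAlgebra (h ≫ PSpace.toSpec n)
      ∀ V V' : Place C.functionField, red V (Submodule.span C.functionField {genericCoord h, w}) =
        red V' (Submodule.span C.functionField {genericCoord h, w})) :
    ∃ l : Set (PPoints n), IsLine l ∧ ImageIn h l := by
  let _ := functionFieldAlgebra (h ≫ PSpace.toSpec n)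
  have := isCurveField_functionField (h ≫ PSpace.toSpec n)
  obtain ⟨V⟩ : Nonempty (Place C.functionField) := inferInstance
  refine ⟨_, ⟨_, finrank_red V (finrank_span_pair hl), rfl⟩, ?_⟩
  have h1 : scroll (Submodule.span C.functionField {genericCoord h, w}) =
      linearSubspace (red V (Submodule.span C.functionField {genericCoord h, w})) := by
    rw [scroll]
    simp_rw [hred _ V]
    exact Set.iUnion_const _
  rw [← h1]
  exact imageIn_scroll hl

/-- The degree of the scroll is finite, and bounded by the degree of the plane. -/
lemma exists_surfaceDegree_eq (hl : LinearIndependent C.functionField ![genericCoord h, w]) :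
    letI := functionFieldAlgebra (h ≫ PSpace.toSpec n)
    haveI := isCurveField_functionField (h ≫ PSpace.toSpec n)
    ∀ V V' : Place C.functionField, red V (Submodule.span C.functionField {genericCoord h, w}) ≠
        red V' (Submodule.span C.functionField {genericCoord h, w}) →
      ∃ d : ℕ, surfaceDegree (scroll (Submodule.span C.functionField {genericCoord h, w})) = d ∧
        (d : ℤ) ≤ planeDegree (genericCoord h) w := by
  let _ := functionFieldAlgebra (h ≫ PSpace.toSpec n)
  have := isCurveField_functionField (h ≫ PSpace.toSpec n)
  intro V V' hV
  have h1 := surfaceDegree_scroll_le rfl hl hV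
  have h2 := one_le_planeDegree rfl hl hV
  obtain ⟨d, hd⟩ := ENat.ne_top_iff_exists.1 (ne_top_of_le_ne_top (ENat.natCast_ne_top _) h1)
  refine ⟨d, hd.symm, ?_⟩
  rw [← hd, Nat.cast_le] at h1
  omega

variable {Q : C.Modules} {π : pullbackOmegaOne h ⟶ Q} {τ : genericStalk Q}

lemma quotientLine_eq (hw : IsCoframe π τ w) (hτ : τ ≠ 0)
    (hl : LinearIndependent C.functionField ![genericCoord h, w])
    {p : C} (hp : p ≠ genericPoint C) (hinj : Function.Injective (toGenericStalk Q p)) :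
    letI := functionFieldAlgebra (h ≫ PSpace.toSpec n)
    quotientLine h π p = linearSubspace (red (stalkPlace (h ≫ PSpace.toSpec n) p hp)
      (Submodule.span C.functionField {genericCoord h, w})) :=
  fibreAt_eq _ hw hτ hl hp hinj

lemma isLine_quotientLine (hw : IsCoframe π τ w) (hτ : τ ≠ 0)
    (hl : LinearIndependent C.functionField ![genericCoord h, w])
    {p : C} (hp : p ≠ genericPoint C) (hinj : Function.Injective (toGenericStalk Q p)) :
    IsLine (quotientLine h π p) ∧ LiesOn (h p) (quotientLine h π p) := by
  let _ := functionFieldAlgebra (h ≫ PSpace.toSpec n)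
  have := isCurveField_functionField (h ≫ PSpace.toSpec n)
  have h1 := finrank_red (stalkPlace (h ≫ PSpace.toSpec n) p hp) (finrank_span_pair hl)
  rw [quotientLine_eq hw hτ hl hp hinj]
  exact ⟨⟨_, h1, rfl⟩, liesOn_red w hp⟩

variable [IsProper (h ≫ PSpace.toSpec n)]

/-- The image of `ℙ(Q') ⟶ ℙⁿ` is the scroll of the plane spanned by the generic point of the curve
and the coframe, since the closed points of the curve are the places of its function field. -/
lemma quotientScroll_eq (hw : IsCoframe π τ w) (hτ : τ ≠ 0)
    (hl : LinearIndependent C.functionField ![genericCoord h, w])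
    (hinj : ∀ p, Function.Injective (toGenericStalk Q p)) :
    letI := functionFieldAlgebra (h ≫ PSpace.toSpec n)
    quotientScroll h π = scroll (Submodule.span C.functionField {genericCoord h, w}) := by
  let _ := functionFieldAlgebra (h ≫ PSpace.toSpec n)
  ext x
  simp only [quotientScroll, scroll, Set.mem_iUnion, exists_prop]
  constructor
  · rintro ⟨p, hp, hx⟩
    have hpg := ne_genericPoint_of_isClosed (h ≫ PSpace.toSpec n) hp
    rw [quotientLine_eq hw hτ hl hpg (hinj p)] at hx
    exact ⟨_, hx⟩
  · rintro ⟨V, hx⟩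
    obtain ⟨p, hpg, hp, rfl⟩ := exists_stalkPlace_eq V
    refine ⟨p, hp, ?_⟩
    rwa [quotientLine_eq hw hτ hl hpg (hinj p)]

end Incidence

end Scrolls

end

theorem mainTheorem4 (n : ℕ) (C : Scheme.{0}) [IsIntegral C] (c : C ⟶ Spec (.of ℂ))
    [IsProper c] [SmoothOfRelativeDimension 1 c]
    (h : C ⟶ PSpace n) (hc : h ≫ PSpace.toSpec n = c)
    (hinj : ∃ U : C.Opens, (U : Set C).Nonempty ∧ Set.InjOn h (U : Set C))
    (e : ℤ) (he : HasDegree (pullbackOOne h) e) :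
    (∀ (Q : C.Modules) (π : pullbackOmegaOne h ⟶ Q), Epi π → IsLineBundle Q →
      ∀ m : ℤ, HasDegree Q (-m) →
      ¬ (m = e ∧ ∃ l : Set (PPoints n), IsLine l ∧ ImageIn h l) →
        (∀ p : C, IsClosed ({p} : Set C) →
          IsLine (quotientLine h π p) ∧ LiesOn (h p) (quotientLine h π p)) ∧
        IsSurfaceScroll (quotientScroll h π) ∧
        ImageIn h (quotientScroll h π) ∧
        ∃ d : ℕ, surfaceDegree (quotientScroll h π) = d ∧ (d : ℤ) ≤ e - m) ∧
    (∀ k : ℤ, (¬ ∃ l : Set (PPoints n), IsLine l ∧ ImageIn h l) →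
      (∀ S : Set (PPoints n), IsSurfaceScroll S → ImageIn h S →
        ∀ d : ℕ, surfaceDegree S = d → k ≤ d) →
      ∀ (Q : C.Modules) (π : pullbackOmegaOne h ⟶ Q), Epi π →
        SheafOfModules.IsQuasicoherent Q → IsRankOne Q →
        ∀ q : ℤ, HasDegree Q q → k - e ≤ q) := by
  subst hc
  let _ := functionFieldAlgebra (h ≫ PSpace.toSpec n)
  have := isCurveField_functionField (h ≫ PSpace.toSpec n)
  refine ⟨fun Q π hπ hQ m hm hexc ↦ ?_, fun k hline hk Q π hπ _ hQ q hq ↦ ?_⟩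
  · obtain ⟨τ, w, hτ, hτ', hw, hl⟩ := exists_isCoframe_of_isRankOne (π := π) hQ.2
    have htor := toGenericStalk_injective_of_isLineBundle hQ
    have hdeg := (planeDegree_le_add (h ≫ PSpace.toSpec n) hτ hτ' hw hl he hm).2 htor
    -- if the lines do not vary, the plane has degree zero: this is the excluded case
    obtain ⟨V, V', hV⟩ : ∃ V V' : Place C.functionField,
        red V (Submodule.span C.functionField {genericCoord h, w}) ≠
          red V' (Submodule.span C.functionField {genericCoord h, w}) := by
      by_contra! hred
      have h1 := planeDegree_eq_zero rfl hl hred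
      exact hexc ⟨by omega, exists_line_of_red_eq hl hred⟩
    rw [quotientScroll_eq hw hτ hl htor]
    obtain ⟨d, hd, hd'⟩ := exists_surfaceDegree_eq hl V V' hV
    refine ⟨fun p hp ↦ ?_, isSurfaceScroll_scroll rfl hl hV, imageIn_scroll hl, d, hd, by omega⟩
    have hpg := ne_genericPoint_of_isClosed (h ≫ PSpace.toSpec n) hp
    exact isLine_quotientLine hw hτ hl hpg (htor p)
  · obtain ⟨τ, w, hτ, hτ', hw, hl⟩ := exists_isCoframe_of_isRankOne (π := π) hQ
    have hdeg := (planeDegree_le_add (h ≫ PSpace.toSpec n) hτ hτ' hw hl he hq).1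
    obtain ⟨V, V', hV⟩ : ∃ V V' : Place C.functionField,
        red V (Submodule.span C.functionField {genericCoord h, w}) ≠
          red V' (Submodule.span C.functionField {genericCoord h, w}) := by
      by_contra! hred
      exact hline (exists_line_of_red_eq hl hred)
    obtain ⟨d, hd, hd'⟩ := exists_surfaceDegree_eq hl V V' hV
    have := hk _ (isSurfaceScroll_scroll rfl hl hV) (imageIn_scroll hl) d hd
    omega
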